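/- Let $q\in\mathbb C$ be a primitive $n$-th root of unity, $n>2$, $n\neq 4$; put $d=n$ if $n$ is odd and $d=n/2$ if $n$ is even, and **assume that $d$ is odd**. Let $u_q=u_q(\mathfrak{sl}_2(\mathbb C))$ be the $\mathbb C$-algebra generated by $E,F,K$ with relations $E^d=F^d=0$, $K^d=1$, $KE=q^2EK$, $KF=q^{-2}FK$, $EF-FE=\frac{K-K^{-1}}{q-q^{-1}}$, with comultiplication $\Delta(E)=1\otimes E+E\otimes K$, $\Delta(F)=K^{-1}\otimes F+F\otimes 1$, $\Delta(K)=K\otimes K$, and with $R$-matrix $$R=\frac1d\sum_{0\le i,j,k\le d-1}\frac{(q-q^{-1})^k}{[k]!}\,q^{k(k-1)/2+2k(i-j)-2ij}\,E^kK^i\otimes F^kK^j ,$$ where $[m]=\frac{q^m-q^{-m}}{q-q^{-1}}$ and $[k]!=[1][2]\cdots[k]$. Let $u_q^+\subset u_q$ be the subalgebra generated by $E$ and $K$; $\Delta$ restricts to it, and tensor products over $\mathbb C$ of $u_q^+$-modules (and of $u_q$-modules) are modules through $\Delta$. For $l\in\mathbb Z/d\mathbb Z$ let $S_l$ be the one-dimensional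 $u_q^+$-module on which $E=0$ and $K=q^{2l}$. Let $\tau$ be the flip of tensor factors. *Construction of $c_{U,V}$.* A $u_q^+$-module of the form $S_l\otimes X$, with $X$ (the restriction to $u_q^+$ of) a $u_q$-module, is called a shifted module. For $u_q$-modules $X,Y$ there is the isomorphism of $u_q^+$-modules $$(S_l\otimes X)\otimes(S_m\otimes Y)\cong S_{l+m}\otimes(X\otimes Y),\qquad (s\otimes x)\otimes(t\otimes y)\mapsto st\otimes(K^{-m}x\otimes y),\tag{1}$$ and $c_{S_l\otimes X,\,S_m\otimes Y}$ is the map $(S_l\otimes X)\otimes(S_m\otimes Y)\to(S_m\otimes Y)\otimes(S_l\otimes X)$ that corresponds under (1) to $\mathrm{id}\otimes\tau R: S_{l+m}\otimes (X\otimes Y)\to S_{l+m}\otimes (Y\otimes X)$. If $U$ and $V$ are $u_q^+$-modules with given decompositions into finite direct sums of shifted modules, $c_{U,V}:U\otimes V\to V\otimes U$ is defined summand by summand. The module $U\otimes V$ is then given the decomposition whose summands are the $(S_l\otimes X)\otimes(S_m\otimes Y)$, identified with $S_{l+m}\otimes(X\otimes Y)$ by (1). **Corollary 4.2.** 1. Every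 finite-dimensional $u_q^+$-module is a finite direct sum of shifted modules (so that $c_{U,V}$ is defined for all finite-dimensional $U,V$, once decompositions are chosen), and the maps $c_{U,V}$ are isomorphisms of $u_q^+$-modules. 2. For all $u_q^+$-modules $U,V,W$ with such decompositions, $$c_{U,V\otimes W}=(\mathrm{id}_V\otimes c_{U,W})(c_{U,V}\otimes \mathrm{id}_W),\qquad c_{U\otimes V,W}=(c_{U,W}\otimes \mathrm{id}_V)(\mathrm{id}_U\otimes c_{V,W}),$$ $$(\mathrm{id}_W\otimes c_{U,V})(c_{U,W}\otimes \mathrm{id}_V)(\mathrm{id}_U\otimes c_{V,W})=(c_{V,W}\otimes \mathrm{id}_U)(\mathrm{id}_V\otimes c_{U,W})(c_{U,V}\otimes \mathrm{id}_W).$$ 3. The isomorphisms $c_{U,V}$ are not natural: there are finite-dimensional $u_q^+$-modules $U,U',V$ and a $u_q^+$-linear map $f:U\to U'$ such that $(\mathrm{id}_V\otimes f)\,c_{U,V}\neq c_{U',V}\,(f\otimes \mathrm{id}_V)$ for all choices of decompositions of $U$, $U'$ and $V$. -/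

import Mathlib

open scoped TensorProduct

universe u

noncomputable section

/-! ### The parameter `q` -/

/-- A primitive `n`-th root of unity `q` in `ℂ`, with `n ≠ 4`, and `n > 2` so that `q - q⁻¹ ≠ 0`. -/
structure RootData where
  n : ℕ
  q : ℂ
  prim : IsPrimitiveRoot q n
  two_lt : 2 < n
  ne_four : n ≠ 4

namespace RootData

/-- `d = n` if `n` is odd and `d = n / 2` if `n` is even; it is the order of `q ^ 2`. -/
def d (P : RootData) : ℕ := if Odd P.n then P.n else P.n / 2

theorem one_lt_d (P : RootData) : 1 < P.d := by
  have h1 := P.two_lt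
  have h2 := P.ne_four
  unfold d
  split_ifs with h
  · omega
  · rw [Nat.odd_iff] at h
    omega

theorem d_pos (P : RootData) : 0 < P.d := lt_trans Nat.zero_lt_one P.one_lt_d

instance (P : RootData) : NeZero P.d := ⟨P.d_pos.ne'⟩

theorem prim_sq (P : RootData) : IsPrimitiveRoot (P.q ^ 2) P.d := by
  unfold d
  split_ifs with h
  · exact P.prim.pow_of_coprime 2 (Nat.coprime_two_left.mpr h)
  · exact P.prim.pow_of_dvd two_ne_zero (even_iff_two_dvd.mp (Nat.not_odd_iff_even.mp h))

theorem q_ne_zero (P : RootData) : P.q ≠ 0 :=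
  P.prim.ne_zero (by have := P.two_lt; omega)

end RootData

/-! ### The `q`-binomial formula, used to see that comultiplication is well defined -/

/-- Gaussian binomial coefficients in the variable `w`. -/
def gaussBinom (w : ℂ) : ℕ → ℕ → ℂ
  | _, 0 => 1
  | 0, _ + 1 => 0
  | n + 1, k + 1 => gaussBinom w n k + w ^ (k + 1) * gaussBinom w n (k + 1)

theorem gaussBinom_zero_right (w : ℂ) (n : ℕ) : gaussBinom w n 0 = 1 := by
  cases n <;> rfl

theorem gaussBinom_of_lt (w : ℂ) (n : ℕ) : ∀ k, n < k → gaussBinom w n k = 0 := by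
  induction n with
  | zero =>
    intro k hk
    cases k with
    | zero => omega
    | succ k => rfl
  | succ n ih =>
    intro k hk
    cases k with
    | zero => omega
    | succ k =>
      rw [gaussBinom, ih k (by omega), ih (k + 1) (by omega)]
      simp

theorem gaussBinom_absorb (w : ℂ) (n : ℕ) : ∀ k,
    (1 - w ^ (k + 1)) * gaussBinom w (n + 1) (k + 1) = (1 - w ^ (n + 1)) * gaussBinom w n k := by
  induction n with
  | zero =>
    intro k
    cases k with
    | zero => simp [gaussBinom]
    | succ k => simp [gaussBinom]
  | succ n ih =>
    intro k
    have h0 := ih k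
    have h1 : gaussBinom w (n + 2) (k + 1) =
      gaussBinom w (n + 1) k + w ^ (k + 1) * gaussBinom w (n + 1) (k + 1) := rfl
    cases k with
    | zero =>
      rw [h1]
      simp only [gaussBinom_zero_right] at h0 ⊢
      linear_combination w * h0
    | succ k =>
      have h2 := ih k
      have h3 : gaussBinom w (n + 1) (k + 1) =
        gaussBinom w n k + w ^ (k + 1) * gaussBinom w n (k + 1) := rfl
      rw [h1]
      linear_combination w ^ (k + 2) * h0 + w * h2 - w * (1 - w ^ (n + 1)) * h3

theorem gaussBinom_eq_zero {w : ℂ} {d : ℕ} (hw : IsPrimitiveRoot w d) (k : ℕ)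
    (hk0 : 0 < k) (hkd : k < d) : gaussBinom w d k = 0 := by
  obtain ⟨k, rfl⟩ : ∃ j, k = j + 1 := ⟨k - 1, by omega⟩
  obtain ⟨m, rfl⟩ : ∃ m, d = m + 1 := ⟨d - 1, by omega⟩
  have h := gaussBinom_absorb w m k
  rw [hw.pow_eq_one, sub_self, zero_mul] at h
  rcases mul_eq_zero.mp h with h | h
  · exact absurd (sub_eq_zero.mp h).symm (hw.pow_ne_one_of_pos_of_lt hk0.ne' hkd)
  · exact h

theorem qCommute_pow {A : Type*} [Ring A] [Algebra ℂ A] {w : ℂ} {x y : A}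
    (h : y * x = w • (x * y)) (k : ℕ) : y * x ^ k = w ^ k • (x ^ k * y) := by
  induction k with
  | zero => simp
  | succ k ih =>
    rw [pow_succ x, ← mul_assoc, ih, smul_mul_assoc, mul_assoc, h, mul_smul_comm, smul_smul,
      ← mul_assoc, pow_succ w]

theorem qCommute_add_pow {A : Type*} [Ring A] [Algebra ℂ A] {w : ℂ} {x y : A}
    (h : y * x = w • (x * y)) (n : ℕ) :
    (x + y) ^ n = ∑ k ∈ Finset.range (n + 1), gaussBinom w n k • (x ^ k * y ^ (n - k)) := by
  induction n with
  | zero => simp [gaussBinom]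
  | succ n ih =>
    have e1 : x * ∑ k ∈ Finset.range (n + 1), gaussBinom w n k • (x ^ k * y ^ (n - k)) =
        ∑ k ∈ Finset.range (n + 1), gaussBinom w n k • (x ^ (k + 1) * y ^ (n - k)) := by
      rw [Finset.mul_sum]
      refine Finset.sum_congr rfl fun k _ => ?_
      rw [mul_smul_comm, ← mul_assoc, ← pow_succ']
    have e2 : y * ∑ k ∈ Finset.range (n + 1), gaussBinom w n k • (x ^ k * y ^ (n - k)) =
        ∑ k ∈ Finset.range (n + 2), (w ^ k * gaussBinom w n k) • (x ^ k * y ^ (n + 1 - k)) := by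
      rw [Finset.sum_range_succ _ (n + 1), gaussBinom_of_lt w n (n + 1) (by omega), mul_zero,
        zero_smul, add_zero, Finset.mul_sum]
      refine Finset.sum_congr rfl fun k hk => ?_
      have hk' : k ≤ n := by simpa [Nat.lt_succ_iff] using hk
      rw [mul_smul_comm, ← mul_assoc, qCommute_pow h, smul_mul_assoc, mul_assoc, ← pow_succ',
        smul_smul, mul_comm, Nat.succ_sub hk']
    rw [pow_succ', ih, add_mul, e1, e2, Finset.sum_range_succ' _ (n + 1),
      Finset.sum_range_succ' _ (n + 1), ← add_assoc, ← Finset.sum_add_distrib]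
    congr 1
    · refine Finset.sum_congr rfl fun k _ => ?_
      rw [gaussBinom, add_smul, Nat.add_sub_add_right]
    · simp [gaussBinom_zero_right]

theorem qCommute_add_pow_eq_zero {A : Type*} [Ring A] [Algebra ℂ A] {w : ℂ} {d : ℕ}
    (hd : 0 < d) (hw : IsPrimitiveRoot w d) {x y : A}
    (h : y * x = w • (x * y)) (hx : x ^ d = 0) (hy : y ^ d = 0) : (x + y) ^ d = 0 := by
  rw [qCommute_add_pow h]
  refine Finset.sum_eq_zero fun k hk => ?_
  have hk' : k ≤ d := by simpa [Nat.lt_succ_iff] using hk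
  rcases Nat.eq_zero_or_pos k with rfl | hk0
  · simp [hy]
  · rcases hk'.lt_or_eq with hlt | rfl
    · rw [gaussBinom_eq_zero hw k hk0 hlt, zero_smul]
    · simp [hx]

/-! ### The algebra `u_q(sl₂)` by generators and relations -/

inductive UqGen
  | E
  | F
  | K

/-- The defining relations. Since `K ^ d = 1`, the element `K⁻¹` is written `K ^ (d - 1)`. -/
inductive UqRel (P : RootData) : FreeAlgebra ℂ UqGen → FreeAlgebra ℂ UqGen → Prop
  | E_pow : UqRel P (FreeAlgebra.ι ℂ UqGen.E ^ P.d) 0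
  | F_pow : UqRel P (FreeAlgebra.ι ℂ UqGen.F ^ P.d) 0
  | K_pow : UqRel P (FreeAlgebra.ι ℂ UqGen.K ^ P.d) 1
  | K_E : UqRel P (FreeAlgebra.ι ℂ UqGen.K * FreeAlgebra.ι ℂ UqGen.E)
      (P.q ^ 2 • (FreeAlgebra.ι ℂ UqGen.E * FreeAlgebra.ι ℂ UqGen.K))
  | K_F : UqRel P (FreeAlgebra.ι ℂ UqGen.K * FreeAlgebra.ι ℂ UqGen.F)
      ((P.q ^ 2)⁻¹ • (FreeAlgebra.ι ℂ UqGen.F * FreeAlgebra.ι ℂ UqGen.K))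
  | E_F : UqRel P (FreeAlgebra.ι ℂ UqGen.E * FreeAlgebra.ι ℂ UqGen.F
        - FreeAlgebra.ι ℂ UqGen.F * FreeAlgebra.ι ℂ UqGen.E)
      ((P.q - P.q⁻¹)⁻¹ • (FreeAlgebra.ι ℂ UqGen.K - FreeAlgebra.ι ℂ UqGen.K ^ (P.d - 1)))

/-- The algebra `u_q(sl₂(ℂ))`. -/
def Uq (P : RootData) : Type := RingQuot (UqRel P)

instance (P : RootData) : Ring (Uq P) := inferInstanceAs (Ring (RingQuot (UqRel P)))

instance (P : RootData) : Algebra ℂ (Uq P) := inferInstanceAs (Algebra ℂ (RingQuot (UqRel P)))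

namespace Uq

variable (P : RootData)

/-- The quotient map from the free algebra. -/
def mk : FreeAlgebra ℂ UqGen →ₐ[ℂ] Uq P := RingQuot.mkAlgHom ℂ (UqRel P)

theorem mk_rel {x y : FreeAlgebra ℂ UqGen} (h : UqRel P x y) : mk P x = mk P y :=
  RingQuot.mkAlgHom_rel ℂ h

def E : Uq P := mk P (FreeAlgebra.ι ℂ UqGen.E)
def F : Uq P := mk P (FreeAlgebra.ι ℂ UqGen.F)
def K : Uq P := mk P (FreeAlgebra.ι ℂ UqGen.K)

theorem E_pow : E P ^ P.d = 0 := by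
  simpa [E] using mk_rel P UqRel.E_pow

theorem F_pow : F P ^ P.d = 0 := by
  simpa [F] using mk_rel P UqRel.F_pow

theorem K_pow : K P ^ P.d = 1 := by
  simpa [K] using mk_rel P UqRel.K_pow

theorem K_mul_E : K P * E P = P.q ^ 2 • (E P * K P) := by
  simpa only [E, K, map_mul, map_smul] using mk_rel P UqRel.K_E

theorem K_mul_F : K P * F P = (P.q ^ 2)⁻¹ • (F P * K P) := by
  simpa only [F, K, map_mul, map_smul] using mk_rel P UqRel.K_F

theorem E_mul_F : E P * F P - F P * E P =
    (P.q - P.q⁻¹)⁻¹ • (K P - K P ^ (P.d - 1)) := by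
  simpa only [E, F, K, map_mul, map_smul, map_sub, map_pow] using
    mk_rel P UqRel.E_F

theorem K_pow_mul_E (k : ℕ) : K P ^ k * E P = (P.q ^ 2) ^ k • (E P * K P ^ k) := by
  induction k with
  | zero => simp
  | succ k ih =>
    rw [pow_succ, mul_assoc, K_mul_E, mul_smul_comm, ← mul_assoc, ih, smul_mul_assoc, smul_smul,
      mul_assoc, ← pow_succ, ← pow_succ']

/-- The universal property of `u_q`. -/
theorem exists_lift {A : Type*} [Ring A] [Algebra ℂ A] (e f k : A)
    (he : e ^ P.d = 0) (hf : f ^ P.d = 0) (hk : k ^ P.d = 1)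
    (hke : k * e = P.q ^ 2 • (e * k)) (hkf : k * f = (P.q ^ 2)⁻¹ • (f * k))
    (hef : e * f - f * e = (P.q - P.q⁻¹)⁻¹ • (k - k ^ (P.d - 1))) :
    ∃ φ : Uq P →ₐ[ℂ] A, φ (E P) = e ∧ φ (F P) = f ∧ φ (K P) = k := by
  let g : UqGen → A := fun x => match x with
    | UqGen.E => e
    | UqGen.F => f
    | UqGen.K => k
  have hg : ∀ ⦃x y⦄, UqRel P x y → FreeAlgebra.lift ℂ g x = FreeAlgebra.lift ℂ g y := by
    intro x y h
    cases h
    · simpa [g] using he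
    · simpa [g] using hf
    · simpa [g] using hk
    · simpa [g] using hke
    · simpa [g] using hkf
    · simpa [g] using hef
  let φ : Uq P →ₐ[ℂ] A := RingQuot.liftAlgHom ℂ ⟨FreeAlgebra.lift ℂ g, hg⟩
  have hφ : ∀ x, φ (mk P x) = FreeAlgebra.lift ℂ g x :=
    fun x => RingQuot.liftAlgHom_mkAlgHom_apply ℂ (FreeAlgebra.lift ℂ g) hg x
  refine ⟨φ, ?_, ?_, ?_⟩
  · rw [E, hφ, FreeAlgebra.lift_ι_apply]
  · rw [F, hφ, FreeAlgebra.lift_ι_apply]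
  · rw [K, hφ, FreeAlgebra.lift_ι_apply]

theorem pow_pred_mul_K : K P ^ (P.d - 1) * K P = 1 := by
  rw [← pow_succ, Nat.sub_add_cancel P.d_pos, K_pow]

theorem K_mul_pow_pred : K P * K P ^ (P.d - 1) = 1 := by
  rw [← pow_succ', Nat.sub_add_cancel P.d_pos, K_pow]

theorem pow_pred_mul_of_K_mul {x : Uq P} {c : ℂ} (hc : c ≠ 0)
    (h : K P * x = c • (x * K P)) :
    K P ^ (P.d - 1) * x = c⁻¹ • (x * K P ^ (P.d - 1)) := by
  have h1 : K P ^ (P.d - 1) * (K P * x) * K P ^ (P.d - 1)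
      = c • (K P ^ (P.d - 1) * x) := by
    rw [h, mul_smul_comm, smul_mul_assoc, mul_assoc, mul_assoc, K_mul_pow_pred, mul_one]
  rw [← mul_assoc (K P ^ (P.d - 1)), pow_pred_mul_K, one_mul] at h1
  rw [h1, smul_smul, inv_mul_cancel₀ hc, one_smul]

theorem exists_comul : ∃ φ : Uq P →ₐ[ℂ] (Uq P ⊗[ℂ] Uq P),
    φ (E P) = 1 ⊗ₜ E P + E P ⊗ₜ K P ∧
    φ (F P) = (K P ^ (P.d - 1)) ⊗ₜ F P + F P ⊗ₜ 1 ∧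
    φ (K P) = K P ⊗ₜ K P := by
  have hq : P.q ^ 2 ≠ 0 := pow_ne_zero 2 P.q_ne_zero
  have hKE := pow_pred_mul_of_K_mul P hq (K_mul_E P)
  have hKF := pow_pred_mul_of_K_mul P (inv_ne_zero hq) (K_mul_F P)
  rw [inv_inv] at hKF
  apply exists_lift
  · apply qCommute_add_pow_eq_zero P.d_pos P.prim_sq
    · simp only [Algebra.TensorProduct.tmul_mul_tmul, one_mul, mul_one, K_mul_E,
        TensorProduct.tmul_smul]
    · rw [Algebra.TensorProduct.tmul_pow, E_pow, TensorProduct.tmul_zero]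
    · rw [Algebra.TensorProduct.tmul_pow, E_pow, TensorProduct.zero_tmul]
  · rw [add_comm]
    apply qCommute_add_pow_eq_zero P.d_pos P.prim_sq
    · simp only [Algebra.TensorProduct.tmul_mul_tmul, one_mul, mul_one, hKF,
        TensorProduct.smul_tmul']
    · rw [Algebra.TensorProduct.tmul_pow, F_pow, TensorProduct.zero_tmul]
    · rw [Algebra.TensorProduct.tmul_pow, F_pow, TensorProduct.tmul_zero]
  · rw [Algebra.TensorProduct.tmul_pow, K_pow]
    rfl
  · simp only [mul_add, add_mul, Algebra.TensorProduct.tmul_mul_tmul, one_mul, mul_one, K_mul_E,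
      TensorProduct.tmul_smul, TensorProduct.smul_tmul', smul_add]
  · have hcomm : K P * K P ^ (P.d - 1) = K P ^ (P.d - 1) * K P := by
      rw [K_mul_pow_pred, pow_pred_mul_K]
    simp only [mul_add, add_mul, Algebra.TensorProduct.tmul_mul_tmul, one_mul, mul_one, K_mul_F,
      TensorProduct.tmul_smul, TensorProduct.smul_tmul', smul_add, hcomm]
  · have hEF : E P * F P = F P * E P + (P.q - P.q⁻¹)⁻¹ • (K P - K P ^ (P.d - 1)) := by
      rw [← E_mul_F]; abel
    simp only [mul_add, add_mul, Algebra.TensorProduct.tmul_mul_tmul, one_mul, mul_one, K_mul_F,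
      hKE, hEF, Algebra.TensorProduct.tmul_pow, TensorProduct.tmul_add, TensorProduct.add_tmul,
      TensorProduct.tmul_sub, TensorProduct.sub_tmul, smul_sub, TensorProduct.tmul_smul,
      TensorProduct.smul_tmul']
    abel

/-- The comultiplication `Δ(E) = 1 ⊗ E + E ⊗ K`, `Δ(F) = K⁻¹ ⊗ F + F ⊗ 1`, `Δ(K) = K ⊗ K`. -/
def comul : Uq P →ₐ[ℂ] (Uq P ⊗[ℂ] Uq P) := (exists_comul P).choose

theorem comul_E : comul P (E P) = 1 ⊗ₜ E P + E P ⊗ₜ K P := (exists_comul P).choose_spec.1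
theorem comul_F : comul P (F P) = (K P ^ (P.d - 1)) ⊗ₜ F P + F P ⊗ₜ 1 :=
  (exists_comul P).choose_spec.2.1
theorem comul_K : comul P (K P) = K P ⊗ₜ K P := (exists_comul P).choose_spec.2.2

/-- The quantum integer `[m] = (q ^ m - q ^ (-m)) / (q - q⁻¹)`. -/
def qInt (m : ℕ) : ℂ := (P.q ^ m - P.q⁻¹ ^ m) / (P.q - P.q⁻¹)

/-- The quantum factorial `[k]! = [1] [2] ⋯ [k]`. -/
def qFactorial (k : ℕ) : ℂ := ∏ m ∈ Finset.range k, qInt P (m + 1)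

/-- The `R`-matrix of `u_q`. -/
def R : Uq P ⊗[ℂ] Uq P :=
  (1 / (P.d : ℂ)) • ∑ i ∈ Finset.range P.d, ∑ j ∈ Finset.range P.d, ∑ k ∈ Finset.range P.d,
    ((P.q - P.q⁻¹) ^ k / qFactorial P k *
      P.q ^ ((k : ℤ) * (k - 1) / 2 + 2 * k * (i - j) - 2 * i * j : ℤ)) •
      ((E P ^ k * K P ^ i) ⊗ₜ[ℂ] (F P ^ k * K P ^ j))

theorem K_pow_val_mul (a b : ZMod P.d) : K P ^ a.val * K P ^ b.val = K P ^ (a + b).val := by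
  rw [← pow_add, ZMod.val_add]
  conv_lhs => rw [← Nat.mod_add_div (a.val + b.val) P.d, pow_add, pow_mul, K_pow, one_pow, mul_one]

end Uq

/-! ### The sub-Hopf algebra `u_q⁺` -/

/-- The subalgebra `u_q⁺` of `u_q` generated by `E` and `K`. -/
def uqPlus (P : RootData) : Subalgebra ℂ (Uq P) := Algebra.adjoin ℂ {Uq.E P, Uq.K P}

namespace UqPlus

variable (P : RootData)

def E : uqPlus P := ⟨Uq.E P, Algebra.subset_adjoin (by simp)⟩
def K : uqPlus P := ⟨Uq.K P, Algebra.subset_adjoin (by simp)⟩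

theorem induction {p : uqPlus P → Prop} (hE : p (E P)) (hK : p (K P))
    (hc : ∀ r : ℂ, p (algebraMap ℂ _ r)) (ha : ∀ x y, p x → p y → p (x + y))
    (hm : ∀ x y, p x → p y → p (x * y)) (x : uqPlus P) : p x := by
  obtain ⟨x, hx⟩ := x
  refine Algebra.adjoin_induction (p := fun x hx => p ⟨x, hx⟩) ?_ ?_ ?_ ?_ hx
  · intro x hx
    rcases hx with rfl | hx
    · exact hE
    · obtain rfl : x = Uq.K P := hx
      exact hK
  · exact hc
  · intro x y hx hy h1 h2
    exact ha _ _ h1 h2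
  · intro x y hx hy h1 h2
    exact hm _ _ h1 h2

theorem algHom_ext {A : Type*} [Ring A] [Algebra ℂ A] {f g : uqPlus P →ₐ[ℂ] A}
    (hE : f (E P) = g (E P)) (hK : f (K P) = g (K P)) : f = g := by
  ext x
  refine induction P (p := fun x => f x = g x) hE hK ?_ ?_ ?_ x
  · intro r
    rw [AlgHom.commutes, AlgHom.commutes]
  · intro x y h1 h2
    rw [map_add, map_add, h1, h2]
  · intro x y h1 h2
    rw [map_mul, map_mul, h1, h2]

/-- The inclusion of `u_q⁺ ⊗ u_q⁺` in `u_q ⊗ u_q`. -/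
def tensorIncl : (uqPlus P ⊗[ℂ] uqPlus P) →ₐ[ℂ] (Uq P ⊗[ℂ] Uq P) :=
  Algebra.TensorProduct.map (uqPlus P).val (uqPlus P).val

theorem tensorIncl_injective : Function.Injective (tensorIncl P) :=
  TensorProduct.map_injective_of_flat_flat (uqPlus P).val.toLinearMap (uqPlus P).val.toLinearMap
    Subtype.val_injective Subtype.val_injective

theorem comul_mem (x : uqPlus P) :
    ((Uq.comul P).comp (uqPlus P).val) x ∈ (tensorIncl P).range := by
  refine induction P (p := fun x => ((Uq.comul P).comp (uqPlus P).val) x ∈ (tensorIncl P).range)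
    ?_ ?_ ?_ ?_ ?_ x
  · refine ⟨1 ⊗ₜ E P + E P ⊗ₜ K P, ?_⟩
    simpa [tensorIncl, E, K] using (Uq.comul_E P).symm
  · refine ⟨K P ⊗ₜ K P, ?_⟩
    simpa [tensorIncl, E, K] using (Uq.comul_K P).symm
  · intro r
    rw [AlgHom.commutes]
    exact Subalgebra.algebraMap_mem _ r
  · intro x y h1 h2
    rw [map_add]
    exact add_mem h1 h2
  · intro x y h1 h2
    rw [map_mul]
    exact mul_mem h1 h2

/-- The comultiplication of `u_q⁺`, the restriction of the one of `u_q`. -/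
def comul : uqPlus P →ₐ[ℂ] (uqPlus P ⊗[ℂ] uqPlus P) :=
  (AlgEquiv.ofInjective (tensorIncl P) (tensorIncl_injective P)).symm.toAlgHom.comp
    (((Uq.comul P).comp (uqPlus P).val).codRestrict (tensorIncl P).range (comul_mem P))

theorem tensorIncl_comul (x : uqPlus P) : tensorIncl P (comul P x) = Uq.comul P (x : Uq P) := by
  have h := (AlgEquiv.ofInjective (tensorIncl P) (tensorIncl_injective P)).apply_symm_apply
    ((((Uq.comul P).comp (uqPlus P).val).codRestrict (tensorIncl P).range (comul_mem P)) x)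
  exact congrArg Subtype.val h

theorem comul_E : comul P (E P) = 1 ⊗ₜ E P + E P ⊗ₜ K P := by
  apply tensorIncl_injective P
  rw [tensorIncl_comul]
  simpa [tensorIncl, E, K] using Uq.comul_E P

theorem comul_K : comul P (K P) = K P ⊗ₜ K P := by
  apply tensorIncl_injective P
  rw [tensorIncl_comul]
  simpa [tensorIncl, E, K] using Uq.comul_K P

end UqPlus

/-! ### Modules

A module over one of these algebras `A` is a complex vector space `U` with an algebra homomorphism
`A →ₐ[ℂ] Module.End ℂ U`. -/

/-- A linear map that commutes with the actions. -/
def IsIntertwining {A : Type*} [Semiring A] [Algebra ℂ A]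
    {U V : Type*} [AddCommGroup U] [Module ℂ U] [AddCommGroup V] [Module ℂ V]
    (ρ : A →ₐ[ℂ] Module.End ℂ U) (σ : A →ₐ[ℂ] Module.End ℂ V) (f : U →ₗ[ℂ] V) : Prop :=
  ∀ (a : A) (x : U), f (ρ a x) = σ a (f x)

/-- The action of `A ⊗ B` on `U ⊗ V`. -/
def outerRep {A B : Type*} [Semiring A] [Algebra ℂ A] [Semiring B] [Algebra ℂ B]
    {U V : Type*} [AddCommGroup U] [Module ℂ U] [AddCommGroup V] [Module ℂ V]
    (ρ : A →ₐ[ℂ] Module.End ℂ U) (σ : B →ₐ[ℂ] Module.End ℂ V) :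
    (A ⊗[ℂ] B) →ₐ[ℂ] Module.End ℂ (U ⊗[ℂ] V) :=
  (Module.endTensorEndAlgHom (R := ℂ) (S := ℂ) (A := ℂ)).comp (Algebra.TensorProduct.map ρ σ)

theorem outerRep_tmul {A B : Type*} [Semiring A] [Algebra ℂ A] [Semiring B] [Algebra ℂ B]
    {U V : Type*} [AddCommGroup U] [Module ℂ U] [AddCommGroup V] [Module ℂ V]
    (ρ : A →ₐ[ℂ] Module.End ℂ U) (σ : B →ₐ[ℂ] Module.End ℂ V) (a : A) (b : B) :
    outerRep ρ σ (a ⊗ₜ b) = TensorProduct.map (ρ a) (σ b) := rfl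

/-- The tensor product, over the ground field, of two `u_q⁺`-modules. -/
def tensorRep {P : RootData}
    {U V : Type*} [AddCommGroup U] [Module ℂ U] [AddCommGroup V] [Module ℂ V]
    (ρ : uqPlus P →ₐ[ℂ] Module.End ℂ U) (σ : uqPlus P →ₐ[ℂ] Module.End ℂ V) :
    uqPlus P →ₐ[ℂ] Module.End ℂ (U ⊗[ℂ] V) :=
  (outerRep ρ σ).comp (UqPlus.comul P)

/-- A module over `u_q`. -/
structure UqModule (P : RootData) where
  carrier : Type u
  [addCommGroup : AddCommGroup carrier]
  [module : Module ℂ carrier]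
  ρ : Uq P →ₐ[ℂ] Module.End ℂ carrier

namespace UqModule

variable {P : RootData}

instance : CoeSort (UqModule.{u} P) (Type u) := ⟨carrier⟩
instance (X : UqModule.{u} P) : AddCommGroup X := X.addCommGroup
instance (X : UqModule.{u} P) : Module ℂ X := X.module

/-- The restriction of a `u_q`-module to `u_q⁺`; the modules arising in this way are the
extendable ones. -/
def res (X : UqModule.{u} P) : uqPlus P →ₐ[ℂ] Module.End ℂ X := X.ρ.comp (uqPlus P).val

/-- The tensor product of two `u_q`-modules. -/
def tensor (X Y : UqModule.{u} P) : UqModule.{u} P where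
  carrier := X ⊗[ℂ] Y
  ρ := (outerRep X.ρ Y.ρ).comp (Uq.comul P)

/-- The action of `τ R`, a map `X ⊗ Y → Y ⊗ X`. -/
def tauR (X Y : UqModule.{u} P) : (X ⊗[ℂ] Y) →ₗ[ℂ] (Y ⊗[ℂ] X) :=
  (TensorProduct.comm ℂ X Y).toLinearMap ∘ₗ outerRep X.ρ Y.ρ (Uq.R P)

/-- The action of `K ^ a` on `X`, for `a` in `ℤ/dℤ`. -/
def Kpow (X : UqModule.{u} P) (a : ZMod P.d) : X ≃ₗ[ℂ] X :=
  LinearEquiv.ofLinearMap (X.ρ (Uq.K P ^ a.val)) (X.ρ (Uq.K P ^ (-a).val))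
    (by
      rw [← Module.End.mul_eq_comp, ← map_mul, Uq.K_pow_val_mul, add_neg_cancel, ZMod.val_zero,
        pow_zero, map_one]
      rfl)
    (by
      rw [← Module.End.mul_eq_comp, ← map_mul, Uq.K_pow_val_mul, neg_add_cancel, ZMod.val_zero,
        pow_zero, map_one]
      rfl)

end UqModule

/-! ### The simple modules `S_l` of `u_q⁺` -/

namespace Verma

/-! A module over `u_q` with a vector killed by `E`, on functions `ℕ → ℂ` (with trivial part in
degrees at least `d`); it serves to see that the characters of `u_q⁺` exist. -/

variable (P : RootData) (c : ℂ)

def wt (j : ℕ) : ℂ := if j < P.d then c * (P.q ^ 2)⁻¹ ^ j else 1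

def mu (j : ℕ) : ℂ :=
  (P.q - P.q⁻¹)⁻¹ * ∑ i ∈ Finset.range j, (c * (P.q ^ 2)⁻¹ ^ i - c⁻¹ * (P.q ^ 2) ^ i)

def opE : Module.End ℂ (ℕ → ℂ) where
  toFun v j := if j + 1 < P.d then mu P c (j + 1) * v (j + 1) else 0
  map_add' v w := by
    funext j
    simp only [Pi.add_apply]
    split_ifs <;> ring
  map_smul' r v := by
    funext j
    simp only [Pi.smul_apply, smul_eq_mul, RingHom.id_apply]
    split_ifs <;> ring

def opF : Module.End ℂ (ℕ → ℂ) where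
  toFun v j := if 1 ≤ j ∧ j < P.d then v (j - 1) else 0
  map_add' v w := by
    funext j
    simp only [Pi.add_apply]
    split_ifs <;> ring
  map_smul' r v := by
    funext j
    simp only [Pi.smul_apply, smul_eq_mul, RingHom.id_apply]
    split_ifs <;> ring

def opK : Module.End ℂ (ℕ → ℂ) where
  toFun v j := wt P c j * v j
  map_add' v w := by
    funext j
    simp only [Pi.add_apply]
    ring
  map_smul' r v := by
    funext j
    simp only [Pi.smul_apply, smul_eq_mul, RingHom.id_apply]
    ring

theorem opE_apply (v : ℕ → ℂ) (j : ℕ) :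
    opE P c v j = if j + 1 < P.d then mu P c (j + 1) * v (j + 1) else 0 := rfl

theorem opF_apply (v : ℕ → ℂ) (j : ℕ) :
    opF P v j = if 1 ≤ j ∧ j < P.d then v (j - 1) else 0 := rfl

theorem opK_apply (v : ℕ → ℂ) (j : ℕ) : opK P c v j = wt P c j * v j := rfl

theorem opK_pow_apply (m : ℕ) (v : ℕ → ℂ) (j : ℕ) : (opK P c ^ m) v j = wt P c j ^ m * v j := by
  induction m with
  | zero => simp
  | succ m ih =>
    rw [pow_succ', Module.End.mul_apply, opK_apply, ih]
    ring

theorem opE_pow_apply (m : ℕ) (v : ℕ → ℂ) (j : ℕ) (h : P.d ≤ j + (m + 1)) :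
    (opE P c ^ (m + 1)) v j = 0 := by
  induction m generalizing j with
  | zero =>
    rw [pow_one, opE_apply, if_neg (by omega)]
  | succ m ih =>
    rw [pow_succ', Module.End.mul_apply, opE_apply, ih (j + 1) (by omega)]
    simp

theorem opF_pow_apply (m : ℕ) (v : ℕ → ℂ) (j : ℕ) (h : j < m + 1 ∨ P.d ≤ j) :
    (opF P ^ (m + 1)) v j = 0 := by
  induction m generalizing j with
  | zero =>
    rw [pow_one, opF_apply, if_neg (by omega)]
  | succ m ih =>
    rw [pow_succ', Module.End.mul_apply, opF_apply]
    split_ifs with hj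
    · exact ih (j - 1) (by omega)
    · rfl

theorem mu_d : mu P c P.d = 0 := by
  unfold mu
  rw [Finset.sum_sub_distrib, ← Finset.mul_sum, ← Finset.mul_sum,
    P.prim_sq.geom_sum_eq_zero P.one_lt_d, P.prim_sq.inv.geom_sum_eq_zero P.one_lt_d]
  simp

variable {c}

theorem wt_pow (hc : c ^ P.d = 1) (j : ℕ) : wt P c j ^ P.d = 1 := by
  unfold wt
  split_ifs
  · rw [mul_pow, hc, one_mul, ← pow_mul, mul_comm j, pow_mul, P.prim_sq.inv.pow_eq_one, one_pow]
  · exact one_pow _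

theorem wt_pow_pred (hc : c ^ P.d = 1) (j : ℕ) : wt P c j ^ (P.d - 1) = (wt P c j)⁻¹ := by
  refine eq_inv_of_mul_eq_one_left ?_
  rw [← pow_succ, Nat.sub_add_cancel P.d_pos, wt_pow P hc]

theorem exists_rep (hc : c ^ P.d = 1) : ∃ φ : Uq P →ₐ[ℂ] Module.End ℂ (ℕ → ℂ),
    φ (Uq.E P) = opE P c ∧ φ (Uq.F P) = opF P ∧ φ (Uq.K P) = opK P c := by
  have hq : P.q ^ 2 ≠ 0 := pow_ne_zero 2 P.q_ne_zero
  have hd := P.d_pos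
  obtain ⟨m, hm⟩ : ∃ m, P.d = m + 1 := ⟨P.d - 1, by omega⟩
  apply Uq.exists_lift
  · ext v j
    rw [hm]
    exact opE_pow_apply P c m v j (by omega)
  · ext v j
    rw [hm]
    exact opF_pow_apply P m v j (by omega)
  · ext v j
    rw [opK_pow_apply, wt_pow P hc]
    simp
  · ext v j
    simp only [Module.End.mul_apply, LinearMap.smul_apply, Pi.smul_apply, smul_eq_mul, opK_apply,
      opE_apply]
    split_ifs with h
    · rw [wt, wt, if_pos (by omega), if_pos h, pow_succ]
      linear_combination (-(c * (P.q ^ 2)⁻¹ ^ j * mu P c (j + 1) * v (j + 1))) *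
        mul_inv_cancel₀ hq
    · simp
  · ext v j
    simp only [Module.End.mul_apply, LinearMap.smul_apply, Pi.smul_apply, smul_eq_mul, opK_apply,
      opF_apply]
    split_ifs with h
    · obtain ⟨i, rfl⟩ : ∃ i, j = i + 1 := ⟨j - 1, by omega⟩
      rw [wt, wt, if_pos (by omega), if_pos (by omega), Nat.add_sub_cancel, pow_succ]
      ring
    · simp
  · ext v j
    simp only [Module.End.mul_apply, LinearMap.smul_apply, LinearMap.sub_apply, Pi.sub_apply,
      Pi.smul_apply, smul_eq_mul, opK_apply, opK_pow_apply, wt_pow_pred P hc, opE_apply, opF_apply]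
    by_cases h : j < P.d
    · have e1 : (if j + 1 < P.d then mu P c (j + 1) *
          (if 1 ≤ j + 1 ∧ j + 1 < P.d then v (j + 1 - 1) else 0) else 0) = mu P c (j + 1) * v j := by
        split_ifs with h1 h2
        · rw [Nat.add_sub_cancel]
        · omega
        · rw [show j + 1 = P.d by omega, mu_d, zero_mul]
      have e2 : (if 1 ≤ j ∧ j < P.d then
          (if j - 1 + 1 < P.d then mu P c (j - 1 + 1) * v (j - 1 + 1) else 0) else 0) =
          mu P c j * v j := by
        split_ifs with h1 h2
        · rw [Nat.sub_add_cancel h1.1]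
        · omega
        · rw [show j = 0 by omega]
          simp [mu]
      rw [e1, e2, mu, mu, Finset.sum_range_succ, wt, if_pos h, mul_inv, inv_pow, inv_inv]
      ring
    · rw [if_neg (by omega), if_neg (by omega), wt, if_neg h]
      simp

end Verma

namespace UqPlus

variable (P : RootData)

theorem exists_character {c : ℂ} (hc : c ^ P.d = 1) :
    ∃ χ : uqPlus P →ₐ[ℂ] ℂ, χ (E P) = 0 ∧ χ (K P) = c := by
  obtain ⟨φ, hE, -, hK⟩ := Verma.exists_rep P hc
  let v : ℕ → ℂ := Pi.single 0 1
  have hv0 : v 0 = 1 := by simp [v]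
  have hEv : φ (Uq.E P) v = (0 : ℂ) • v := by
    rw [hE, zero_smul]
    funext j
    rw [Verma.opE_apply]
    simp [v]
  have hKv : φ (Uq.K P) v = c • v := by
    rw [hK]
    funext j
    rw [Verma.opK_apply]
    rcases Nat.eq_zero_or_pos j with rfl | hj
    · simp [Verma.wt, P.d_pos]
    · have : v j = 0 := by simp [v, hj.ne']
      simp [this]
  have key : ∀ x : uqPlus P, φ (x : Uq P) v = (φ (x : Uq P) v 0) • v := by
    have : ∀ x : uqPlus P, ∃ r : ℂ, φ (x : Uq P) v = r • v := by
      intro x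
      refine induction P (p := fun x => ∃ r : ℂ, φ (x : Uq P) v = r • v) ?_ ?_ ?_ ?_ ?_ x
      · exact ⟨0, hEv⟩
      · exact ⟨c, hKv⟩
      · intro r
        refine ⟨r, ?_⟩
        rw [Subalgebra.coe_algebraMap, AlgHom.commutes]
        rfl
      · rintro x y ⟨r, hr⟩ ⟨s, hs⟩
        refine ⟨r + s, ?_⟩
        rw [Subalgebra.coe_add, map_add, LinearMap.add_apply, hr, hs, add_smul]
      · rintro x y ⟨r, hr⟩ ⟨s, hs⟩
        refine ⟨s * r, ?_⟩
        rw [Subalgebra.coe_mul, map_mul, Module.End.mul_apply, hs, map_smul, hr, smul_smul]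
    intro x
    obtain ⟨r, hr⟩ := this x
    rw [hr]
    simp [hv0]
  let χl : uqPlus P →ₗ[ℂ] ℂ :=
    { toFun := fun x => φ (x : Uq P) v 0
      map_add' := by
        intro x y
        simp
      map_smul' := by
        intro r x
        simp }
  refine ⟨AlgHom.ofLinearMap χl ?_ ?_, ?_, ?_⟩
  · simp [χl, hv0]
  · intro x y
    change φ ((x * y : uqPlus P) : Uq P) v 0 = φ (x : Uq P) v 0 * φ (y : Uq P) v 0
    rw [Subalgebra.coe_mul, map_mul, Module.End.mul_apply]
    conv_lhs => rw [key y, map_smul, Pi.smul_apply, smul_eq_mul]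
    ring
  · change φ (Uq.E P) v 0 = 0
    rw [hEv]
    simp
  · change φ (Uq.K P) v 0 = c
    rw [hKv]
    simp [hv0]

theorem sq_pow_val_pow (l : ZMod P.d) : ((P.q ^ 2) ^ l.val) ^ P.d = 1 := by
  rw [← pow_mul, mul_comm, pow_mul, P.prim_sq.pow_eq_one, one_pow]

/-- The character of `u_q⁺` with `E ↦ 0` and `K ↦ q ^ (2 l)`. -/
def character (l : ZMod P.d) : uqPlus P →ₐ[ℂ] ℂ :=
  (exists_character P (sq_pow_val_pow P l)).choose

theorem character_E (l : ZMod P.d) : character P l (E P) = 0 :=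
  (exists_character P (sq_pow_val_pow P l)).choose_spec.1

theorem character_K (l : ZMod P.d) : character P l (K P) = (P.q ^ 2) ^ l.val :=
  (exists_character P (sq_pow_val_pow P l)).choose_spec.2

theorem character_K_mul (l m : ZMod P.d) :
    character P l (K P) * character P m (K P) = character P (l + m) (K P) := by
  rw [character_K, character_K, character_K, ← pow_add, ZMod.val_add]
  conv_lhs => rw [← Nat.mod_add_div (l.val + m.val) P.d, pow_add, pow_mul, P.prim_sq.pow_eq_one,
    one_pow, mul_one]

/-- The simple module `S_l` on `ℂ`, on which `E` acts as `0` and `K` as `q ^ (2 l)`. -/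
def simple (l : ZMod P.d) : uqPlus P →ₐ[ℂ] Module.End ℂ ℂ :=
  (Algebra.lmul ℂ ℂ).comp (character P l)

end UqPlus

/-! ### The isomorphisms -/

namespace UqModule

variable {P : RootData}

/-- The `u_q⁺`-module `S_l ⊗ X`, for an extended module `X`. -/
def shift (l : ZMod P.d) (X : UqModule.{u} P) : uqPlus P →ₐ[ℂ] Module.End ℂ (ℂ ⊗[ℂ] X) :=
  tensorRep (UqPlus.simple P l) X.res

/-- The isomorphism `(S_l ⊗ X) ⊗ (S_m ⊗ Y) ≅ S_{l+m} ⊗ (X ⊗ Y)` which moves `S_m` past `X` by the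
isomorphism `X ⊗ S_m ≅ S_m ⊗ X`, `x ⊗ s ↦ s ⊗ K⁻ᵐ x`, and identifies `S_l ⊗ S_m` with `S_{l+m}`:
`(s ⊗ x) ⊗ (t ⊗ y) ↦ s t ⊗ (K⁻ᵐ x ⊗ y)`. -/
def reorder (m : ZMod P.d) (X Y : UqModule.{u} P) :
    ((ℂ ⊗[ℂ] X) ⊗[ℂ] (ℂ ⊗[ℂ] Y)) ≃ₗ[ℂ] (ℂ ⊗[ℂ] (X ⊗[ℂ] Y)) :=
  (TensorProduct.congr (TensorProduct.congr (LinearEquiv.refl ℂ ℂ) (X.Kpow (-m)))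
      (LinearEquiv.refl ℂ (ℂ ⊗[ℂ] Y))).trans
    ((TensorProduct.tensorTensorTensorComm ℂ ℂ X ℂ Y).trans
      (TensorProduct.congr (TensorProduct.lid ℂ ℂ) (LinearEquiv.refl ℂ (X ⊗[ℂ] Y))))

theorem reorder_tmul (m : ZMod P.d) (X Y : UqModule.{u} P) (s t : ℂ) (x : X) (y : Y) :
    reorder m X Y ((s ⊗ₜ x) ⊗ₜ (t ⊗ₜ y)) = (s * t) ⊗ₜ (X.Kpow (-m) x ⊗ₜ y) := rfl

theorem res_tensor (X Y : UqModule.{u} P) : (X.tensor Y).res = tensorRep X.res Y.res := by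
  have h : (outerRep X.ρ Y.ρ).comp (UqPlus.tensorIncl P) = outerRep X.res Y.res := by
    apply Algebra.TensorProduct.ext <;> ext x <;> rfl
  ext1 x
  change outerRep X.ρ Y.ρ (Uq.comul P (x : Uq P)) = outerRep X.res Y.res (UqPlus.comul P x)
  rw [← UqPlus.tensorIncl_comul, ← h]
  rfl

theorem shift_K (l : ZMod P.d) (X : UqModule.{u} P) (s : ℂ) (x : X) :
    shift l X (UqPlus.K P) (s ⊗ₜ x) =
      UqPlus.character P l (UqPlus.K P) • (s ⊗ₜ X.ρ (Uq.K P) x) := by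
  simp only [shift, tensorRep, AlgHom.comp_apply, UqPlus.comul_K, outerRep_tmul,
    TensorProduct.map_tmul]
  rfl

theorem shift_E (l : ZMod P.d) (X : UqModule.{u} P) (s : ℂ) (x : X) :
    shift l X (UqPlus.E P) (s ⊗ₜ x) = s ⊗ₜ X.ρ (Uq.E P) x := by
  simp only [shift, tensorRep, AlgHom.comp_apply, UqPlus.comul_E, outerRep_tmul, map_add,
    LinearMap.add_apply, TensorProduct.map_tmul]
  have h : UqPlus.simple P l (UqPlus.E P) s = 0 := by
    change UqPlus.character P l (UqPlus.E P) * s = 0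
    rw [UqPlus.character_E, zero_mul]
  rw [h, TensorProduct.zero_tmul, add_zero, map_one]
  rfl

/-- The isomorphism `(S_l ⊗ X) ⊗ (S_m ⊗ Y) → (S_m ⊗ Y) ⊗ (S_l ⊗ X)` induced by
`id ⊗ τ R : S_{l+m} ⊗ (X ⊗ Y) → S_{l+m} ⊗ (Y ⊗ X)`. -/
def shiftBraiding (l : ZMod P.d) (X : UqModule.{u} P) (m : ZMod P.d) (Y : UqModule.{u} P) :
    ((ℂ ⊗[ℂ] X) ⊗[ℂ] (ℂ ⊗[ℂ] Y)) →ₗ[ℂ] ((ℂ ⊗[ℂ] Y) ⊗[ℂ] (ℂ ⊗[ℂ] X)) :=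
  (reorder l Y X).symm.toLinearMap ∘ₗ (tauR X Y).lTensor ℂ ∘ₗ (reorder m X Y).toLinearMap

end UqModule

theorem isIntertwining_of_generators {P : RootData}
    {U V : Type*} [AddCommGroup U] [Module ℂ U] [AddCommGroup V] [Module ℂ V]
    {ρ : uqPlus P →ₐ[ℂ] Module.End ℂ U} {σ : uqPlus P →ₐ[ℂ] Module.End ℂ V} {f : U →ₗ[ℂ] V}
    (hE : ∀ x, f (ρ (UqPlus.E P) x) = σ (UqPlus.E P) (f x))
    (hK : ∀ x, f (ρ (UqPlus.K P) x) = σ (UqPlus.K P) (f x)) : IsIntertwining ρ σ f := by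
  intro a
  refine UqPlus.induction P (p := fun a => ∀ x, f (ρ a x) = σ a (f x)) hE hK ?_ ?_ ?_ a
  · intro r x
    rw [AlgHom.commutes, AlgHom.commutes]
    simp [Module.algebraMap_end_apply]
  · intro a b ha hb x
    rw [map_add, map_add, LinearMap.add_apply, LinearMap.add_apply, map_add, ha, hb]
  · intro a b ha hb x
    rw [map_mul, map_mul, Module.End.mul_apply, Module.End.mul_apply, ha, hb]

theorem IsIntertwining.tensor {P : RootData} {U V U' V' : Type*}
    [AddCommGroup U] [Module ℂ U] [AddCommGroup V] [Module ℂ V]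
    [AddCommGroup U'] [Module ℂ U'] [AddCommGroup V'] [Module ℂ V']
    {ρ : uqPlus P →ₐ[ℂ] Module.End ℂ U} {σ : uqPlus P →ₐ[ℂ] Module.End ℂ V}
    {ρ' : uqPlus P →ₐ[ℂ] Module.End ℂ U'} {σ' : uqPlus P →ₐ[ℂ] Module.End ℂ V'}
    {f : U →ₗ[ℂ] U'} {g : V →ₗ[ℂ] V'} (hf : IsIntertwining ρ ρ' f) (hg : IsIntertwining σ σ' g) :
    IsIntertwining (tensorRep ρ σ) (tensorRep ρ' σ') (TensorProduct.map f g) := by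
  intro a z
  simp only [tensorRep, AlgHom.comp_apply]
  induction UqPlus.comul P a with
  | zero => simp
  | add s t hs ht => simp only [map_add, LinearMap.add_apply, hs, ht]
  | tmul s t =>
    rw [outerRep_tmul, outerRep_tmul]
    induction z with
    | zero => simp
    | add z w hz hw => simp only [map_add, hz, hw]
    | tmul x y => simp only [TensorProduct.map_tmul, hf s x, hg t y]

namespace UqModule

variable {P : RootData}

theorem character_smul_Kpow_E (m : ZMod P.d) (X : UqModule.{u} P) (x : X) :
    UqPlus.character P m (UqPlus.K P) • X.Kpow (-m) (X.ρ (Uq.E P) x) =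
      X.ρ (Uq.E P) (X.Kpow (-m) x) := by
  have hE := Uq.K_pow_mul_E P (-m).val
  have h1 : (P.q ^ 2) ^ m.val * (P.q ^ 2) ^ (-m).val = 1 := by
    rw [← UqPlus.character_K, ← UqPlus.character_K, UqPlus.character_K_mul, add_neg_cancel,
      UqPlus.character_K, ZMod.val_zero, pow_zero]
  change UqPlus.character P m (UqPlus.K P) • X.ρ (Uq.K P ^ (-m).val) (X.ρ (Uq.E P) x) =
    X.ρ (Uq.E P) (X.ρ (Uq.K P ^ (-m).val) x)
  rw [← Module.End.mul_apply, ← map_mul, hE, map_smul, LinearMap.smul_apply, smul_smul,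
    UqPlus.character_K, h1, one_smul, map_mul, Module.End.mul_apply]

theorem Kpow_K (m : ZMod P.d) (X : UqModule.{u} P) (x : X) :
    X.Kpow m (X.ρ (Uq.K P) x) = X.ρ (Uq.K P) (X.Kpow m x) := by
  change X.ρ (Uq.K P ^ m.val) (X.ρ (Uq.K P) x) = X.ρ (Uq.K P) (X.ρ (Uq.K P ^ m.val) x)
  rw [← Module.End.mul_apply, ← map_mul, ← Module.End.mul_apply, ← map_mul, ← pow_succ, pow_succ']

theorem reorder_isIntertwining (l m : ZMod P.d) (X Y : UqModule.{u} P) :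
    IsIntertwining (tensorRep (X.shift l) (Y.shift m)) ((X.tensor Y).shift (l + m))
      (reorder m X Y).toLinearMap := by
  have hE : (reorder m X Y).toLinearMap ∘ₗ tensorRep (X.shift l) (Y.shift m) (UqPlus.E P) =
      (X.tensor Y).shift (l + m) (UqPlus.E P) ∘ₗ (reorder m X Y).toLinearMap := by
    refine TensorProduct.ext_fourfold' fun s x t y => ?_
    have e1 : tensorRep (X.shift l) (Y.shift m) (UqPlus.E P) ((s ⊗ₜ x) ⊗ₜ (t ⊗ₜ y)) =
        (s ⊗ₜ x) ⊗ₜ Y.shift m (UqPlus.E P) (t ⊗ₜ y) +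
          X.shift l (UqPlus.E P) (s ⊗ₜ x) ⊗ₜ Y.shift m (UqPlus.K P) (t ⊗ₜ y) := by
      rw [tensorRep, AlgHom.comp_apply, UqPlus.comul_E, map_add, outerRep_tmul, outerRep_tmul,
        LinearMap.add_apply, TensorProduct.map_tmul, TensorProduct.map_tmul, map_one]
      rfl
    have e2 : ∀ (x : X) (y : Y), (X.tensor Y).ρ (Uq.E P) (x ⊗ₜ[ℂ] y : X ⊗[ℂ] Y) =
        (x ⊗ₜ[ℂ] Y.ρ (Uq.E P) y + X.ρ (Uq.E P) x ⊗ₜ[ℂ] Y.ρ (Uq.K P) y : X ⊗[ℂ] Y) := by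
      intro x y
      change outerRep X.ρ Y.ρ (Uq.comul P (Uq.E P)) (x ⊗ₜ y) = _
      rw [Uq.comul_E, map_add, outerRep_tmul, outerRep_tmul,
        LinearMap.add_apply, TensorProduct.map_tmul, TensorProduct.map_tmul, map_one]
      rfl
    change reorder m X Y (tensorRep (X.shift l) (Y.shift m) (UqPlus.E P) _) =
      (X.tensor Y).shift (l + m) (UqPlus.E P) (reorder m X Y _)
    rw [e1, shift_E, shift_E, shift_K, map_add, TensorProduct.tmul_smul, map_smul, reorder_tmul,
      reorder_tmul, reorder_tmul]
    refine Eq.trans ?_ (shift_E (l + m) (X.tensor Y) (s * t) _).symm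
    refine Eq.trans ?_ (congrArg (fun z => (s * t) ⊗ₜ[ℂ] z) (e2 _ _).symm)
    rw [← character_smul_Kpow_E, TensorProduct.tmul_add, ← TensorProduct.smul_tmul',
      TensorProduct.tmul_smul]
  have hK : (reorder m X Y).toLinearMap ∘ₗ tensorRep (X.shift l) (Y.shift m) (UqPlus.K P) =
      (X.tensor Y).shift (l + m) (UqPlus.K P) ∘ₗ (reorder m X Y).toLinearMap := by
    refine TensorProduct.ext_fourfold' fun s x t y => ?_
    have e1 : tensorRep (X.shift l) (Y.shift m) (UqPlus.K P) ((s ⊗ₜ x) ⊗ₜ (t ⊗ₜ y)) =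
        X.shift l (UqPlus.K P) (s ⊗ₜ x) ⊗ₜ Y.shift m (UqPlus.K P) (t ⊗ₜ y) := by
      rw [tensorRep, AlgHom.comp_apply, UqPlus.comul_K, outerRep_tmul, TensorProduct.map_tmul]
    have e2 : ∀ (x : X) (y : Y), (X.tensor Y).ρ (Uq.K P) (x ⊗ₜ[ℂ] y : X ⊗[ℂ] Y) =
        (X.ρ (Uq.K P) x ⊗ₜ[ℂ] Y.ρ (Uq.K P) y : X ⊗[ℂ] Y) := by
      intro x y
      change outerRep X.ρ Y.ρ (Uq.comul P (Uq.K P)) (x ⊗ₜ y) = _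
      rw [Uq.comul_K, outerRep_tmul, TensorProduct.map_tmul]
    change reorder m X Y (tensorRep (X.shift l) (Y.shift m) (UqPlus.K P) _) =
      (X.tensor Y).shift (l + m) (UqPlus.K P) (reorder m X Y _)
    rw [e1, shift_K, shift_K, TensorProduct.tmul_smul, ← TensorProduct.smul_tmul', map_smul,
      map_smul, reorder_tmul, reorder_tmul, smul_smul, mul_comm (UqPlus.character P m _),
      UqPlus.character_K_mul]
    refine Eq.trans ?_ (shift_K (l + m) (X.tensor Y) (s * t) _).symm
    refine Eq.trans ?_ (congrArg (fun z => UqPlus.character P (l + m) (UqPlus.K P) •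
      ((s * t) ⊗ₜ[ℂ] z)) (e2 _ _).symm)
    rw [Kpow_K]
  exact isIntertwining_of_generators (fun z => LinearMap.congr_fun hE z)
    (fun z => LinearMap.congr_fun hK z)

end UqModule

theorem IsIntertwining.symm {A : Type*} [Semiring A] [Algebra ℂ A]
    {U V : Type*} [AddCommGroup U] [Module ℂ U] [AddCommGroup V] [Module ℂ V]
    {ρ : A →ₐ[ℂ] Module.End ℂ U} {σ : A →ₐ[ℂ] Module.End ℂ V} {e : U ≃ₗ[ℂ] V}
    (h : IsIntertwining ρ σ e.toLinearMap) : IsIntertwining σ ρ e.symm.toLinearMap := by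
  intro a x
  apply e.injective
  have := h a (e.symm x)
  simp only [LinearEquiv.coe_coe, LinearEquiv.apply_symm_apply] at this ⊢
  rw [this]

/-- A decomposition of a `u_q⁺`-module `U` as a finite direct sum of modules `S_{l a} ⊗ X a`, with
`X a` a `u_q`-module, given by its injections and projections. (The projections are automatically
`u_q⁺`-linear.) -/
structure Presentation {P : RootData} {U : Type u} [AddCommGroup U] [Module ℂ U]
    (ρ : uqPlus P →ₐ[ℂ] Module.End ℂ U) where
  ι : Type
  [fintype : Fintype ι]
  l : ι → ZMod P.d
  X : ι → UqModule.{u} P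
  inc : ∀ a, (ℂ ⊗[ℂ] X a) →ₗ[ℂ] U
  proj : ∀ a, U →ₗ[ℂ] (ℂ ⊗[ℂ] X a)
  inc_isIntertwining : ∀ a, IsIntertwining ((X a).shift (l a)) ρ (inc a)
  proj_inc_self : ∀ a, proj a ∘ₗ inc a = LinearMap.id
  proj_inc_ne : ∀ a b, a ≠ b → proj b ∘ₗ inc a = 0
  sum_inc_proj : ∑ a, inc a ∘ₗ proj a = LinearMap.id

namespace Presentation

variable {P : RootData}

instance {U : Type u} [AddCommGroup U] [Module ℂ U] {ρ : uqPlus P →ₐ[ℂ] Module.End ℂ U}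
    (π : Presentation ρ) : Fintype π.ι := π.fintype

/-- The isomorphism `c_{U,V} : U ⊗ V → V ⊗ U`, given on the direct summands of `U` and `V` by
`UqModule.shiftBraiding`. -/
def braiding {U V : Type u} [AddCommGroup U] [Module ℂ U] [AddCommGroup V] [Module ℂ V]
    {ρ : uqPlus P →ₐ[ℂ] Module.End ℂ U} {σ : uqPlus P →ₐ[ℂ] Module.End ℂ V}
    (π : Presentation ρ) (κ : Presentation σ) : (U ⊗[ℂ] V) →ₗ[ℂ] (V ⊗[ℂ] U) :=
  ∑ a, ∑ b, TensorProduct.map (κ.inc b) (π.inc a) ∘ₗ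
    UqModule.shiftBraiding (π.l a) (π.X a) (κ.l b) (κ.X b) ∘ₗ
      TensorProduct.map (π.proj a) (κ.proj b)

/-- The decomposition of `U ⊗ V` induced by decompositions of `U` and `V`: its summands are
`(S_l ⊗ X) ⊗ (S_m ⊗ Y) ≅ S_{l+m} ⊗ (X ⊗ Y)`. -/
def tensor {U V : Type u} [AddCommGroup U] [Module ℂ U] [AddCommGroup V] [Module ℂ V]
    {ρ : uqPlus P →ₐ[ℂ] Module.End ℂ U} {σ : uqPlus P →ₐ[ℂ] Module.End ℂ V}
    (π : Presentation ρ) (κ : Presentation σ) : Presentation (tensorRep ρ σ) where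
  ι := π.ι × κ.ι
  l := fun a => π.l a.1 + κ.l a.2
  X := fun a => (π.X a.1).tensor (κ.X a.2)
  inc := fun a => TensorProduct.map (π.inc a.1) (κ.inc a.2) ∘ₗ
    (UqModule.reorder (κ.l a.2) (π.X a.1) (κ.X a.2)).symm.toLinearMap
  proj := fun a => (UqModule.reorder (κ.l a.2) (π.X a.1) (κ.X a.2)).toLinearMap ∘ₗ
    TensorProduct.map (π.proj a.1) (κ.proj a.2)
  inc_isIntertwining := by
    intro a r z
    have h1 := (UqModule.reorder_isIntertwining (π.l a.1) (κ.l a.2) (π.X a.1) (κ.X a.2)).symm r z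
    have h2 := (π.inc_isIntertwining a.1).tensor (κ.inc_isIntertwining a.2) r
      ((UqModule.reorder (κ.l a.2) (π.X a.1) (κ.X a.2)).symm z)
    exact (congrArg (TensorProduct.map (π.inc a.1) (κ.inc a.2)) h1).trans h2
  proj_inc_self := by
    intro a
    have h : TensorProduct.map (π.proj a.1) (κ.proj a.2) ∘ₗ
        TensorProduct.map (π.inc a.1) (κ.inc a.2) = LinearMap.id := by
      rw [← TensorProduct.map_comp, π.proj_inc_self, κ.proj_inc_self, TensorProduct.map_id]
    refine LinearMap.ext fun z => ?_
    refine (congrArg (UqModule.reorder (κ.l a.2) (π.X a.1) (κ.X a.2))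
      (LinearMap.congr_fun h _)).trans ?_
    exact LinearEquiv.apply_symm_apply _ z
  proj_inc_ne := by
    intro a b hab
    have h : TensorProduct.map (π.proj b.1) (κ.proj b.2) ∘ₗ
        TensorProduct.map (π.inc a.1) (κ.inc a.2) = 0 := by
      rw [← TensorProduct.map_comp]
      by_cases h1 : a.1 = b.1
      · have h2 : a.2 ≠ b.2 := fun h2 => hab (Prod.ext h1 h2)
        rw [κ.proj_inc_ne _ _ h2, TensorProduct.map_zero_right]
      · rw [π.proj_inc_ne _ _ h1, TensorProduct.map_zero_left]
    refine LinearMap.ext fun z => ?_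
    refine (congrArg (UqModule.reorder (κ.l b.2) (π.X b.1) (κ.X b.2))
      (LinearMap.congr_fun h _)).trans ?_
    exact map_zero _
  sum_inc_proj := by
    have h : ∀ a : π.ι × κ.ι, (TensorProduct.map (π.inc a.1) (κ.inc a.2) ∘ₗ
        (UqModule.reorder (κ.l a.2) (π.X a.1) (κ.X a.2)).symm.toLinearMap) ∘ₗ
        ((UqModule.reorder (κ.l a.2) (π.X a.1) (κ.X a.2)).toLinearMap ∘ₗ
          TensorProduct.map (π.proj a.1) (κ.proj a.2)) =
        TensorProduct.map (π.inc a.1 ∘ₗ π.proj a.1) (κ.inc a.2 ∘ₗ κ.proj a.2) := by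
      intro a
      rw [TensorProduct.map_comp]
      refine LinearMap.ext fun z => ?_
      exact congrArg (TensorProduct.map (π.inc a.1) (κ.inc a.2))
        (LinearEquiv.symm_apply_apply _ _)
    refine (Finset.sum_congr rfl fun a _ => h a).trans ?_
    refine TensorProduct.ext' fun x y => ?_
    have hx : ∑ a, π.inc a (π.proj a x) = x := by
      simpa using LinearMap.congr_fun π.sum_inc_proj x
    have hy : ∑ b, κ.inc b (κ.proj b y) = y := by
      simpa using LinearMap.congr_fun κ.sum_inc_proj y
    rw [LinearMap.sum_apply, Fintype.sum_prod_type]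
    simp only [TensorProduct.map_tmul, LinearMap.comp_apply, LinearMap.id_apply]
    conv_rhs => rw [← hx, ← hy, TensorProduct.sum_tmul]
    simp only [TensorProduct.tmul_sum]

end Presentation

end

/-!
The `R`-matrix factors as `R = C · e(E ⊗ F)`, where `C = ∑ K ^ b ⊗ 1_b` is built from the
idempotents `1_b` of the weights of `K`, and `e` is the `q`-exponential truncated in degree `d`
(`Uq.R_eq`). This makes `R` invertible and, with the functional equation of `e`, gives the
identities `(id ⊗ Δ) R = R₁₃ R₁₂` and `(Δ ⊗ id) R = R₁₃ R₂₃` (`Uq.comulRight_R`, `Uq.comulLeft_R`).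
The relation `R Δ(a) = Δᵒᵖ(a) R` is needed for `a` in `u_q⁺` only; it makes the braidings
`u_q⁺`-linear, and it implies the Yang–Baxter equation, because the first factors of `R` lie in
`u_q⁺`.

As vector spaces `S_l ⊗ X = X`, and the braiding of `S_l ⊗ X` with `S_m ⊗ Y` is the flip after the
action of `(1 ⊗ K ^ l) R (K ^ (-m) ⊗ 1)` (`UqModule.shiftBraiding_map`). Since `K ⊗ K` commutes with
`R`, these shifted elements satisfy the same three identities (`Uq.shifted_comulRight`,
`Uq.shifted_comulLeft`, `Uq.shifted_yang_baxter`), once the powers of `K` in the identification of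
`(S_l ⊗ X) ⊗ (S_m ⊗ Y)` with `S_{l+m} ⊗ (X ⊗ Y)` are taken into account. The hexagon identities and
the braid relation follow summand by summand.

The algebra `u_q⁺` is a Nakayama algebra. A chain `v, E v, …, E ^ m v` of the maximal length, with
`v` a weight vector, splits off as a direct summand, and for `d` odd the lowest weight can be
multiplied by a power of `q ^ 2` so that the chain becomes a `u_q`-module, in which the weight of
`v` is a square root of `q ^ (-2 m)` (`exists_summand`). By induction every finite-dimensional
module is a sum of shifted modules.

Naturality fails for the inclusion of the highest weight line in the two-dimensional simple
`u_q`-module: in the decomposition of the line `K` acts trivially through `X`, but in no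
decomposition of the two-dimensional module does it fix the highest weight vector, and the braiding
with `S_1` involves the action of `K⁻¹` (`not_natural`).
-/

noncomputable section

/-! ### Weight idempotents -/

namespace Uq

variable (P : RootData)

/-- The additive character `a ↦ q ^ (2 a)` of `ℤ/dℤ`. -/
def zeta : AddChar (ZMod P.d) ℂ := AddChar.zmodChar P.d P.prim_sq.pow_eq_one

theorem zeta_apply (a : ZMod P.d) : zeta P a = (P.q ^ 2) ^ a.val :=
  AddChar.zmodChar_apply _ _

theorem zeta_natCast (k : ℕ) : zeta P k = (P.q ^ 2) ^ k :=
  AddChar.zmodChar_apply' _ _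

theorem zeta_one : zeta P 1 = P.q ^ 2 := by
  simpa using zeta_natCast P 1

theorem zeta_intCast (k : ℤ) : zeta P k = (P.q ^ 2) ^ k := by
  have h := AddChar.map_zsmul_eq_zpow (zeta P) k 1
  rwa [zeta_one, zsmul_one] at h

theorem zeta_neg_mul (a : ZMod P.d) : zeta P (-a) * zeta P a = 1 := by
  rw [← AddChar.map_add_eq_mul, neg_add_cancel, AddChar.map_zero_eq_one]

theorem sum_zeta_mul (b : ZMod P.d) :
    ∑ a, zeta P (a * b) = if b = 0 then (P.d : ℂ) else 0 := by
  have h := AddChar.sum_mulShift b (AddChar.zmodChar_primitive_of_primitive_root P.d P.prim_sq)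
  rw [ZMod.card] at h
  exact_mod_cast h

/-- The power `K ^ a` for `a` in `ℤ/dℤ`. -/
def Kp (a : ZMod P.d) : Uq P := K P ^ a.val

theorem Kp_mul (a b : ZMod P.d) : Kp P a * Kp P b = Kp P (a + b) := K_pow_val_mul P a b

theorem Kp_zero : Kp P 0 = 1 := by rw [Kp, ZMod.val_zero, pow_zero]

theorem Kp_natCast (k : ℕ) : Kp P k = K P ^ k := by
  rw [Kp, ZMod.val_natCast]
  conv_rhs => rw [← Nat.mod_add_div k P.d, pow_add, pow_mul, K_pow, one_pow, mul_one]

theorem Kp_one : Kp P 1 = K P := by simpa using Kp_natCast P 1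

theorem Kp_neg_one : Kp P (-1) = K P ^ (P.d - 1) := by
  rw [← Kp_natCast, Nat.cast_sub P.d_pos]
  simp

theorem Kp_neg_mul_self (a : ZMod P.d) : Kp P (-a) * Kp P a = 1 := by
  rw [Kp_mul, neg_add_cancel, Kp_zero]

theorem Kp_mul_neg_self (a : ZMod P.d) : Kp P a * Kp P (-a) = 1 := by
  rw [Kp_mul, add_neg_cancel, Kp_zero]

theorem comul_Kp (a : ZMod P.d) : comul P (Kp P a) = Kp P a ⊗ₜ Kp P a := by
  rw [Kp, map_pow, comul_K, Algebra.TensorProduct.tmul_pow]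

theorem Kp_mul_E (a : ZMod P.d) : Kp P a * E P = zeta P a • (E P * Kp P a) := by
  rw [Kp, K_pow_mul_E, zeta_apply]

theorem K_pow_mul_F (k : ℕ) : K P ^ k * F P = ((P.q ^ 2) ^ k)⁻¹ • (F P * K P ^ k) := by
  induction k with
  | zero => simp
  | succ k ih =>
    rw [pow_succ, mul_assoc, K_mul_F, mul_smul_comm, ← mul_assoc, ih, smul_mul_assoc, smul_smul,
      mul_assoc, pow_succ (P.q ^ 2), mul_inv_rev]

theorem Kp_mul_F (a : ZMod P.d) : Kp P a * F P = zeta P (-a) • (F P * Kp P a) := by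
  rw [Kp, K_pow_mul_F, AddChar.map_neg_eq_inv, zeta_apply]

theorem Kp_mul_E_pow (a : ZMod P.d) (k : ℕ) :
    Kp P a * E P ^ k = zeta P (a * k) • (E P ^ k * Kp P a) := by
  rw [qCommute_pow (Kp_mul_E P a), ← AddChar.map_nsmul_eq_pow, nsmul_eq_mul, mul_comm]

theorem E_mul_Kp (a : ZMod P.d) : E P * Kp P a = zeta P (-a) • (Kp P a * E P) := by
  rw [Kp_mul_E, smul_smul, zeta_neg_mul, one_smul]

theorem F_mul_Kp (a : ZMod P.d) : F P * Kp P a = zeta P a • (Kp P a * F P) := by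
  rw [Kp_mul_F, smul_smul, mul_comm, zeta_neg_mul, one_smul]

/-- The idempotent projecting any module onto the eigenspace of `K` for `q ^ (2 b)`. -/
def idem (b : ZMod P.d) : Uq P := (P.d : ℂ)⁻¹ • ∑ j, zeta P (-(b * j)) • Kp P j

theorem Kp_mul_idem (a b : ZMod P.d) : Kp P a * idem P b = zeta P (a * b) • idem P b := by
  rw [idem, mul_smul_comm, smul_comm, Finset.mul_sum, Finset.smul_sum (r := zeta P (a * b))]
  congr 1
  refine Fintype.sum_equiv (Equiv.addLeft a) _ _ fun j => ?_
  rw [mul_smul_comm, Kp_mul, smul_smul, Equiv.coe_addLeft, ← AddChar.map_add_eq_mul]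
  congr 2
  ring

theorem idem_mul_Kp (a b : ZMod P.d) : idem P b * Kp P a = zeta P (a * b) • idem P b := by
  rw [← Kp_mul_idem, idem, smul_mul_assoc, mul_smul_comm, Finset.mul_sum, Finset.sum_mul]
  congr 1
  refine Finset.sum_congr rfl fun j _ => ?_
  rw [mul_smul_comm, smul_mul_assoc, Kp_mul, Kp_mul, add_comm]

theorem sum_idem : ∑ b, idem P b = 1 := by
  simp only [idem]
  rw [← Finset.smul_sum, Finset.sum_comm]
  have h : ∀ j : ZMod P.d, ∑ b, zeta P (-(b * j)) • Kp P j =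
      if j = 0 then (P.d : ℂ) • (1 : Uq P) else 0 := by
    intro j
    rw [← Finset.sum_smul]
    simp only [← mul_neg]
    rw [sum_zeta_mul]
    simp only [neg_eq_zero]
    split_ifs with hj
    · rw [hj, Kp_zero]
    · rw [zero_smul]
  rw [Finset.sum_congr rfl fun j _ => h j]
  simp [smul_smul]

theorem idem_mul_idem (a b : ZMod P.d) :
    idem P a * idem P b = if a = b then idem P b else 0 := by
  conv_lhs => rw [idem]
  rw [smul_mul_assoc, Finset.sum_mul]
  have h : ∀ j, zeta P (-(a * j)) • Kp P j * idem P b = zeta P (j * (b - a)) • idem P b := by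
    intro j
    rw [smul_mul_assoc, Kp_mul_idem, smul_smul, ← AddChar.map_add_eq_mul]
    congr 2
    ring
  rw [Finset.sum_congr rfl fun j _ => h j, ← Finset.sum_smul, sum_zeta_mul]
  by_cases hab : a = b
  · simp [hab, smul_smul]
  · rw [if_neg (sub_ne_zero.mpr (Ne.symm hab)), if_neg hab, zero_smul, smul_zero]

theorem E_mul_idem (b : ZMod P.d) : E P * idem P b = idem P (b + 1) * E P := by
  rw [idem, idem, mul_smul_comm, smul_mul_assoc, Finset.mul_sum, Finset.sum_mul]
  congr 1
  refine Finset.sum_congr rfl fun j _ => ?_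
  rw [mul_smul_comm, smul_mul_assoc, E_mul_Kp, smul_smul, ← AddChar.map_add_eq_mul]
  congr 2
  ring

theorem idem_mul_F (b : ZMod P.d) : idem P b * F P = F P * idem P (b + 1) := by
  rw [idem, idem, mul_smul_comm, smul_mul_assoc, Finset.mul_sum, Finset.sum_mul]
  congr 1
  refine Finset.sum_congr rfl fun j _ => ?_
  rw [mul_smul_comm, smul_mul_assoc, F_mul_Kp, smul_smul, ← AddChar.map_add_eq_mul]
  congr 2
  ring

theorem idem_mul_F_pow (b : ZMod P.d) (k : ℕ) :
    idem P b * F P ^ k = F P ^ k * idem P (b + k) := by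
  induction k with
  | zero => simp
  | succ k ih =>
    rw [pow_succ, ← mul_assoc, ih, mul_assoc, idem_mul_F, mul_assoc, add_assoc, Nat.cast_succ]

/-! ### The Cartan part of the `R`-matrix -/

/-- The diagonal part of the `R`-matrix: it acts on `x ⊗ y` with `y` of weight `q ^ (2 b)` by
`K ^ b ⊗ 1`. -/
def cartan : Uq P ⊗[ℂ] Uq P := ∑ b, Kp P b ⊗ₜ idem P b

theorem cartan_eq : cartan P = ∑ b, idem P b ⊗ₜ[ℂ] Kp P b := by
  simp only [cartan, idem, TensorProduct.tmul_smul, TensorProduct.tmul_sum,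
    TensorProduct.sum_tmul, ← TensorProduct.smul_tmul', ← Finset.smul_sum]
  rw [Finset.sum_comm]
  simp only [mul_comm]

theorem cartan_mul_E_tmul :
    cartan P * (E P ⊗ₜ Kp P (-1)) = (E P ⊗ₜ 1) * cartan P := by
  simp only [cartan, Finset.mul_sum, Finset.sum_mul, Algebra.TensorProduct.tmul_mul_tmul, one_mul,
    Kp_mul_E, idem_mul_Kp, TensorProduct.tmul_smul, ← TensorProduct.smul_tmul', smul_smul]
  refine Finset.sum_congr rfl fun b _ => ?_
  rw [neg_one_mul, zeta_neg_mul, one_smul]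

theorem cartan_mul_tmul_E :
    cartan P * (1 ⊗ₜ E P) = (K P ⊗ₜ E P) * cartan P := by
  simp only [cartan, Finset.mul_sum, Finset.sum_mul, Algebra.TensorProduct.tmul_mul_tmul, mul_one,
    E_mul_idem]
  refine (Fintype.sum_equiv (Equiv.addRight 1) _ _ fun b => ?_).symm
  rw [← Kp_one, Kp_mul, Equiv.coe_addRight, add_comm]

theorem cartan_mul_tmul_F :
    cartan P * (K P ⊗ₜ F P) = (1 ⊗ₜ F P) * cartan P := by
  simp only [cartan, Finset.mul_sum, Finset.sum_mul, Algebra.TensorProduct.tmul_mul_tmul, one_mul,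
    idem_mul_F]
  refine Fintype.sum_equiv (Equiv.addRight 1) _ _ fun b => ?_
  rw [← Kp_one, Kp_mul, Equiv.coe_addRight]

theorem cartan_commute (a : ZMod P.d) : Commute (cartan P) (Kp P a ⊗ₜ Kp P a) := by
  simp only [Commute, SemiconjBy, cartan, Finset.mul_sum, Finset.sum_mul,
    Algebra.TensorProduct.tmul_mul_tmul, idem_mul_Kp, Kp_mul_idem, Kp_mul, add_comm]

theorem isUnit_cartan : IsUnit (cartan P) := by
  have h : ∀ s : ZMod P.d → ZMod P.d, (∀ b, b + s b = 0) →
      cartan P * ∑ b, Kp P (s b) ⊗ₜ[ℂ] idem P b = 1 ∧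
      (∑ b, Kp P (s b) ⊗ₜ[ℂ] idem P b) * cartan P = 1 := by
    intro s hs
    have hs' : ∀ b, s b + b = 0 := fun b => by rw [add_comm, hs]
    constructor <;>
    · simp only [cartan, Finset.mul_sum, Finset.sum_mul, Algebra.TensorProduct.tmul_mul_tmul,
        idem_mul_idem, Kp_mul]
      simp only [TensorProduct.tmul_ite, Finset.sum_ite_eq', Finset.mem_univ, if_true, hs, hs',
        Kp_zero, ← TensorProduct.tmul_sum, sum_idem]
      rfl
  obtain ⟨h1, h2⟩ := h (fun b => -b) fun b => add_neg_cancel b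
  exact ⟨⟨_, _, h1, h2⟩, rfl⟩

/-! ### The `q`-exponential -/

/-- The `q`-integer `1 + p + ⋯ + p ^ (k - 1)` for `p = q ^ (-2)`. -/
def pInt (k : ℕ) : ℂ := ∑ i ∈ Finset.range k, ((P.q ^ 2)⁻¹) ^ i

/-- The coefficients of the `q`-exponential series, `(q - q⁻¹) ^ k` over a `q`-factorial in
`q ^ (-2)`. -/
def expCoeff (k : ℕ) : ℂ := ∏ m ∈ Finset.range k, (P.q - P.q⁻¹) / pInt P (m + 1)

/-- The `q`-exponential of `(q - q⁻¹) x`, truncated in degree `d`. -/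
def qexp {A : Type*} [Ring A] [Algebra ℂ A] (x : A) : A :=
  ∑ k ∈ Finset.range P.d, expCoeff P k • x ^ k

theorem one_sub_p_ne_zero : 1 - (P.q ^ 2)⁻¹ ≠ 0 := by
  have h := P.prim_sq.inv.ne_one P.one_lt_d
  exact sub_ne_zero.mpr h.symm

theorem one_sub_p_mul_pInt (k : ℕ) : (1 - (P.q ^ 2)⁻¹) * pInt P k = 1 - ((P.q ^ 2)⁻¹) ^ k :=
  mul_neg_geom_sum _ _

theorem q_sub_inv_ne_zero : P.q - P.q⁻¹ ≠ 0 := by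
  have h := one_sub_p_ne_zero P
  have hq := P.q_ne_zero
  intro h0
  apply h
  field_simp at h0 ⊢
  simpa using h0

theorem pInt_ne_zero {k : ℕ} (h0 : 0 < k) (hk : k < P.d) : pInt P k ≠ 0 := by
  intro h
  have h1 := one_sub_p_mul_pInt P k
  rw [h, mul_zero] at h1
  exact P.prim_sq.inv.pow_ne_one_of_pos_of_lt h0.ne' hk (sub_eq_zero.mp h1.symm).symm

theorem expCoeff_zero : expCoeff P 0 = 1 := by simp [expCoeff]

theorem expCoeff_succ_mul {k : ℕ} (hk : k + 1 < P.d) :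
    expCoeff P (k + 1) * pInt P (k + 1) = (P.q - P.q⁻¹) * expCoeff P k := by
  rw [expCoeff, Finset.prod_range_succ, ← expCoeff, mul_assoc,
    div_mul_cancel₀ _ (pInt_ne_zero P k.succ_pos hk), mul_comm]

theorem pInt_mul_gaussBinom (n k : ℕ) :
    pInt P (k + 1) * gaussBinom (P.q ^ 2)⁻¹ (n + 1) (k + 1) =
      pInt P (n + 1) * gaussBinom (P.q ^ 2)⁻¹ n k := by
  apply mul_left_cancel₀ (one_sub_p_ne_zero P)
  rw [← mul_assoc, ← mul_assoc, one_sub_p_mul_pInt, one_sub_p_mul_pInt]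
  exact gaussBinom_absorb _ n k

theorem expCoeff_mul_gaussBinom (s t : ℕ) (h : s + t < P.d) :
    expCoeff P (s + t) * gaussBinom (P.q ^ 2)⁻¹ (s + t) s = expCoeff P s * expCoeff P t := by
  induction s with
  | zero => rw [gaussBinom_zero_right, expCoeff_zero, zero_add, one_mul, mul_one]
  | succ s ih =>
    apply mul_left_cancel₀ (pInt_ne_zero P s.succ_pos (by omega))
    have h1 := pInt_mul_gaussBinom P (s + t) s
    have h2 := expCoeff_succ_mul P (k := s + t) (by omega)
    have h3 := expCoeff_succ_mul P (k := s) (by omega)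
    rw [show s + 1 + t = s + t + 1 by omega]
    linear_combination expCoeff P (s + t + 1) * h1 + gaussBinom (P.q ^ 2)⁻¹ (s + t) s * h2 -
      expCoeff P t * h3 + (P.q - P.q⁻¹) * ih (by omega)

/-- The functional equation of the `q`-exponential. As the series is truncated in degree `d`, the
products `x ^ s * y ^ t` of higher degree have to vanish. -/
theorem qexp_add {A : Type*} [Ring A] [Algebra ℂ A] {x y : A}
    (h : y * x = (P.q ^ 2)⁻¹ • (x * y)) (h0 : ∀ s t, P.d ≤ s + t → x ^ s * y ^ t = 0) :
    qexp P (x + y) = qexp P x * qexp P y := by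
  simp only [qexp, qCommute_add_pow h, Finset.smul_sum, Finset.sum_mul_sum, smul_mul_smul_comm]
  rw [Finset.sum_sigma', ← Finset.sum_product']
  symm
  rw [← Finset.sum_filter_add_sum_filter_not _ (fun p : ℕ × ℕ => p.1 + p.2 < P.d)]
  rw [Finset.sum_eq_zero (s := Finset.filter (fun p : ℕ × ℕ => ¬ p.1 + p.2 < P.d) _), add_zero]
  · refine Finset.sum_nbij' (fun p => ⟨p.1 + p.2, p.1⟩) (fun p => (p.2, p.1 - p.2)) ?_ ?_ ?_ ?_ ?_
    · rintro ⟨s, t⟩ hst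
      simp only [Finset.mem_filter, Finset.mem_product, Finset.mem_sigma, Finset.mem_range] at *
      omega
    · rintro ⟨n, k⟩ hnk
      simp only [Finset.mem_filter, Finset.mem_product, Finset.mem_sigma, Finset.mem_range] at *
      omega
    · rintro ⟨s, t⟩ hst
      simp
    · rintro ⟨n, k⟩ hnk
      simp only [Finset.mem_sigma, Finset.mem_range] at hnk
      simp only [Sigma.mk.injEq, heq_eq_eq, and_true]
      omega
    · rintro ⟨s, t⟩ hst
      simp only [Finset.mem_filter] at hst
      simp only [smul_smul]
      rw [expCoeff_mul_gaussBinom P s t hst.2, Nat.add_sub_cancel_left]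
  · rintro ⟨s, t⟩ hst
    simp only [Finset.mem_filter, not_lt] at hst
    simp only
    rw [h0 s t hst.2, smul_zero]

theorem map_qexp {A B : Type*} [Ring A] [Algebra ℂ A] [Ring B] [Algebra ℂ B] (f : A →ₐ[ℂ] B)
    (x : A) : f (qexp P x) = qexp P (f x) := by
  simp only [qexp, map_sum, map_smul, map_pow]

theorem mul_qexp {A : Type*} [Ring A] [Algebra ℂ A] {c x y : A} (h : c * x = y * c) :
    c * qexp P x = qexp P y * c := by
  have hk : ∀ k, c * x ^ k = y ^ k * c := fun k => (SemiconjBy.pow_right h k).eq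
  simp only [qexp, Finset.mul_sum, Finset.sum_mul, mul_smul_comm, smul_mul_assoc, hk]

theorem isUnit_qexp {A : Type*} [Ring A] [Algebra ℂ A] {x : A} (h : x ^ P.d = 0) :
    IsUnit (qexp P x) := by
  obtain ⟨m, hm⟩ : ∃ m, P.d = m + 1 := ⟨P.d - 1, by have := P.d_pos; omega⟩
  rw [qexp, hm, Finset.sum_range_succ', expCoeff_zero, pow_zero, one_smul]
  have h1 : ∑ k ∈ Finset.range m, expCoeff P (k + 1) • x ^ (k + 1) =
      x * ∑ k ∈ Finset.range m, expCoeff P (k + 1) • x ^ k := by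
    rw [Finset.mul_sum]
    exact Finset.sum_congr rfl fun k _ => by rw [mul_smul_comm, pow_succ']
  rw [h1]
  apply IsNilpotent.isUnit_add_one
  refine Commute.isNilpotent_mul_right ?_ ⟨P.d, h⟩
  exact Commute.sum_right _ _ _ fun k _ => ((Commute.refl x).pow_right k).smul_right _

/-! ### Factorization of the `R`-matrix -/

theorem qInt_succ (m : ℕ) : qInt P (m + 1) = P.q ^ m * pInt P (m + 1) := by
  have hq := P.q_ne_zero
  have h := one_sub_p_mul_pInt P (m + 1)
  rw [qInt, div_eq_iff (q_sub_inv_ne_zero P)]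
  have e : P.q ^ m * pInt P (m + 1) * (P.q - P.q⁻¹) =
      P.q ^ (m + 1) * ((1 - (P.q ^ 2)⁻¹) * pInt P (m + 1)) := by
    field_simp
    ring
  rw [e, h, mul_sub, mul_one, ← inv_pow, ← mul_pow]
  congr 2
  field_simp

theorem expCoeff_eq (k : ℕ) :
    (P.q - P.q⁻¹) ^ k / qFactorial P k * P.q ^ ((k : ℤ) * (k - 1) / 2) = expCoeff P k := by
  have hq := P.q_ne_zero
  induction k with
  | zero => simp [qFactorial, expCoeff]
  | succ k ih =>
    have e : ((k + 1 : ℕ) : ℤ) * ((k + 1 : ℕ) - 1) / 2 = (k : ℤ) * (k - 1) / 2 + k := by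
      rw [← Int.add_mul_ediv_right _ _ two_ne_zero]
      push_cast
      congr 1
      ring
    rw [expCoeff, Finset.prod_range_succ, ← expCoeff, ← ih, qFactorial, Finset.prod_range_succ,
      ← qFactorial, qInt_succ, e, zpow_add₀ hq, zpow_natCast, pow_succ]
    have hk : P.q ^ k ≠ 0 := pow_ne_zero k hq
    field_simp

theorem sum_range_eq_sum_zmod {A : Type*} [AddCommMonoid A] (f : ℕ → A) :
    ∑ i ∈ Finset.range P.d, f i = ∑ a : ZMod P.d, f a.val := by
  refine Finset.sum_nbij' (fun i => (i : ZMod P.d)) (fun a => a.val) ?_ ?_ ?_ ?_ ?_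
  · simp
  · intro a _
    simpa using ZMod.val_lt a
  · intro i hi
    exact ZMod.val_cast_of_lt (Finset.mem_range.mp hi)
  · intro a _
    simp
  · intro i hi
    rw [ZMod.val_cast_of_lt (Finset.mem_range.mp hi)]

/-- Summing over the powers of `K` in the second factor first gives the weight idempotents; moving
`E ^ k` and `F ^ k` past `K ^ i ⊗ idem i` accounts for the power `q ^ (2 k (i - j))`. -/
theorem R_eq : R P = cartan P * qexp P (E P ⊗ₜ F P) := by
  have hq := P.q_ne_zero
  rw [R, sum_range_eq_sum_zmod]
  simp only [sum_range_eq_sum_zmod P (fun j => ∑ k ∈ Finset.range P.d, _)]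
  rw [cartan, qexp, Finset.sum_mul_sum, Finset.smul_sum]
  refine Finset.sum_congr rfl fun b _ => ?_
  rw [Finset.sum_comm, Finset.smul_sum]
  refine Finset.sum_congr rfl fun k _ => ?_
  rw [mul_smul_comm, Algebra.TensorProduct.tmul_pow, Algebra.TensorProduct.tmul_mul_tmul,
    Kp_mul_E_pow, idem_mul_F_pow, idem, mul_smul_comm, Finset.mul_sum, TensorProduct.tmul_smul,
    TensorProduct.tmul_sum, smul_comm, one_div]
  congr 1
  rw [Finset.smul_sum]
  refine Finset.sum_congr rfl fun j _ => ?_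
  rw [mul_smul_comm, TensorProduct.tmul_smul, ← TensorProduct.smul_tmul', smul_smul, smul_smul,
    Kp, Kp]
  congr 1
  have e1 : ((k : ℤ) * (k - 1) / 2 + 2 * k * (b.val - j.val) - 2 * b.val * j.val : ℤ) =
      (k : ℤ) * (k - 1) / 2 + 2 * ((k : ℤ) * (b.val - j.val) - b.val * j.val) := by ring
  have e2 : zeta P (-((b + k) * j)) * zeta P (b * k) =
      P.q ^ (2 * ((k : ℤ) * (b.val - j.val) - b.val * j.val)) := by
    rw [← AddChar.map_add_eq_mul, zpow_mul, zpow_two, ← pow_two, ← zeta_intCast]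
    congr 1
    push_cast
    simp only [ZMod.natCast_val, ZMod.cast_id', id_eq]
    ring
  rw [e1, zpow_add₀ hq, ← mul_assoc, expCoeff_eq, mul_assoc, e2]

theorem E_tmul_F_pow : (E P ⊗ₜ[ℂ] F P) ^ P.d = 0 := by
  rw [Algebra.TensorProduct.tmul_pow, E_pow, TensorProduct.zero_tmul]

theorem isUnit_R : IsUnit (R P) := by
  rw [R_eq]
  exact (isUnit_cartan P).mul (isUnit_qexp P (E_tmul_F_pow P))

theorem R_commute (a : ZMod P.d) : Commute (R P) (Kp P a ⊗ₜ Kp P a) := by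
  rw [R_eq]
  refine (cartan_commute P a).mul_left (mul_qexp P ?_).symm
  rw [Algebra.TensorProduct.tmul_mul_tmul, Algebra.TensorProduct.tmul_mul_tmul, Kp_mul_E, Kp_mul_F,
    TensorProduct.tmul_smul, ← TensorProduct.smul_tmul', smul_smul, zeta_neg_mul, one_smul]

/-! ### The intertwining property of the `R`-matrix on `E` -/

/-- The commutator of `E` with a power of `F`. The `q`-integer is the one that occurs in the
coefficients of `qexp`, so that the commutators telescope in `qexp_mul_comul_E`. -/
theorem E_mul_F_pow_succ (k : ℕ) : E P * F P ^ (k + 1) = F P ^ (k + 1) * E P +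
    ((P.q - P.q⁻¹)⁻¹ * pInt P (k + 1)) • (F P ^ k * K P - Kp P (-1) * F P ^ k) := by
  have hEF : E P * F P = F P * E P + (P.q - P.q⁻¹)⁻¹ • (K P - Kp P (-1)) := by
    rw [Kp_neg_one, ← E_mul_F]; abel
  have hFK : ∀ k, Kp P (-1) * F P ^ k = (P.q ^ 2) ^ k • (F P ^ k * Kp P (-1)) := by
    refine qCommute_pow ?_
    rw [Kp_mul_F, neg_neg, zeta_one]
  induction k with
  | zero => simpa [pInt] using hEF
  | succ k ih =>
    have hq : (P.q ^ 2) ≠ 0 := pow_ne_zero 2 P.q_ne_zero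
    have h1 : pInt P (k + 1 + 1) = 1 + (P.q ^ 2)⁻¹ * pInt P (k + 1) := by
      rw [pInt, Finset.sum_range_succ', pInt, Finset.mul_sum, add_comm, pow_zero]
      simp only [pow_succ']
    have h2 : pInt P (k + 1 + 1) * (P.q ^ 2) ^ (k + 1) =
        1 + (P.q ^ 2) ^ (k + 1) * pInt P (k + 1) := by
      rw [pInt, Finset.sum_range_succ, ← pInt, add_mul, ← mul_pow, inv_mul_cancel₀ hq, one_pow]
      ring
    rw [pow_succ (F P) (k + 1), ← mul_assoc, ih, add_mul, mul_assoc, hEF, smul_mul_assoc, sub_mul,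
      mul_assoc (F P ^ k), K_mul_F, mul_assoc (Kp P (-1)), ← pow_succ, hFK, mul_smul_comm,
      ← mul_assoc (F P ^ k), ← pow_succ, mul_add, mul_smul_comm, mul_sub]
    simp only [smul_sub, smul_smul]
    rw [mul_assoc _ (pInt P (k + 1 + 1)), h2, h1, ← mul_assoc (F P ^ (k + 1))]
    module

theorem qexp_mul_comul_E :
    qexp P (E P ⊗ₜ[ℂ] F P) * (1 ⊗ₜ E P + E P ⊗ₜ K P) =
      (1 ⊗ₜ E P + E P ⊗ₜ Kp P (-1)) * qexp P (E P ⊗ₜ[ℂ] F P) := by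
  obtain ⟨m, hm⟩ : ∃ m, P.d = m + 1 := ⟨P.d - 1, by have := P.d_pos; omega⟩
  have h : (1 ⊗ₜ[ℂ] E P) * qexp P (E P ⊗ₜ[ℂ] F P) - qexp P (E P ⊗ₜ[ℂ] F P) * (1 ⊗ₜ E P) =
      qexp P (E P ⊗ₜ[ℂ] F P) * (E P ⊗ₜ K P) - (E P ⊗ₜ Kp P (-1)) * qexp P (E P ⊗ₜ[ℂ] F P) := by
    simp only [qexp, Finset.mul_sum, Finset.sum_mul, mul_smul_comm, smul_mul_assoc,
      Algebra.TensorProduct.tmul_pow, Algebra.TensorProduct.tmul_mul_tmul, one_mul, mul_one,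
      ← Finset.sum_sub_distrib, ← smul_sub, ← TensorProduct.tmul_sub, ← pow_succ, ← pow_succ']
    rw [show Finset.range P.d = Finset.range (m + 1) by rw [hm], Finset.sum_range_succ',
      Finset.sum_range_succ, ← hm, E_pow, TensorProduct.zero_tmul, smul_zero, add_zero, pow_zero,
      pow_zero, one_mul, mul_one, sub_self, TensorProduct.tmul_zero, smul_zero, add_zero]
    refine Finset.sum_congr rfl fun k hk => ?_
    have hk' : k + 1 < P.d := by
      have := Finset.mem_range.mp hk
      omega
    rw [E_mul_F_pow_succ, add_sub_cancel_left, TensorProduct.tmul_smul, smul_smul]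
    congr 1
    rw [mul_left_comm, expCoeff_succ_mul P hk', inv_mul_cancel_left₀ (q_sub_inv_ne_zero P)]
  rw [mul_add, add_mul]
  rw [sub_eq_sub_iff_add_eq_add] at h
  rw [h]
  abel

/-- `R Δ(E) = Δᵒᵖ(E) R`. -/
theorem R_mul_comul_E :
    R P * comul P (E P) = (E P ⊗ₜ 1 + K P ⊗ₜ E P) * R P := by
  rw [comul_E, R_eq, mul_assoc, qexp_mul_comul_E, ← mul_assoc, ← mul_assoc, mul_add,
    cartan_mul_tmul_E, cartan_mul_E_tmul, ← add_mul, add_comm (K P ⊗ₜ[ℂ] E P)]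

end Uq

/-! ### Coproducts of the `R`-matrix -/

namespace Uq

variable (P : RootData)

/-- The embedding of `u_q ⊗ u_q` in the first and second factors of `u_q ⊗ u_q ⊗ u_q`. -/
def leg12 : Uq P ⊗[ℂ] Uq P →ₐ[ℂ] Uq P ⊗[ℂ] (Uq P ⊗[ℂ] Uq P) :=
  Algebra.TensorProduct.map (AlgHom.id ℂ (Uq P)) Algebra.TensorProduct.includeLeft

/-- The embedding of `u_q ⊗ u_q` in the first and third factors of `u_q ⊗ u_q ⊗ u_q`. -/
def leg13 : Uq P ⊗[ℂ] Uq P →ₐ[ℂ] Uq P ⊗[ℂ] (Uq P ⊗[ℂ] Uq P) :=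
  Algebra.TensorProduct.map (AlgHom.id ℂ (Uq P)) Algebra.TensorProduct.includeRight

/-- The embedding of `u_q ⊗ u_q` in the second and third factors of `u_q ⊗ u_q ⊗ u_q`. -/
def leg23 : Uq P ⊗[ℂ] Uq P →ₐ[ℂ] Uq P ⊗[ℂ] (Uq P ⊗[ℂ] Uq P) :=
  Algebra.TensorProduct.includeRight

theorem leg12_tmul (a b : Uq P) : leg12 P (a ⊗ₜ b) = a ⊗ₜ (b ⊗ₜ 1) := rfl
theorem leg13_tmul (a b : Uq P) : leg13 P (a ⊗ₜ b) = a ⊗ₜ (1 ⊗ₜ b) := rfl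
theorem leg23_tmul (a b : Uq P) : leg23 P (a ⊗ₜ b) = 1 ⊗ₜ (a ⊗ₜ b) := rfl

/-- The map `id ⊗ Δ`. -/
def comulRight : Uq P ⊗[ℂ] Uq P →ₐ[ℂ] Uq P ⊗[ℂ] (Uq P ⊗[ℂ] Uq P) :=
  Algebra.TensorProduct.map (AlgHom.id ℂ (Uq P)) (comul P)

/-- The map `Δ ⊗ id`. -/
def comulLeft : Uq P ⊗[ℂ] Uq P →ₐ[ℂ] Uq P ⊗[ℂ] (Uq P ⊗[ℂ] Uq P) :=
  (Algebra.TensorProduct.assoc ℂ ℂ ℂ (Uq P) (Uq P) (Uq P)).toAlgHom.comp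
    (Algebra.TensorProduct.map (comul P) (AlgHom.id ℂ (Uq P)))

theorem comulRight_tmul (a b : Uq P) : comulRight P (a ⊗ₜ b) = a ⊗ₜ comul P b := rfl

theorem comulLeft_tmul (a b : Uq P) :
    comulLeft P (a ⊗ₜ b) = leg12 P (comul P a) * (1 ⊗ₜ (1 ⊗ₜ b)) := by
  change Algebra.TensorProduct.assoc ℂ ℂ ℂ (Uq P) (Uq P) (Uq P) (comul P a ⊗ₜ b) = _
  induction comul P a with
  | zero => simp
  | add x y hx hy => rw [TensorProduct.add_tmul, map_add, hx, hy, map_add, add_mul]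
  | tmul x y => simp [leg12_tmul]

theorem leg12_commute (T : Uq P ⊗[ℂ] Uq P) (c : Uq P) :
    Commute (leg12 P T) (1 ⊗ₜ (1 ⊗ₜ c)) := by
  induction T with
  | zero => rw [map_zero]; exact Commute.zero_left _
  | add x y hx hy => rw [map_add]; exact hx.add_left hy
  | tmul x y => simp [Commute, SemiconjBy, leg12_tmul]

theorem leg13_commute (T : Uq P ⊗[ℂ] Uq P) (c : Uq P) :
    Commute (leg13 P T) (1 ⊗ₜ (c ⊗ₜ 1)) := by
  induction T with
  | zero => rw [map_zero]; exact Commute.zero_left _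
  | add x y hx hy => rw [map_add]; exact hx.add_left hy
  | tmul x y => simp [Commute, SemiconjBy, leg13_tmul]

theorem leg23_commute (T : Uq P ⊗[ℂ] Uq P) (c : Uq P) :
    Commute (leg23 P T) (c ⊗ₜ 1) := by
  simp [Commute, SemiconjBy, leg23]

theorem comulRight_cartan :
    comulRight P (cartan P) = leg13 P (cartan P) * leg12 P (cartan P) := by
  simp only [cartan_eq, map_sum, comulRight_tmul, leg13_tmul, leg12_tmul, comul_Kp,
    Finset.sum_mul_sum, Algebra.TensorProduct.tmul_mul_tmul, idem_mul_idem, one_mul, mul_one,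
    TensorProduct.ite_tmul, Finset.sum_ite_eq, Finset.mem_univ, if_true]

theorem comulLeft_cartan :
    comulLeft P (cartan P) = leg13 P (cartan P) * leg23 P (cartan P) := by
  simp only [cartan, map_sum, comulLeft_tmul, leg13_tmul, leg12_tmul, leg23_tmul, comul_Kp,
    Finset.sum_mul_sum, Algebra.TensorProduct.tmul_mul_tmul, idem_mul_idem, one_mul, mul_one,
    TensorProduct.tmul_ite, Finset.sum_ite_eq, Finset.mem_univ, if_true]

/-- `(id ⊗ Δ) R = R₁₃ R₁₂`: both factors of `R` are multiplicative, and moving the second Cartan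
part past the first `q`-exponential turns `E ⊗ K⁻¹ ⊗ F` into `E ⊗ 1 ⊗ F`. -/
theorem comulRight_R : comulRight P (R P) = leg13 P (R P) * leg12 P (R P) := by
  have hadd : comulRight P (qexp P (E P ⊗ₜ F P)) =
      qexp P (E P ⊗ₜ[ℂ] (Kp P (-1) ⊗ₜ[ℂ] F P)) * leg12 P (qexp P (E P ⊗ₜ F P)) := by
    rw [map_qexp, map_qexp, comulRight_tmul, comul_F, ← Kp_neg_one, TensorProduct.tmul_add,
      leg12_tmul]
    apply qexp_add
    · simp only [Algebra.TensorProduct.tmul_mul_tmul, one_mul, mul_one, F_mul_Kp,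
        ← TensorProduct.smul_tmul', TensorProduct.tmul_smul, AddChar.map_neg_eq_inv, zeta_one]
    · intro s t hst
      simp only [Algebra.TensorProduct.tmul_pow, Algebra.TensorProduct.tmul_mul_tmul, ← pow_add]
      rw [pow_eq_zero_of_le hst (E_pow P),
        TensorProduct.zero_tmul]
  have hcomm : leg12 P (cartan P) * (E P ⊗ₜ (Kp P (-1) ⊗ₜ F P)) =
      leg13 P (E P ⊗ₜ F P) * leg12 P (cartan P) := by
    have e1 : E P ⊗ₜ[ℂ] (Kp P (-1) ⊗ₜ[ℂ] F P) =
        leg12 P (E P ⊗ₜ Kp P (-1)) * (1 ⊗ₜ (1 ⊗ₜ F P)) := by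
      simp [leg12_tmul]
    have e2 : leg13 P (E P ⊗ₜ F P) = (1 ⊗ₜ (1 ⊗ₜ F P)) * leg12 P (E P ⊗ₜ 1) := by
      simp [leg12_tmul, leg13_tmul]
    rw [e1, ← mul_assoc, ← map_mul, cartan_mul_E_tmul, e2, mul_assoc, ← map_mul,
      (leg12_commute P _ _).eq]
  conv_lhs => rw [R_eq, map_mul, comulRight_cartan, hadd, mul_assoc, ← mul_assoc (leg12 P _),
    mul_qexp P hcomm]
  rw [R_eq, map_mul, map_mul, ← map_qexp]
  simp only [mul_assoc]

/-- `(Δ ⊗ id) R = R₁₃ R₂₃`. -/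
theorem comulLeft_R : comulLeft P (R P) = leg13 P (R P) * leg23 P (R P) := by
  have hadd : comulLeft P (qexp P (E P ⊗ₜ F P)) =
      qexp P (E P ⊗ₜ[ℂ] (K P ⊗ₜ[ℂ] F P)) * leg23 P (qexp P (E P ⊗ₜ F P)) := by
    have e : comulLeft P (E P ⊗ₜ F P) = E P ⊗ₜ (K P ⊗ₜ F P) + leg23 P (E P ⊗ₜ F P) := by
      simp [comulLeft_tmul, comul_E, leg12_tmul, leg23_tmul, add_mul, add_comm]
    rw [map_qexp, map_qexp, e, leg23_tmul]
    apply qexp_add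
    · simp only [Algebra.TensorProduct.tmul_mul_tmul, one_mul, mul_one, K_mul_E,
        ← TensorProduct.smul_tmul', TensorProduct.tmul_smul, smul_smul]
      rw [inv_mul_cancel₀ (pow_ne_zero 2 P.q_ne_zero), one_smul]
    · intro s t hst
      simp only [Algebra.TensorProduct.tmul_pow, Algebra.TensorProduct.tmul_mul_tmul, ← pow_add]
      rw [pow_eq_zero_of_le hst (F_pow P), TensorProduct.tmul_zero, TensorProduct.tmul_zero]
  have hcomm : leg23 P (cartan P) * (E P ⊗ₜ (K P ⊗ₜ F P)) =
      leg13 P (E P ⊗ₜ F P) * leg23 P (cartan P) := by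
    have e1 : E P ⊗ₜ[ℂ] (K P ⊗ₜ[ℂ] F P) = leg23 P (K P ⊗ₜ F P) * (E P ⊗ₜ 1) := by
      simp [leg23_tmul]
    have e2 : leg13 P (E P ⊗ₜ F P) = (E P ⊗ₜ 1) * leg23 P (1 ⊗ₜ F P) := by
      simp [leg23_tmul, leg13_tmul]
    rw [e1, ← mul_assoc, ← map_mul, cartan_mul_tmul_F, e2, mul_assoc, ← map_mul,
      (leg23_commute P _ _).eq]
  conv_lhs => rw [R_eq, map_mul, comulLeft_cartan, hadd, mul_assoc, ← mul_assoc (leg23 P _),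
    mul_qexp P hcomm]
  rw [R_eq, map_mul, map_mul, ← map_qexp]
  simp only [mul_assoc]

/-! ### The Yang–Baxter equation -/

/-- The opposite comultiplication. -/
def comulOp : Uq P →ₐ[ℂ] (Uq P ⊗[ℂ] Uq P) :=
  (Algebra.TensorProduct.comm ℂ (Uq P) (Uq P)).toAlgHom.comp (comul P)

theorem comulOp_apply (a : Uq P) :
    comulOp P a = Algebra.TensorProduct.comm ℂ (Uq P) (Uq P) (comul P a) := rfl

/-- `R Δ(a) = Δᵒᵖ(a) R`. This holds on all of `u_q`, but `u_q⁺` is enough for the Yang–Baxter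
equation, because the first tensor factors of `R` lie there. -/
theorem R_mul_comul {a : Uq P} (ha : a ∈ uqPlus P) : R P * comul P a = comulOp P a * R P := by
  refine Algebra.adjoin_induction (p := fun a _ => R P * comul P a = comulOp P a * R P)
    ?_ ?_ ?_ ?_ ha
  · rintro x (rfl | hx)
    · rw [R_mul_comul_E, comulOp_apply, comul_E]
      simp
    · obtain rfl : x = K P := hx
      rw [comulOp_apply, comul_K, ← Kp_one, (R_commute P 1).eq]
      simp
  · intro r
    rw [AlgHom.commutes, AlgHom.commutes, Algebra.commutes]
  · intro x y _ _ hx hy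
    rw [map_add, map_add, mul_add, add_mul, hx, hy]
  · intro x y _ _ hx hy
    rw [map_mul, map_mul, ← mul_assoc, hx, mul_assoc, hy, mul_assoc]

/-- An induction principle for `R`, whose first tensor factors lie in `u_q⁺`. -/
theorem R_induction : ∀ p : Uq P ⊗[ℂ] Uq P → Prop, p 0 → (∀ x y, p x → p y → p (x + y)) →
    (∀ (r : ℂ) x, p x → p (r • x)) → (∀ a ∈ uqPlus P, ∀ b, p (a ⊗ₜ b)) → p (R P) := by
  intro p h0 hadd hsmul ht
  have hs : ∀ (s : Finset ℕ) (f : ℕ → Uq P ⊗[ℂ] Uq P), (∀ i, p (f i)) → p (∑ i ∈ s, f i) :=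
    fun s f hf => Finset.sum_induction f p hadd h0 fun i _ => hf i
  refine hsmul _ _ (hs _ _ fun i => hs _ _ fun j => hs _ _ fun k => hsmul _ _ (ht _ ?_ _))
  have hE : E P ∈ uqPlus P := Algebra.subset_adjoin (by simp)
  have hK : K P ∈ uqPlus P := Algebra.subset_adjoin (by simp)
  exact mul_mem (pow_mem hE k) (pow_mem hK i)

/-- Apply `R₁₂ (Δ ⊗ id) = (Δᵒᵖ ⊗ id) R₁₂` to `R`. -/
theorem yang_baxter :
    leg12 P (R P) * leg13 P (R P) * leg23 P (R P) =
      leg23 P (R P) * leg13 P (R P) * leg12 P (R P) := by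
  let swap := (Algebra.TensorProduct.leftComm ℂ (Uq P) (Uq P) (Uq P)).toAlgHom
  have h13 : ∀ T, swap (leg13 P T) = leg23 P T := by
    intro T
    have : swap.comp (leg13 P) = leg23 P := by
      apply Algebra.TensorProduct.ext <;> ext x <;> simp [swap, leg13_tmul, leg23_tmul]
    exact AlgHom.congr_fun this T
  have h23 : ∀ T, swap (leg23 P T) = leg13 P T := by
    intro T
    have : swap.comp (leg23 P) = leg13 P := by
      apply Algebra.TensorProduct.ext <;> ext x <;> simp [swap, leg13_tmul, leg23_tmul]
    exact AlgHom.congr_fun this T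
  have h12 : ∀ T, swap (leg12 P T) =
      leg12 P (Algebra.TensorProduct.comm ℂ (Uq P) (Uq P) T) := by
    intro T
    have : swap.comp (leg12 P) =
        (leg12 P).comp (Algebra.TensorProduct.comm ℂ (Uq P) (Uq P)).toAlgHom := by
      apply Algebra.TensorProduct.ext <;> ext x <;> simp [swap, leg12_tmul]
    exact AlgHom.congr_fun this T
  have key : leg12 P (R P) * comulLeft P (R P) = swap (comulLeft P (R P)) * leg12 P (R P) := by
    refine R_induction P (fun T => leg12 P (R P) * comulLeft P T =
      swap (comulLeft P T) * leg12 P (R P)) ?_ ?_ ?_ ?_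
    · simp
    · intro x y hx hy
      rw [map_add, map_add, mul_add, add_mul, hx, hy]
    · intro r x hx
      rw [map_smul, map_smul, mul_smul_comm, smul_mul_assoc, hx]
    · intro a ha b
      have e : swap (1 ⊗ₜ (1 ⊗ₜ b)) = 1 ⊗ₜ (1 ⊗ₜ b) := by simp [swap]
      rw [comulLeft_tmul, map_mul, h12, e, ← comulOp_apply, ← mul_assoc, ← map_mul,
        R_mul_comul P ha, map_mul, mul_assoc, mul_assoc, (leg12_commute P _ _).eq]
  rw [comulLeft_R, map_mul, h13, h23] at key
  rw [mul_assoc, key]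

/-! ### The shifted `R`-matrices -/

/-- The element `(1 ⊗ K ^ l) R (K ^ (-m) ⊗ 1)`: `τ` times its action is the braiding of
`S_l ⊗ X` and `S_m ⊗ Y` when both are identified with `X` and `Y` as vector spaces. -/
def shiftedR (l m : ZMod P.d) : Uq P ⊗[ℂ] Uq P := (1 ⊗ₜ Kp P l) * R P * (Kp P (-m) ⊗ₜ 1)

/-- The element `K ^ a ⊗ K ^ b ⊗ K ^ c`. -/
def Kp3 (a b c : ZMod P.d) : Uq P ⊗[ℂ] (Uq P ⊗[ℂ] Uq P) := Kp P a ⊗ₜ (Kp P b ⊗ₜ Kp P c)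

theorem Kp3_mul (a b c a' b' c' : ZMod P.d) :
    Kp3 P a b c * Kp3 P a' b' c' = Kp3 P (a + a') (b + b') (c + c') := by
  simp only [Kp3, Algebra.TensorProduct.tmul_mul_tmul, Kp_mul]

theorem leg12_R_commute (a c : ZMod P.d) : Commute (leg12 P (R P)) (Kp3 P a a c) := by
  have h : Kp3 P a a c = leg12 P (Kp P a ⊗ₜ Kp P a) * (1 ⊗ₜ (1 ⊗ₜ Kp P c)) := by
    simp [leg12_tmul, Kp3]
  rw [h]
  exact ((R_commute P a).map (leg12 P)).mul_right (leg12_commute P _ _)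

theorem leg13_R_commute (a b : ZMod P.d) : Commute (leg13 P (R P)) (Kp3 P a b a) := by
  have h : Kp3 P a b a = leg13 P (Kp P a ⊗ₜ Kp P a) * (1 ⊗ₜ (Kp P b ⊗ₜ 1)) := by
    simp [leg13_tmul, Kp3]
  rw [h]
  exact ((R_commute P a).map (leg13 P)).mul_right (leg13_commute P _ _)

theorem leg23_R_commute (a b : ZMod P.d) : Commute (leg23 P (R P)) (Kp3 P a b b) := by
  have h : Kp3 P a b b = leg23 P (Kp P b ⊗ₜ Kp P b) * (Kp P a ⊗ₜ 1) := by
    simp [leg23_tmul, Kp3]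
  rw [h]
  exact ((R_commute P b).map (leg23 P)).mul_right (leg23_commute P _ _)

theorem leg12_shiftedR (l m : ZMod P.d) :
    leg12 P (shiftedR P l m) = Kp3 P 0 l 0 * leg12 P (R P) * Kp3 P (-m) 0 0 := by
  simp only [shiftedR, map_mul, leg12_tmul, Kp3, Kp_zero]

theorem leg13_shiftedR (l m : ZMod P.d) :
    leg13 P (shiftedR P l m) = Kp3 P 0 0 l * leg13 P (R P) * Kp3 P (-m) 0 0 := by
  simp only [shiftedR, map_mul, leg13_tmul, Kp3, Kp_zero]

theorem leg23_shiftedR (l m : ZMod P.d) :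
    leg23 P (shiftedR P l m) = Kp3 P 0 0 l * leg23 P (R P) * Kp3 P 0 (-m) 0 := by
  simp only [shiftedR, map_mul, leg23_tmul, Kp3, Kp_zero]

/-- The hexagon `comulRight_R` for shifted modules. The powers of `K` around `id ⊗ Δ` come from the
identification of `(S_m ⊗ Y) ⊗ (S_p ⊗ Z)` with `S_{m+p} ⊗ (Y ⊗ Z)`. -/
theorem shifted_comulRight (l m p : ZMod P.d) :
    (1 ⊗ₜ (Kp P p ⊗ₜ 1)) * comulRight P (shiftedR P l (m + p)) * (1 ⊗ₜ (Kp P (-p) ⊗ₜ 1)) =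
      leg13 P (shiftedR P l p) * leg12 P (shiftedR P l m) := by
  have e : ∀ a, 1 ⊗ₜ[ℂ] (Kp P a ⊗ₜ[ℂ] 1) = Kp3 P 0 a 0 := fun a => by rw [Kp3, Kp_zero]
  have e1 : comulRight P (1 ⊗ₜ Kp P l) = Kp3 P 0 l l := by
    rw [comulRight_tmul, comul_Kp, Kp3, Kp_zero]
  have e2 : comulRight P (Kp P (-(m + p)) ⊗ₜ 1) = Kp3 P (-(m + p)) 0 0 := by
    rw [comulRight_tmul, map_one, Kp3, Kp_zero]
    rfl
  have h1 : Kp3 P (-m) 0 0 = Kp3 P p p 0 * Kp3 P (-(m + p)) (-p) 0 := by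
    rw [Kp3_mul]
    congr 1 <;> ring
  have h2 : Kp3 P (-p) 0 0 * (Kp3 P 0 l 0 * Kp3 P p p 0) = Kp3 P 0 (p + l) 0 := by
    rw [Kp3_mul, Kp3_mul]
    congr 1 <;> ring
  rw [e, e, leg13_shiftedR, leg12_shiftedR, shiftedR, map_mul, map_mul, comulRight_R, e1, e2, h1]
  calc _ = Kp3 P 0 p 0 * Kp3 P 0 l l * (leg13 P (R P) * leg12 P (R P)) *
        (Kp3 P (-(m + p)) 0 0 * Kp3 P 0 (-p) 0) := by simp only [mul_assoc]
    _ = Kp3 P 0 0 l * (leg13 P (R P) * Kp3 P 0 (p + l) 0) * leg12 P (R P) *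
        Kp3 P (-(m + p)) (-p) 0 := by
      rw [(leg13_R_commute P _ _).eq, ← mul_assoc (Kp3 P 0 0 l), Kp3_mul, Kp3_mul, Kp3_mul]
      simp only [add_zero, zero_add, mul_assoc]
    _ = _ := by
      rw [← h2]
      simp only [mul_assoc]
      rw [← mul_assoc (leg12 P (R P)) (Kp3 P p p 0), (leg12_R_commute P _ _).eq]
      simp only [mul_assoc]

/-- The hexagon `comulLeft_R` for shifted modules. -/
theorem shifted_comulLeft (l m p : ZMod P.d) :
    (Kp P m ⊗ₜ 1) * comulLeft P (shiftedR P (l + m) p) * (Kp P (-m) ⊗ₜ 1) =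
      leg13 P (shiftedR P l p) * leg23 P (shiftedR P m p) := by
  have e : ∀ a, Kp P a ⊗ₜ[ℂ] (1 : Uq P ⊗[ℂ] Uq P) = Kp3 P a 0 0 := fun a => by
    rw [Kp3, Kp_zero]
    rfl
  have e1 : comulLeft P (1 ⊗ₜ Kp P (l + m)) = Kp3 P 0 0 (l + m) := by
    rw [comulLeft_tmul, map_one, map_one, one_mul, Kp3, Kp_zero]
  have e2 : comulLeft P (Kp P (-p) ⊗ₜ 1) = Kp3 P (-p) (-p) 0 := by
    rw [comulLeft_tmul, comul_Kp, leg12_tmul, Kp3, Kp_zero]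
    exact mul_one _
  have h1 : Kp3 P m 0 0 * Kp3 P 0 0 (l + m) = Kp3 P 0 0 l * Kp3 P m 0 m := by
    rw [Kp3_mul, Kp3_mul]
    simp only [add_zero, zero_add]
  have h2 : Kp3 P (-p) (-p) 0 * Kp3 P (-m) 0 0 = Kp3 P (-(p + m)) 0 0 * Kp3 P 0 (-p) 0 := by
    rw [Kp3_mul, Kp3_mul]
    congr 1 <;> ring
  have h3 : Kp3 P m 0 m * Kp3 P (-(p + m)) 0 0 = Kp3 P (-p) 0 0 * Kp3 P 0 0 m := by
    rw [Kp3_mul, Kp3_mul]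
    congr 1 <;> ring
  rw [e, e, leg13_shiftedR, leg23_shiftedR, shiftedR, map_mul, map_mul, comulLeft_R, e1, e2]
  calc _ = Kp3 P m 0 0 * Kp3 P 0 0 (l + m) * leg13 P (R P) * leg23 P (R P) *
        (Kp3 P (-p) (-p) 0 * Kp3 P (-m) 0 0) := by simp only [mul_assoc]
    _ = Kp3 P 0 0 l * (leg13 P (R P) * Kp3 P m 0 m) *
        (leg23 P (R P) * Kp3 P (-(p + m)) 0 0) * Kp3 P 0 (-p) 0 := by
      rw [h1, h2, (leg13_R_commute P _ _).eq]
      simp only [mul_assoc]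
    _ = Kp3 P 0 0 l * leg13 P (R P) * (Kp3 P m 0 m * Kp3 P (-(p + m)) 0 0) *
        leg23 P (R P) * Kp3 P 0 (-p) 0 := by
      rw [(leg23_R_commute P _ _).eq]
      simp only [mul_assoc]
    _ = _ := by
      rw [h3]
      simp only [mul_assoc]

/-- The powers of `K` in the six factors can be moved to the outside, since `K ^ a ⊗ K ^ a` commutes
with `R`; they agree on the two sides. -/
theorem shifted_yang_baxter (l m p : ZMod P.d) :
    leg12 P (shiftedR P l m) * leg13 P (shiftedR P l p) * leg23 P (shiftedR P m p) =
      leg23 P (shiftedR P m p) * leg13 P (shiftedR P l p) * leg12 P (shiftedR P l m) := by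
  have a1 : Kp3 P (-p) 0 0 * Kp3 P 0 0 m = Kp3 P m 0 m * Kp3 P (-(m + p)) 0 0 := by
    rw [Kp3_mul, Kp3_mul]
    congr 1 <;> ring
  have a2 : Kp3 P (-m) 0 0 * Kp3 P 0 0 l * Kp3 P m 0 m = Kp3 P 0 0 (l + m) := by
    rw [Kp3_mul, Kp3_mul]
    congr 1 <;> ring
  have b1 : Kp3 P 0 (-p) 0 * Kp3 P 0 0 l = Kp3 P 0 l l * Kp3 P 0 (-(l + p)) 0 := by
    rw [Kp3_mul, Kp3_mul]
    congr 1 <;> ring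
  have b2 : Kp3 P 0 (-(l + p)) 0 * (Kp3 P (-p) 0 0 * Kp3 P 0 l 0) = Kp3 P (-p) (-p) 0 := by
    rw [Kp3_mul, Kp3_mul]
    congr 1 <;> ring
  have c1 : Kp3 P 0 0 m * Kp3 P 0 l l = Kp3 P 0 l 0 * Kp3 P 0 0 (l + m) := by
    rw [Kp3_mul, Kp3_mul]
    congr 1 <;> ring
  have c2 : Kp3 P (-p) (-p) 0 * Kp3 P (-m) 0 0 = Kp3 P (-(m + p)) 0 0 * Kp3 P 0 (-p) 0 := by
    rw [Kp3_mul, Kp3_mul]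
    congr 1 <;> ring
  rw [leg12_shiftedR, leg13_shiftedR, leg23_shiftedR]
  trans Kp3 P 0 l 0 * Kp3 P 0 0 (l + m) * (leg12 P (R P) * leg13 P (R P) * leg23 P (R P)) *
    (Kp3 P (-(m + p)) 0 0 * Kp3 P 0 (-p) 0)
  · calc
      _ = Kp3 P 0 l 0 * leg12 P (R P) * (Kp3 P (-m) 0 0 * Kp3 P 0 0 l) * leg13 P (R P) *
          (Kp3 P (-p) 0 0 * Kp3 P 0 0 m) * leg23 P (R P) * Kp3 P 0 (-p) 0 := by
        simp only [mul_assoc]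
      _ = Kp3 P 0 l 0 * leg12 P (R P) * (Kp3 P (-m) 0 0 * Kp3 P 0 0 l) *
          (leg13 P (R P) * Kp3 P m 0 m) * (Kp3 P (-(m + p)) 0 0 * leg23 P (R P)) *
          Kp3 P 0 (-p) 0 := by
        rw [a1]
        simp only [mul_assoc]
      _ = Kp3 P 0 l 0 * (leg12 P (R P) * (Kp3 P (-m) 0 0 * Kp3 P 0 0 l * Kp3 P m 0 m)) *
          leg13 P (R P) * (leg23 P (R P) * Kp3 P (-(m + p)) 0 0) * Kp3 P 0 (-p) 0 := by
        rw [(leg13_R_commute P _ _).eq, (leg23_R_commute P _ _).eq]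
        simp only [mul_assoc]
      _ = _ := by
        rw [a2, (leg12_R_commute P _ _).eq]
        simp only [mul_assoc]
  · rw [yang_baxter, ← c1, ← c2]
    symm
    calc
      _ = Kp3 P 0 0 m * leg23 P (R P) * (Kp3 P 0 (-p) 0 * Kp3 P 0 0 l) * leg13 P (R P) *
          (Kp3 P (-p) 0 0 * Kp3 P 0 l 0) * leg12 P (R P) * Kp3 P (-m) 0 0 := by
        simp only [mul_assoc]
      _ = Kp3 P 0 0 m * (leg23 P (R P) * Kp3 P 0 l l) * (Kp3 P 0 (-(l + p)) 0 * leg13 P (R P)) *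
          (Kp3 P (-p) 0 0 * Kp3 P 0 l 0) * leg12 P (R P) * Kp3 P (-m) 0 0 := by
        rw [b1]
        simp only [mul_assoc]
      _ = Kp3 P 0 0 m * Kp3 P 0 l l * leg23 P (R P) * leg13 P (R P) *
          ((Kp3 P 0 (-(l + p)) 0 * (Kp3 P (-p) 0 0 * Kp3 P 0 l 0)) * leg12 P (R P)) *
          Kp3 P (-m) 0 0 := by
        rw [(leg23_R_commute P _ _).eq, ← (leg13_R_commute P _ _).eq]
        simp only [mul_assoc]
      _ = _ := by
        rw [b2, ← (leg12_R_commute P _ _).eq]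
        simp only [mul_assoc]

end Uq

/-! ### Action of the `R`-matrix on tensor products of shifted modules -/

namespace UqModule

variable {P : RootData}

/-- The action of `T` in `u_q ⊗ u_q` on `X ⊗ Y`, followed by the flip. -/
def flipAct (X Y : UqModule.{u} P) (T : Uq P ⊗[ℂ] Uq P) : (X ⊗[ℂ] Y) →ₗ[ℂ] (Y ⊗[ℂ] X) :=
  (TensorProduct.comm ℂ X Y).toLinearMap ∘ₗ outerRep X.ρ Y.ρ T

theorem flipAct_tmul (X Y : UqModule.{u} P) (a b : Uq P) (x : X) (y : Y) :
    flipAct X Y (a ⊗ₜ b) (x ⊗ₜ y) = Y.ρ b y ⊗ₜ X.ρ a x := rfl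

theorem flipAct_add (X Y : UqModule.{u} P) (S T : Uq P ⊗[ℂ] Uq P) :
    flipAct X Y (S + T) = flipAct X Y S + flipAct X Y T := by
  rw [flipAct, map_add, LinearMap.comp_add]
  rfl

theorem flipAct_zero (X Y : UqModule.{u} P) : flipAct X Y 0 = 0 := by
  rw [flipAct, map_zero, LinearMap.comp_zero]

/-- The action of `u_q ⊗ u_q ⊗ u_q` on `X ⊗ Y ⊗ Z`. -/
def outerRep₃ (X Y Z : UqModule.{u} P) :
    Uq P ⊗[ℂ] (Uq P ⊗[ℂ] Uq P) →ₐ[ℂ] Module.End ℂ (X ⊗[ℂ] (Y ⊗[ℂ] Z)) :=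
  outerRep X.ρ (outerRep Y.ρ Z.ρ)

theorem outerRep₃_tmul (X Y Z : UqModule.{u} P) (a b c : Uq P) (x : X) (y : Y) (z : Z) :
    outerRep₃ X Y Z (a ⊗ₜ (b ⊗ₜ c)) (x ⊗ₜ (y ⊗ₜ z)) = X.ρ a x ⊗ₜ (Y.ρ b y ⊗ₜ Z.ρ c z) := rfl

/-- `reorder` on the vectors `(1 ⊗ x) ⊗ (1 ⊗ y)`. -/
theorem reorder_map (m : ZMod P.d) (X Y : UqModule.{u} P) (z : X ⊗[ℂ] Y) :
    reorder m X Y (TensorProduct.map (TensorProduct.mk ℂ ℂ X 1) (TensorProduct.mk ℂ ℂ Y 1) z) =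
      1 ⊗ₜ outerRep X.ρ Y.ρ (Uq.Kp P (-m) ⊗ₜ 1) z := by
  induction z with
  | zero => simp
  | add z w hz hw => rw [map_add, map_add, hz, hw, map_add, TensorProduct.tmul_add]
  | tmul x y =>
    rw [TensorProduct.map_tmul, TensorProduct.mk_apply, TensorProduct.mk_apply, reorder_tmul,
      outerRep_tmul, TensorProduct.map_tmul, map_one, mul_one]
    rfl

theorem outerRep_mul_apply (X Y : UqModule.{u} P) (S T : Uq P ⊗[ℂ] Uq P) (z : X ⊗[ℂ] Y) :
    outerRep X.ρ Y.ρ S (outerRep X.ρ Y.ρ T z) = outerRep X.ρ Y.ρ (S * T) z := by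
  rw [map_mul]
  rfl

theorem outerRep₃_mul_apply (X Y Z : UqModule.{u} P) (S T : Uq P ⊗[ℂ] (Uq P ⊗[ℂ] Uq P))
    (z : X ⊗[ℂ] (Y ⊗[ℂ] Z)) :
    outerRep₃ X Y Z S (outerRep₃ X Y Z T z) = outerRep₃ X Y Z (S * T) z := by
  rw [map_mul]
  rfl

theorem reorder_symm_one_tmul (m : ZMod P.d) (X Y : UqModule.{u} P) (z : X ⊗[ℂ] Y) :
    (reorder m X Y).symm (1 ⊗ₜ z) =
      TensorProduct.map (TensorProduct.mk ℂ ℂ X 1) (TensorProduct.mk ℂ ℂ Y 1)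
        (outerRep X.ρ Y.ρ (Uq.Kp P m ⊗ₜ 1) z) := by
  rw [LinearEquiv.symm_apply_eq, reorder_map, outerRep_mul_apply,
    Algebra.TensorProduct.tmul_mul_tmul, Uq.Kp_neg_mul_self, one_mul]
  change _ = 1 ⊗ₜ (outerRep X.ρ Y.ρ 1 z)
  rw [map_one]
  rfl

/-- The braiding of shifted modules in terms of the element `shiftedR`. -/
theorem shiftBraiding_map (l m : ZMod P.d) (X Y : UqModule.{u} P) (z : X ⊗[ℂ] Y) :
    shiftBraiding l X m Y
        (TensorProduct.map (TensorProduct.mk ℂ ℂ X 1) (TensorProduct.mk ℂ ℂ Y 1) z) =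
      TensorProduct.map (TensorProduct.mk ℂ ℂ Y 1) (TensorProduct.mk ℂ ℂ X 1)
        (flipAct X Y (Uq.shiftedR P l m) z) := by
  have hflip : ∀ w : X ⊗[ℂ] Y, outerRep Y.ρ X.ρ (Uq.Kp P l ⊗ₜ 1) (TensorProduct.comm ℂ X Y w) =
      TensorProduct.comm ℂ X Y (outerRep X.ρ Y.ρ (1 ⊗ₜ Uq.Kp P l) w) := by
    intro w
    induction w with
    | zero => simp
    | add z w hz hw => simp only [map_add, hz, hw]
    | tmul x y => rfl
  change (reorder l Y X).symm ((tauR X Y).lTensor ℂ (reorder m X Y _)) = _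
  rw [reorder_map, LinearMap.lTensor_tmul, reorder_symm_one_tmul]
  congr 1
  change outerRep Y.ρ X.ρ _ (TensorProduct.comm ℂ X Y (outerRep X.ρ Y.ρ (Uq.R P) _)) =
    TensorProduct.comm ℂ X Y (outerRep X.ρ Y.ρ (Uq.shiftedR P l m) z)
  rw [hflip, outerRep_mul_apply, outerRep_mul_apply, Uq.shiftedR, mul_assoc]

theorem outerRep_tensor_right (X Y Z : UqModule.{u} P) (T : Uq P ⊗[ℂ] Uq P)
    (z : X ⊗[ℂ] (Y ⊗[ℂ] Z)) :
    outerRep X.ρ ((outerRep Y.ρ Z.ρ).comp (Uq.comul P)) T z =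
      outerRep₃ X Y Z (Uq.comulRight P T) z := by
  have h : outerRep X.ρ ((outerRep Y.ρ Z.ρ).comp (Uq.comul P)) =
      (outerRep₃ X Y Z).comp (Uq.comulRight P) := by
    apply Algebra.TensorProduct.ext <;> ext x <;> rfl
  rw [h]
  rfl

theorem outerRep_tensor_left (X Y Z : UqModule.{u} P) (T : Uq P ⊗[ℂ] Uq P)
    (z : (X ⊗[ℂ] Y) ⊗[ℂ] Z) :
    TensorProduct.assoc ℂ X Y Z (outerRep ((outerRep X.ρ Y.ρ).comp (Uq.comul P)) Z.ρ T z) =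
      outerRep₃ X Y Z (Uq.comulLeft P T) (TensorProduct.assoc ℂ X Y Z z) := by
  have h : ∀ (S : Uq P ⊗[ℂ] Uq P) (c : Uq P) (z : (X ⊗[ℂ] Y) ⊗[ℂ] Z),
      TensorProduct.assoc ℂ X Y Z (outerRep (outerRep X.ρ Y.ρ) Z.ρ (S ⊗ₜ c) z) =
      outerRep₃ X Y Z (Uq.leg12 P S * (1 ⊗ₜ (1 ⊗ₜ c))) (TensorProduct.assoc ℂ X Y Z z) := by
    intro S c z
    induction S with
    | zero => simp
    | add S T hS hT =>
      simp only [TensorProduct.add_tmul, map_add, LinearMap.add_apply, hS, hT, add_mul]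
    | tmul a b =>
      rw [Uq.leg12_tmul, Algebra.TensorProduct.tmul_mul_tmul, Algebra.TensorProduct.tmul_mul_tmul,
        mul_one, mul_one, one_mul]
      induction z with
      | zero => simp
      | add z w hz hw => simp only [map_add, hz, hw]
      | tmul z w =>
        induction z with
        | zero => simp
        | add z w hz hw => simp only [TensorProduct.add_tmul, map_add, hz, hw]
        | tmul x y => rfl
  induction T with
  | zero => simp
  | add S T hS hT => simp only [map_add, LinearMap.add_apply, hS, hT]
  | tmul a c =>
    rw [Uq.comulLeft_tmul]
    exact h (Uq.comul P a) c z

section Composition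

variable {X Y Z : UqModule.{u} P} {U V W : Type u} [AddCommGroup U] [Module ℂ U]
  [AddCommGroup V] [Module ℂ V] [AddCommGroup W] [Module ℂ W]
  {i : X →ₗ[ℂ] U} {j : Y →ₗ[ℂ] V} {k : Z →ₗ[ℂ] W}

/-- If `c` restricts on `X ⊗ Y` to the flipped action of `S` and `c'` on `X ⊗ Z` to that of `T`,
then `(id ⊗ c') (c ⊗ id)` restricts to the action of `T₁₃ S₁₂`, followed by a permutation of the
factors. -/
theorem lTensor_rTensor_apply {c : U ⊗[ℂ] V →ₗ[ℂ] V ⊗[ℂ] U} {c' : U ⊗[ℂ] W →ₗ[ℂ] W ⊗[ℂ] U}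
    {S T : Uq P ⊗[ℂ] Uq P}
    (hc : ∀ x y, c (i x ⊗ₜ j y) = TensorProduct.map j i (flipAct X Y S (x ⊗ₜ y)))
    (hc' : ∀ x z, c' (i x ⊗ₜ k z) = TensorProduct.map k i (flipAct X Z T (x ⊗ₜ z)))
    (x : X) (y : Y) (z : Z) :
    c'.lTensor V (TensorProduct.assoc ℂ V U W (c.rTensor W ((i x ⊗ₜ j y) ⊗ₜ k z))) =
      TensorProduct.assoc ℂ V W U (TensorProduct.comm ℂ U (V ⊗[ℂ] W)
        (TensorProduct.map i (TensorProduct.map j k)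
          (outerRep₃ X Y Z (Uq.leg13 P T * Uq.leg12 P S) (x ⊗ₜ (y ⊗ₜ z))))) := by
  rw [LinearMap.rTensor_tmul, hc]
  clear hc
  induction S with
  | zero => simp [flipAct_zero]
  | add S S' hS hS' =>
    simp only [flipAct_add, LinearMap.add_apply, map_add, TensorProduct.add_tmul, hS, hS', mul_add]
  | tmul a b =>
    rw [flipAct_tmul, TensorProduct.map_tmul, TensorProduct.assoc_tmul, LinearMap.lTensor_tmul,
      hc']
    clear hc'
    induction T with
    | zero => simp [flipAct_zero]
    | add S S' hS hS' =>
      simp only [flipAct_add, LinearMap.add_apply, map_add, TensorProduct.tmul_add, hS, hS',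
        add_mul]
    | tmul c d =>
      rw [flipAct_tmul, Uq.leg12_tmul, Uq.leg13_tmul, ← outerRep₃_mul_apply, outerRep₃_tmul,
        outerRep₃_tmul, map_one, map_one]
      rfl

/-- If `c` restricts on `Y ⊗ Z` to the flipped action of `S` and `c'` on `X ⊗ Z` to that of `T`,
then `(c' ⊗ id) (id ⊗ c)` restricts to the action of `T₁₃ S₂₃`, followed by a permutation of the
factors. -/
theorem rTensor_lTensor_apply {c : V ⊗[ℂ] W →ₗ[ℂ] W ⊗[ℂ] V} {c' : U ⊗[ℂ] W →ₗ[ℂ] W ⊗[ℂ] U}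
    {S T : Uq P ⊗[ℂ] Uq P}
    (hc : ∀ y z, c (j y ⊗ₜ k z) = TensorProduct.map k j (flipAct Y Z S (y ⊗ₜ z)))
    (hc' : ∀ x z, c' (i x ⊗ₜ k z) = TensorProduct.map k i (flipAct X Z T (x ⊗ₜ z)))
    (x : X) (y : Y) (z : Z) :
    c'.rTensor V ((TensorProduct.assoc ℂ U W V).symm (c.lTensor U (i x ⊗ₜ (j y ⊗ₜ k z)))) =
      (TensorProduct.assoc ℂ W U V).symm (TensorProduct.comm ℂ (U ⊗[ℂ] V) W
        ((TensorProduct.assoc ℂ U V W).symm (TensorProduct.map i (TensorProduct.map j k)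
          (outerRep₃ X Y Z (Uq.leg13 P T * Uq.leg23 P S) (x ⊗ₜ (y ⊗ₜ z)))))) := by
  rw [LinearMap.lTensor_tmul, hc]
  clear hc
  induction S with
  | zero => simp [flipAct_zero]
  | add S S' hS hS' =>
    simp only [flipAct_add, LinearMap.add_apply, map_add, TensorProduct.tmul_add, hS, hS', mul_add]
  | tmul a b =>
    rw [flipAct_tmul, TensorProduct.map_tmul, TensorProduct.assoc_symm_tmul,
      LinearMap.rTensor_tmul, hc']
    clear hc'
    induction T with
    | zero => simp [flipAct_zero]
    | add S S' hS hS' =>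
      simp only [flipAct_add, LinearMap.add_apply, map_add, TensorProduct.add_tmul, hS, hS',
        add_mul]
    | tmul c d =>
      rw [flipAct_tmul, Uq.leg23_tmul, Uq.leg13_tmul, ← outerRep₃_mul_apply, outerRep₃_tmul,
        outerRep₃_tmul, map_one, map_one]
      rfl

end Composition

/-! ### The braiding is linear over `u_q⁺` and bijective -/

theorem tauR_isIntertwining (X Y : UqModule.{u} P) :
    IsIntertwining (X.tensor Y).res (Y.tensor X).res (tauR X Y) := by
  intro a (z : X ⊗[ℂ] Y)
  have hflip : ∀ (T : Uq P ⊗[ℂ] Uq P) (w : X ⊗[ℂ] Y),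
      TensorProduct.comm ℂ X Y (outerRep X.ρ Y.ρ
        (Algebra.TensorProduct.comm ℂ (Uq P) (Uq P) T) w) =
      outerRep Y.ρ X.ρ T (TensorProduct.comm ℂ X Y w) := by
    intro T w
    induction T with
    | zero => simp
    | add S T hS hT => simp only [map_add, LinearMap.add_apply, hS, hT]
    | tmul a b =>
      induction w with
      | zero => simp
      | add z w hz hw => simp only [map_add, hz, hw]
      | tmul x y => rfl
  change TensorProduct.comm ℂ X Y (outerRep X.ρ Y.ρ (Uq.R P)
      (outerRep X.ρ Y.ρ (Uq.comul P (a : Uq P)) z)) =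
    outerRep Y.ρ X.ρ (Uq.comul P (a : Uq P))
      (TensorProduct.comm ℂ X Y (outerRep X.ρ Y.ρ (Uq.R P) z))
  rw [outerRep_mul_apply, Uq.R_mul_comul P a.2, ← outerRep_mul_apply, Uq.comulOp_apply, hflip]

theorem shiftBraiding_isIntertwining (l m : ZMod P.d) (X Y : UqModule.{u} P) :
    IsIntertwining (tensorRep (X.shift l) (Y.shift m)) (tensorRep (Y.shift m) (X.shift l))
      (shiftBraiding l X m Y) := by
  intro a z
  have h1 := reorder_isIntertwining l m X Y a z
  have h2 : IsIntertwining ((X.tensor Y).shift (l + m)) ((Y.tensor X).shift (l + m))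
      ((tauR X Y).lTensor ℂ) :=
    IsIntertwining.tensor (f := LinearMap.id) (fun _ _ => rfl) (tauR_isIntertwining X Y)
  have h3 := (reorder_isIntertwining m l Y X).symm a
  rw [add_comm m l] at h3
  change (reorder l Y X).symm ((tauR X Y).lTensor ℂ (reorder m X Y _)) = _
  refine (congrArg (fun w => (reorder l Y X).symm ((tauR X Y).lTensor ℂ w)) h1).trans ?_
  exact (congrArg (reorder l Y X).symm (h2 a (reorder m X Y z))).trans (h3 _)

theorem tauR_bijective (X Y : UqModule.{u} P) : Function.Bijective (tauR X Y) := by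
  have h : IsUnit (outerRep X.ρ Y.ρ (Uq.R P)) := (Uq.isUnit_R P).map _
  exact (TensorProduct.comm ℂ X Y).bijective.comp ((Module.End.isUnit_iff _).mp h)

theorem shiftBraiding_bijective (l m : ZMod P.d) (X Y : UqModule.{u} P) :
    Function.Bijective (shiftBraiding l X m Y) := by
  have h : Function.Bijective ((tauR X Y).lTensor ℂ) :=
    (LinearEquiv.lTensor ℂ (LinearEquiv.ofBijective (tauR X Y) (tauR_bijective X Y))).bijective
  exact (reorder l Y X).symm.bijective.comp (h.comp (reorder m X Y).bijective)

end UqModule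

namespace Presentation

variable {P : RootData} {U V W : Type u} [AddCommGroup U] [Module ℂ U]
  [AddCommGroup V] [Module ℂ V] [AddCommGroup W] [Module ℂ W]
  {ρ : uqPlus P →ₐ[ℂ] Module.End ℂ U} {σ : uqPlus P →ₐ[ℂ] Module.End ℂ V}
  {θ : uqPlus P →ₐ[ℂ] Module.End ℂ W}

theorem sum_inc_proj_apply (π : Presentation ρ) (x : U) : ∑ a, π.inc a (π.proj a x) = x := by
  simpa using LinearMap.congr_fun π.sum_inc_proj x

theorem proj_inc_self_apply (π : Presentation ρ) (a : π.ι) (x : ℂ ⊗[ℂ] π.X a) :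
    π.proj a (π.inc a x) = x :=
  LinearMap.congr_fun (π.proj_inc_self a) x

theorem proj_inc_ne_apply (π : Presentation ρ) {a b : π.ι} (h : a ≠ b) (x : ℂ ⊗[ℂ] π.X a) :
    π.proj b (π.inc a x) = 0 :=
  LinearMap.congr_fun (π.proj_inc_ne a b h) x

theorem proj_isIntertwining (π : Presentation ρ) (a : π.ι) :
    IsIntertwining ρ ((π.X a).shift (π.l a)) (π.proj a) := by
  classical
  intro r x
  conv_lhs => rw [← π.sum_inc_proj_apply x, map_sum, map_sum]
  rw [Finset.sum_eq_single a]
  · rw [← π.inc_isIntertwining a, π.proj_inc_self_apply]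
  · intro b _ hb
    rw [← π.inc_isIntertwining b, π.proj_inc_ne_apply hb]
  · simp

theorem braiding_isIntertwining (π : Presentation ρ) (κ : Presentation σ) :
    IsIntertwining (tensorRep ρ σ) (tensorRep σ ρ) (π.braiding κ) := by
  intro r z
  simp only [braiding, LinearMap.sum_apply, map_sum, LinearMap.comp_apply]
  refine Finset.sum_congr rfl fun a _ => Finset.sum_congr rfl fun b _ => ?_
  rw [(π.proj_isIntertwining a).tensor (κ.proj_isIntertwining b),
    UqModule.shiftBraiding_isIntertwining,
    (κ.inc_isIntertwining b).tensor (π.inc_isIntertwining a)]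

theorem braiding_map_inc (π : Presentation ρ) (κ : Presentation σ) (a : π.ι) (b : κ.ι)
    (z : (ℂ ⊗[ℂ] π.X a) ⊗[ℂ] (ℂ ⊗[ℂ] κ.X b)) :
    π.braiding κ (TensorProduct.map (π.inc a) (κ.inc b) z) =
      TensorProduct.map (κ.inc b) (π.inc a)
        (UqModule.shiftBraiding (π.l a) (π.X a) (κ.l b) (κ.X b) z) := by
  classical
  simp only [braiding, LinearMap.sum_apply, LinearMap.comp_apply]
  rw [Finset.sum_eq_single a, Finset.sum_eq_single b]
  · rw [← LinearMap.comp_apply (TensorProduct.map (π.proj _) _), ← TensorProduct.map_comp,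
      π.proj_inc_self, κ.proj_inc_self, TensorProduct.map_id, LinearMap.id_apply]
  · intro c _ hc
    rw [← LinearMap.comp_apply (TensorProduct.map (π.proj _) _), ← TensorProduct.map_comp,
      κ.proj_inc_ne _ _ hc.symm, TensorProduct.map_zero_right]
    simp
  · simp
  · intro c _ hc
    refine Finset.sum_eq_zero fun e _ => ?_
    rw [← LinearMap.comp_apply (TensorProduct.map (π.proj _) _), ← TensorProduct.map_comp,
      π.proj_inc_ne _ _ hc.symm, TensorProduct.map_zero_left]
    simp
  · simp

theorem sum_map_inc_proj (π : Presentation ρ) (κ : Presentation σ) (z : U ⊗[ℂ] V) :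
    ∑ a, ∑ b, TensorProduct.map (π.inc a) (κ.inc b)
      (TensorProduct.map (π.proj a) (κ.proj b) z) = z := by
  induction z with
  | zero => simp
  | add z w hz hw =>
    simp only [map_add, Finset.sum_add_distrib]
    rw [hz, hw]
  | tmul x y =>
    simp only [TensorProduct.map_tmul, ← TensorProduct.tmul_sum, ← TensorProduct.sum_tmul,
      sum_inc_proj_apply]

theorem map_proj_braiding (π : Presentation ρ) (κ : Presentation σ) (a : π.ι) (b : κ.ι)
    (z : U ⊗[ℂ] V) :
    TensorProduct.map (κ.proj b) (π.proj a) (π.braiding κ z) =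
      UqModule.shiftBraiding (π.l a) (π.X a) (κ.l b) (κ.X b)
        (TensorProduct.map (π.proj a) (κ.proj b) z) := by
  classical
  simp only [braiding, LinearMap.sum_apply, LinearMap.comp_apply, map_sum]
  rw [Finset.sum_eq_single a, Finset.sum_eq_single b]
  · rw [← LinearMap.comp_apply (TensorProduct.map (κ.proj _) _), ← TensorProduct.map_comp,
      π.proj_inc_self, κ.proj_inc_self, TensorProduct.map_id, LinearMap.id_apply]
  · intro c _ hc
    rw [← LinearMap.comp_apply (TensorProduct.map (κ.proj _) _), ← TensorProduct.map_comp,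
      κ.proj_inc_ne _ _ hc, TensorProduct.map_zero_left]
    simp
  · simp
  · intro c _ hc
    refine Finset.sum_eq_zero fun e _ => ?_
    rw [← LinearMap.comp_apply (TensorProduct.map (κ.proj _) _), ← TensorProduct.map_comp,
      π.proj_inc_ne _ _ hc, TensorProduct.map_zero_right]
    simp
  · simp

theorem braiding_bijective (π : Presentation ρ) (κ : Presentation σ) :
    Function.Bijective (π.braiding κ) := by
  constructor
  · rw [← LinearMap.ker_eq_bot, LinearMap.ker_eq_bot']
    intro z hz
    rw [← sum_map_inc_proj π κ z]
    refine Finset.sum_eq_zero fun a _ => Finset.sum_eq_zero fun b _ => ?_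
    have h := map_proj_braiding π κ a b z
    rw [hz, map_zero] at h
    have h' := (UqModule.shiftBraiding_bijective (π.l a) (κ.l b) (π.X a) (κ.X b)).1
      (h.symm.trans (map_zero _).symm)
    rw [h', map_zero]
  · intro w
    have hsurj := fun a b => (UqModule.shiftBraiding_bijective
      (π.l a) (κ.l b) (π.X a) (κ.X b)).2 (TensorProduct.map (κ.proj b) (π.proj a) w)
    choose f hf using hsurj
    refine ⟨∑ a, ∑ b, TensorProduct.map (π.inc a) (κ.inc b) (f a b), ?_⟩
    simp only [map_sum, braiding_map_inc, hf]
    rw [Finset.sum_comm, sum_map_inc_proj κ π w]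

/-! ### The hexagon identities and the braid relation -/

/-- The embedding `x ↦ 1 ⊗ x` of the vector space underlying `X a` in the summand
`S_{l a} ⊗ X a` of `U`. -/
def emb (π : Presentation ρ) (a : π.ι) : π.X a →ₗ[ℂ] U :=
  π.inc a ∘ₗ TensorProduct.mk ℂ ℂ (π.X a) 1

theorem emb_apply (π : Presentation ρ) (a : π.ι) (x : π.X a) : π.emb a x = π.inc a (1 ⊗ₜ x) := rfl

theorem braiding_emb (π : Presentation ρ) (κ : Presentation σ) (a : π.ι) (b : κ.ι)
    (x : π.X a) (y : κ.X b) :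
    π.braiding κ (π.emb a x ⊗ₜ κ.emb b y) = TensorProduct.map (κ.emb b) (π.emb a)
      (UqModule.flipAct (π.X a) (κ.X b) (Uq.shiftedR P (π.l a) (κ.l b)) (x ⊗ₜ y)) := by
  have h1 := braiding_map_inc π κ a b ((1 ⊗ₜ x) ⊗ₜ (1 ⊗ₜ y))
  have h2 := UqModule.shiftBraiding_map (π.l a) (κ.l b) (π.X a) (κ.X b) (x ⊗ₜ y)
  refine h1.trans ((congrArg _ h2).trans ?_)
  rw [emb, emb, TensorProduct.map_comp]
  rfl

theorem emb_induction (π : Presentation ρ) {p : U → Prop} (hadd : ∀ x y, p x → p y → p (x + y))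
    (h0 : p 0) (h : ∀ a x, p (π.emb a x)) (x : U) : p x := by
  rw [← π.sum_inc_proj_apply x]
  refine Finset.sum_induction _ p hadd h0 fun a _ => ?_
  have e : π.proj a x = 1 ⊗ₜ TensorProduct.lid ℂ (π.X a) (π.proj a x) :=
    ((TensorProduct.lid ℂ (π.X a)).symm_apply_apply _).symm
  rw [e]
  exact h a _

theorem linearMap_ext₃ (π : Presentation ρ) (κ : Presentation σ) (μ : Presentation θ)
    {M : Type*} [AddCommGroup M] [Module ℂ M] {f g : U ⊗[ℂ] (V ⊗[ℂ] W) →ₗ[ℂ] M}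
    (h : ∀ a b c x y z, f (π.emb a x ⊗ₜ (κ.emb b y ⊗ₜ μ.emb c z)) =
      g (π.emb a x ⊗ₜ (κ.emb b y ⊗ₜ μ.emb c z))) : f = g := by
  refine TensorProduct.ext' fun u t => ?_
  induction t with
  | zero => simp
  | add t t' ht ht' => simp only [TensorProduct.tmul_add, map_add, ht, ht']
  | tmul v w =>
    refine π.emb_induction (p := fun u => f (u ⊗ₜ _) = g (u ⊗ₜ _)) ?_ ?_ (fun a x => ?_) u
    · intro x y hx hy
      simp only [TensorProduct.add_tmul, map_add, hx, hy]
    · simp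
    refine κ.emb_induction (p := fun v => f (_ ⊗ₜ (v ⊗ₜ _)) = g (_ ⊗ₜ (v ⊗ₜ _))) ?_ ?_
      (fun b y => ?_) v
    · intro x y hx hy
      simp only [TensorProduct.tmul_add, TensorProduct.add_tmul, map_add, hx, hy]
    · simp
    refine μ.emb_induction (p := fun w => f (_ ⊗ₜ (_ ⊗ₜ w)) = g (_ ⊗ₜ (_ ⊗ₜ w))) ?_ ?_
      (fun c z => ?_) w
    · intro x y hx hy
      simp only [TensorProduct.tmul_add, map_add, hx, hy]
    · simp
    exact h a b c x y z

/-- The embedding of `X a ⊗ X b` in `U ⊗ V` coming from the decomposition of `U ⊗ V`. It is not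
`emb a ⊗ emb b`: see `tensorEmb_apply`. -/
def tensorEmb (π : Presentation ρ) (κ : Presentation σ) (a : π.ι) (b : κ.ι) :
    (π.X a ⊗[ℂ] κ.X b) →ₗ[ℂ] (U ⊗[ℂ] V) :=
  (π.tensor κ).emb (a, b)

theorem tensorEmb_apply (π : Presentation ρ) (κ : Presentation σ) (a : π.ι) (b : κ.ι)
    (z : π.X a ⊗[ℂ] κ.X b) :
    tensorEmb π κ a b z = TensorProduct.map (π.emb a) (κ.emb b)
      (outerRep (π.X a).ρ (κ.X b).ρ (Uq.Kp P (κ.l b) ⊗ₜ 1) z) := by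
  have h := UqModule.reorder_symm_one_tmul (κ.l b) (π.X a) (κ.X b) z
  change TensorProduct.map (π.inc a) (κ.inc b)
    ((UqModule.reorder (κ.l b) (π.X a) (κ.X b)).symm (1 ⊗ₜ z)) = _
  rw [h, emb, emb, TensorProduct.map_comp]
  rfl

theorem emb_tmul_emb (π : Presentation ρ) (κ : Presentation σ) (a : π.ι) (b : κ.ι)
    (x : π.X a) (y : κ.X b) :
    π.emb a x ⊗ₜ κ.emb b y = tensorEmb π κ a b
      (outerRep (π.X a).ρ (κ.X b).ρ (Uq.Kp P (-κ.l b) ⊗ₜ 1) (x ⊗ₜ y)) := by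
  rw [tensorEmb_apply, UqModule.outerRep_mul_apply, Algebra.TensorProduct.tmul_mul_tmul,
    Uq.Kp_mul_neg_self, one_mul, outerRep_tmul, map_one, map_one]
  rfl

theorem braiding_emb_tensorEmb (π : Presentation ρ) (κ : Presentation σ) (μ : Presentation θ)
    (a : π.ι) (b : κ.ι) (c : μ.ι) (x : π.X a) (w : κ.X b ⊗[ℂ] μ.X c) :
    π.braiding (κ.tensor μ) (π.emb a x ⊗ₜ tensorEmb κ μ b c w) =
      TensorProduct.map (tensorEmb κ μ b c) (π.emb a) (TensorProduct.comm ℂ _ _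
        (outerRep (π.X a).ρ ((outerRep (κ.X b).ρ (μ.X c).ρ).comp (Uq.comul P))
          (Uq.shiftedR P (π.l a) (κ.l b + μ.l c)) (x ⊗ₜ w))) :=
  braiding_emb π (κ.tensor μ) a (b, c) x w

theorem braiding_tensorEmb_emb (π : Presentation ρ) (κ : Presentation σ) (μ : Presentation θ)
    (a : π.ι) (b : κ.ι) (c : μ.ι) (w : π.X a ⊗[ℂ] κ.X b) (z : μ.X c) :
    (π.tensor κ).braiding μ (tensorEmb π κ a b w ⊗ₜ μ.emb c z) =
      TensorProduct.map (μ.emb c) (tensorEmb π κ a b) (TensorProduct.comm ℂ _ _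
        (outerRep ((outerRep (π.X a).ρ (κ.X b).ρ).comp (Uq.comul P)) (μ.X c).ρ
          (Uq.shiftedR P (π.l a + κ.l b) (μ.l c)) (w ⊗ₜ z))) :=
  braiding_emb (π.tensor κ) μ (a, b) c w z

/-- `c_{U,V⊗W} = (id_V ⊗ c_{U,W}) (c_{U,V} ⊗ id_W)`. -/
theorem braiding_tensor_right (π : Presentation ρ) (κ : Presentation σ) (μ : Presentation θ) :
    π.braiding (κ.tensor μ) =
      (TensorProduct.assoc ℂ V W U).symm.toLinearMap ∘ₗ (π.braiding μ).lTensor V ∘ₗ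
        (TensorProduct.assoc ℂ V U W).toLinearMap ∘ₗ (π.braiding κ).rTensor W ∘ₗ
          (TensorProduct.assoc ℂ U V W).symm.toLinearMap := by
  refine linearMap_ext₃ π κ μ fun a b c x y z => ?_
  have hr := UqModule.lTensor_rTensor_apply (braiding_emb π κ a b) (braiding_emb π μ a c) x y z
  have e : ∀ t : π.X a ⊗[ℂ] (κ.X b ⊗[ℂ] μ.X c),
      TensorProduct.map (tensorEmb κ μ b c) (π.emb a) (TensorProduct.comm ℂ _ _ t) =
      TensorProduct.comm ℂ U (V ⊗[ℂ] W) (TensorProduct.map (π.emb a)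
        (TensorProduct.map (κ.emb b) (μ.emb c)) (UqModule.outerRep₃ (π.X a) (κ.X b) (μ.X c)
          (1 ⊗ₜ (Uq.Kp P (μ.l c) ⊗ₜ 1)) t)) := by
    intro t
    induction t with
    | zero => simp
    | add t t' ht ht' => simp only [map_add, ht, ht']
    | tmul x w =>
      rw [UqModule.outerRep₃, outerRep_tmul, map_one, TensorProduct.comm_tmul,
        TensorProduct.map_tmul, tensorEmb_apply]
      rfl
  have h : UqModule.outerRep₃ (π.X a) (κ.X b) (μ.X c)
      (1 ⊗ₜ (Uq.Kp P (-μ.l c) ⊗ₜ 1)) (x ⊗ₜ (y ⊗ₜ z)) =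
      x ⊗ₜ outerRep (κ.X b).ρ (μ.X c).ρ (Uq.Kp P (-μ.l c) ⊗ₜ 1) (y ⊗ₜ z) := by
    rw [UqModule.outerRep₃, outerRep_tmul, map_one]
    rfl
  simp only [LinearMap.comp_apply, LinearEquiv.coe_coe, TensorProduct.assoc_symm_tmul]
  rw [hr, LinearEquiv.symm_apply_apply, ← Uq.shifted_comulRight, emb_tmul_emb,
    braiding_emb_tensorEmb, ← UqModule.outerRep₃_mul_apply, ← UqModule.outerRep₃_mul_apply,
    h, ← UqModule.outerRep_tensor_right, ← e]

/-- `c_{U⊗V,W} = (c_{U,W} ⊗ id_V) (id_U ⊗ c_{V,W})`. -/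
theorem braiding_tensor_left (π : Presentation ρ) (κ : Presentation σ) (μ : Presentation θ) :
    (π.tensor κ).braiding μ =
      (TensorProduct.assoc ℂ W U V).toLinearMap ∘ₗ (π.braiding μ).rTensor V ∘ₗ
        (TensorProduct.assoc ℂ U W V).symm.toLinearMap ∘ₗ (κ.braiding μ).lTensor U ∘ₗ
          (TensorProduct.assoc ℂ U V W).toLinearMap := by
  rw [← LinearMap.cancel_right (TensorProduct.assoc ℂ U V W).symm.surjective]
  refine linearMap_ext₃ π κ μ fun a b c x y z => ?_
  have hr := UqModule.rTensor_lTensor_apply (braiding_emb κ μ b c) (braiding_emb π μ a c) x y z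
  have e : ∀ t : (π.X a ⊗[ℂ] κ.X b) ⊗[ℂ] μ.X c,
      TensorProduct.map (μ.emb c) (tensorEmb π κ a b) (TensorProduct.comm ℂ _ _ t) =
      TensorProduct.comm ℂ (U ⊗[ℂ] V) W ((TensorProduct.assoc ℂ U V W).symm
        (TensorProduct.map (π.emb a)
        (TensorProduct.map (κ.emb b) (μ.emb c)) (UqModule.outerRep₃ (π.X a) (κ.X b) (μ.X c)
          (Uq.Kp P (κ.l b) ⊗ₜ 1) (TensorProduct.assoc ℂ _ _ _ t)))) := by
    intro t
    induction t with
    | zero => simp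
    | add t t' ht ht' => simp only [map_add, ht, ht']
    | tmul w z =>
      induction w with
      | zero => simp
      | add t t' ht ht' => simp only [map_add, TensorProduct.add_tmul, ht, ht']
      | tmul x y =>
        rw [UqModule.outerRep₃, outerRep_tmul, map_one, TensorProduct.comm_tmul,
          TensorProduct.map_tmul, tensorEmb_apply, outerRep_tmul, map_one]
        rfl
  have h : UqModule.outerRep₃ (π.X a) (κ.X b) (μ.X c)
      (Uq.Kp P (-κ.l b) ⊗ₜ 1) (x ⊗ₜ (y ⊗ₜ z)) = TensorProduct.assoc ℂ _ _ _
      (outerRep (π.X a).ρ (κ.X b).ρ (Uq.Kp P (-κ.l b) ⊗ₜ 1) (x ⊗ₜ y) ⊗ₜ z) := by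
    rw [UqModule.outerRep₃, outerRep_tmul, map_one, outerRep_tmul, map_one]
    rfl
  simp only [LinearMap.comp_apply, LinearEquiv.coe_coe, TensorProduct.assoc_symm_tmul,
    TensorProduct.assoc_tmul]
  rw [hr, LinearEquiv.apply_symm_apply, ← Uq.shifted_comulLeft, emb_tmul_emb,
    braiding_tensorEmb_emb, ← UqModule.outerRep₃_mul_apply, ← UqModule.outerRep₃_mul_apply,
    h, ← UqModule.outerRep_tensor_left, ← e]

/-- Both sides act on `X a ⊗ X b ⊗ X c` by a product of three shifted `R`-matrices, followed by the
reversal of the factors. -/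
theorem braid_relation (π : Presentation ρ) (κ : Presentation σ) (μ : Presentation θ) :
    (π.braiding κ).lTensor W ∘ₗ (TensorProduct.assoc ℂ W U V).toLinearMap ∘ₗ
        (π.braiding μ).rTensor V ∘ₗ (TensorProduct.assoc ℂ U W V).symm.toLinearMap ∘ₗ
          (κ.braiding μ).lTensor U ∘ₗ (TensorProduct.assoc ℂ U V W).toLinearMap =
      (TensorProduct.assoc ℂ W V U).toLinearMap ∘ₗ (κ.braiding μ).rTensor U ∘ₗ
        (TensorProduct.assoc ℂ V W U).symm.toLinearMap ∘ₗ (π.braiding μ).lTensor V ∘ₗ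
          (TensorProduct.assoc ℂ V U W).toLinearMap ∘ₗ (π.braiding κ).rTensor W := by
  rw [← LinearMap.cancel_right (TensorProduct.assoc ℂ U V W).symm.surjective]
  refine linearMap_ext₃ π κ μ fun a b c x y z => ?_
  have hl := UqModule.rTensor_lTensor_apply (braiding_emb κ μ b c) (braiding_emb π μ a c) x y z
  have hr := UqModule.lTensor_rTensor_apply (braiding_emb π κ a b) (braiding_emb π μ a c) x y z
  simp only [LinearMap.comp_apply, LinearEquiv.coe_coe, TensorProduct.assoc_symm_tmul,
    TensorProduct.assoc_tmul]
  rw [hl, hr, LinearEquiv.apply_symm_apply, LinearEquiv.symm_apply_apply]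
  -- a braiding applied last, on a permuted product, acts by `S₁₂` or `S₂₃` before the permutation
  have h1 : ∀ (S : Uq P ⊗[ℂ] Uq P) (t : π.X a ⊗[ℂ] (κ.X b ⊗[ℂ] μ.X c)),
    (∀ x y, π.braiding κ (π.emb a x ⊗ₜ κ.emb b y) = TensorProduct.map (κ.emb b) (π.emb a)
      (UqModule.flipAct (π.X a) (κ.X b) S (x ⊗ₜ y))) →
    (π.braiding κ).lTensor W (TensorProduct.comm ℂ (U ⊗[ℂ] V) W
      ((TensorProduct.assoc ℂ U V W).symm (TensorProduct.map (π.emb a)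
        (TensorProduct.map (κ.emb b) (μ.emb c)) t))) =
    TensorProduct.assoc ℂ W V U ((TensorProduct.comm ℂ V W).rTensor U
      (TensorProduct.comm ℂ U (V ⊗[ℂ] W) (TensorProduct.map (π.emb a)
        (TensorProduct.map (κ.emb b) (μ.emb c))
          (UqModule.outerRep₃ (π.X a) (κ.X b) (μ.X c) (Uq.leg12 P S) t)))) := by
    intro S t hS
    induction t with
    | zero => simp
    | add t t' ht ht' => simp only [map_add, ht, ht']
    | tmul x t =>
      induction t with
      | zero => simp
      | add t t' ht ht' => simp only [map_add, TensorProduct.tmul_add, ht, ht']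
      | tmul y z =>
        rw [TensorProduct.map_tmul, TensorProduct.map_tmul, TensorProduct.assoc_symm_tmul,
          TensorProduct.comm_tmul, LinearMap.lTensor_tmul, hS]
        clear hS
        induction S with
        | zero => simp [UqModule.flipAct_zero]
        | add S S' hS hS' =>
          simp only [UqModule.flipAct_add, LinearMap.add_apply, map_add, TensorProduct.tmul_add,
            hS, hS']
        | tmul a b =>
          rw [Uq.leg12_tmul, UqModule.outerRep₃_tmul, map_one]
          rfl
  have h2 : ∀ (S : Uq P ⊗[ℂ] Uq P) (t : π.X a ⊗[ℂ] (κ.X b ⊗[ℂ] μ.X c)),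
    (∀ y z, κ.braiding μ (κ.emb b y ⊗ₜ μ.emb c z) = TensorProduct.map (μ.emb c) (κ.emb b)
      (UqModule.flipAct (κ.X b) (μ.X c) S (y ⊗ₜ z))) →
    (κ.braiding μ).rTensor U
      (TensorProduct.comm ℂ U (V ⊗[ℂ] W) (TensorProduct.map (π.emb a)
        (TensorProduct.map (κ.emb b) (μ.emb c)) t)) =
    (TensorProduct.comm ℂ V W).rTensor U
      (TensorProduct.comm ℂ U (V ⊗[ℂ] W) (TensorProduct.map (π.emb a)
        (TensorProduct.map (κ.emb b) (μ.emb c))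
          (UqModule.outerRep₃ (π.X a) (κ.X b) (μ.X c) (Uq.leg23 P S) t))) := by
    intro S t hS
    induction t with
    | zero => simp
    | add t t' ht ht' => simp only [map_add, ht, ht']
    | tmul x t =>
      induction t with
      | zero => simp
      | add t t' ht ht' => simp only [map_add, TensorProduct.tmul_add, ht, ht']
      | tmul y z =>
        rw [TensorProduct.map_tmul, TensorProduct.map_tmul,
          TensorProduct.comm_tmul, LinearMap.rTensor_tmul, hS]
        clear hS
        induction S with
        | zero => simp [UqModule.flipAct_zero]
        | add S S' hS hS' =>
          simp only [UqModule.flipAct_add, LinearMap.add_apply, map_add, TensorProduct.add_tmul,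
            hS, hS']
        | tmul a b =>
          rw [Uq.leg23_tmul, UqModule.outerRep₃_tmul, map_one]
          rfl
  rw [h1 _ _ (braiding_emb π κ a b), h2 _ _ (braiding_emb κ μ b c), UqModule.outerRep₃_mul_apply,
    UqModule.outerRep₃_mul_apply, ← mul_assoc, ← mul_assoc, Uq.shifted_yang_baxter]

end Presentation

/-! ### Uniserial modules over `u_q⁺` that extend to `u_q` -/

namespace Uniserial

variable (P : RootData) (r : ℕ) (c : ℂ)

/-- The operator `e_i ↦ e_{i+1}` on functions on `{0, …, r - 1}`. -/
def opE : Module.End ℂ (Fin r → ℂ) where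
  toFun v j := if h : 0 < j.val then v ⟨j.val - 1, by omega⟩ else 0
  map_add' v w := by
    funext j
    simp only [Pi.add_apply]
    split_ifs <;> ring
  map_smul' s v := by
    funext j
    simp only [Pi.smul_apply, smul_eq_mul, RingHom.id_apply]
    split_ifs <;> ring

/-- The operator `e_i ↦ mu i • e_{i-1}` on functions on `{0, …, r - 1}`. The coefficients are those
of the Verma module of highest weight `c⁻¹`, as exchanging `E` and `F` inverts the weights. -/
def opF : Module.End ℂ (Fin r → ℂ) where
  toFun v j := if h : j.val + 1 < r then Verma.mu P c⁻¹ (j + 1) * v ⟨j.val + 1, h⟩ else 0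
  map_add' v w := by
    funext j
    simp only [Pi.add_apply]
    split_ifs <;> ring
  map_smul' s v := by
    funext j
    simp only [Pi.smul_apply, smul_eq_mul, RingHom.id_apply]
    split_ifs <;> ring

/-- The diagonal operator with eigenvalues `c q ^ (2 i)`. -/
def opK : Module.End ℂ (Fin r → ℂ) where
  toFun v j := c * (P.q ^ 2) ^ j.val * v j
  map_add' v w := by
    funext j
    simp only [Pi.add_apply]
    ring
  map_smul' s v := by
    funext j
    simp only [Pi.smul_apply, smul_eq_mul, RingHom.id_apply]
    ring

theorem opE_apply (v : Fin r → ℂ) (j : Fin r) :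
    opE r v j = if h : 0 < j.val then v ⟨j.val - 1, by omega⟩ else 0 := rfl

theorem opF_apply (v : Fin r → ℂ) (j : Fin r) : opF P r c v j =
    if h : j.val + 1 < r then Verma.mu P c⁻¹ (j + 1) * v ⟨j.val + 1, h⟩ else 0 := rfl

theorem opK_apply (v : Fin r → ℂ) (j : Fin r) :
    opK P r c v j = c * (P.q ^ 2) ^ j.val * v j := rfl

theorem opE_pow_apply (m : ℕ) (v : Fin r → ℂ) (j : Fin r) (h : j.val < m) :
    (opE r ^ m) v j = 0 := by
  induction m generalizing j with
  | zero => omega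
  | succ m ih =>
    rw [pow_succ', Module.End.mul_apply, opE_apply]
    split_ifs with hj
    · exact ih _ (by simp only; omega)
    · rfl

theorem opF_pow_apply (m : ℕ) (v : Fin r → ℂ) (j : Fin r) (h : r ≤ j.val + m) :
    (opF P r c ^ m) v j = 0 := by
  induction m generalizing j with
  | zero => omega
  | succ m ih =>
    rw [pow_succ', Module.End.mul_apply, opF_apply]
    split_ifs with hj
    · rw [ih _ (by simp only; omega), mul_zero]
    · rfl

theorem opK_pow_apply (m : ℕ) (v : Fin r → ℂ) (j : Fin r) :
    (opK P r c ^ m) v j = (c * (P.q ^ 2) ^ j.val) ^ m * v j := by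
  induction m with
  | zero => simp
  | succ m ih =>
    rw [pow_succ', Module.End.mul_apply, opK_apply, ih]
    ring

/-- The condition on the lowest weight `c` under which `F` extends the action of `u_q⁺` on a
uniserial module of length `m + 1`. -/
theorem mu_eq_zero {m : ℕ} (h : c ^ 2 * (P.q ^ 2) ^ m = 1) : Verma.mu P c⁻¹ (m + 1) = 0 := by
  have hc : c ≠ 0 := by
    rintro rfl
    simp at h
  have hq : P.q ^ 2 ≠ 0 := pow_ne_zero 2 P.q_ne_zero
  rw [Verma.mu, Finset.sum_sub_distrib]
  refine mul_eq_zero_of_right _ (sub_eq_zero.mpr ?_)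
  rw [← Finset.sum_range_reflect]
  refine Finset.sum_congr rfl fun j hj => ?_
  have hj' : j ≤ m := Nat.lt_succ_iff.mp (Finset.mem_range.mp hj)
  obtain ⟨i, rfl⟩ := Nat.exists_eq_add_of_le hj'
  rw [show j + i + 1 - 1 - j = i by omega, inv_inv, inv_pow, ← mul_inv, inv_eq_iff_eq_inv]
  rw [pow_add] at h
  refine eq_inv_of_mul_eq_one_left ?_
  linear_combination h

theorem exists_rep {m : ℕ} (hm : m < P.d) (hc : c ^ P.d = 1) (h : c ^ 2 * (P.q ^ 2) ^ m = 1) :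
    ∃ φ : Uq P →ₐ[ℂ] Module.End ℂ (Fin (m + 1) → ℂ),
      φ (Uq.E P) = opE (m + 1) ∧ φ (Uq.K P) = opK P (m + 1) c := by
  have hq : P.q ^ 2 ≠ 0 := pow_ne_zero 2 P.q_ne_zero
  have hpow : ∀ j : ℕ, (c * (P.q ^ 2) ^ j) ^ P.d = 1 := fun j => by
    rw [mul_pow, hc, one_mul, ← pow_mul, mul_comm j, pow_mul, P.prim_sq.pow_eq_one, one_pow]
  have hpred : ∀ j : ℕ, (c * (P.q ^ 2) ^ j) ^ (P.d - 1) = (c * (P.q ^ 2) ^ j)⁻¹ := fun j => by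
    refine eq_inv_of_mul_eq_one_left ?_
    rw [← pow_succ, Nat.sub_add_cancel P.d_pos, hpow]
  obtain ⟨φ, hE, -, hK⟩ := Uq.exists_lift P (opE (m + 1)) (opF P (m + 1) c) (opK P (m + 1) c)
    (by
      refine LinearMap.ext fun v => funext fun j => ?_
      exact opE_pow_apply _ _ v j (by omega))
    (by
      refine LinearMap.ext fun v => funext fun j => ?_
      exact opF_pow_apply P _ c _ v j (by omega))
    (by
      refine LinearMap.ext fun v => funext fun j => ?_
      rw [opK_pow_apply, hpow]
      simp)
    (by
      refine LinearMap.ext fun v => funext fun j => ?_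
      simp only [Module.End.mul_apply, LinearMap.smul_apply, Pi.smul_apply, smul_eq_mul, opK_apply,
        opE_apply]
      split_ifs with hj
      · obtain ⟨i, hi⟩ : ∃ i, j.val = i + 1 := ⟨j.val - 1, by omega⟩
        simp only [hi, Nat.add_sub_cancel]
        ring
      · simp)
    (by
      refine LinearMap.ext fun v => funext fun j => ?_
      simp only [Module.End.mul_apply, LinearMap.smul_apply, Pi.smul_apply, smul_eq_mul, opK_apply,
        opF_apply]
      split_ifs with hj
      · rw [pow_succ]
        linear_combination (-(c * (P.q ^ 2) ^ j.val * Verma.mu P c⁻¹ (j.val + 1) *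
          v ⟨j.val + 1, hj⟩)) * mul_inv_cancel₀ hq
      · simp)
    (by
      refine LinearMap.ext fun v => funext fun j => ?_
      simp only [Module.End.mul_apply, LinearMap.smul_apply, LinearMap.sub_apply, Pi.sub_apply,
        Pi.smul_apply, smul_eq_mul, opK_apply, opK_pow_apply, hpred, opE_apply, opF_apply]
      have e1 : (if h : 0 < j.val then (if h' : j.val - 1 + 1 < m + 1 then
          Verma.mu P c⁻¹ (j.val - 1 + 1) * v ⟨j.val - 1 + 1, h'⟩ else 0) else 0) =
          Verma.mu P c⁻¹ j * v j := by
        split_ifs with h1 h2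
        · simp only [Nat.sub_add_cancel h1]
        · omega
        · rw [show j.val = 0 by omega]
          simp [Verma.mu]
      have e2 : (if h : j.val + 1 < m + 1 then Verma.mu P c⁻¹ (j.val + 1) *
          (if h' : 0 < j.val + 1 then v ⟨j.val + 1 - 1, by omega⟩ else 0) else 0) =
          Verma.mu P c⁻¹ (j.val + 1) * v j := by
        split_ifs with h1 h2
        · simp only [Nat.add_sub_cancel]
        · omega
        · rw [show j.val + 1 = m + 1 by omega, mu_eq_zero P c h, zero_mul]
      rw [e1, e2, Verma.mu, Verma.mu, Finset.sum_range_succ, inv_inv, mul_inv, inv_pow]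
      ring)
  exact ⟨φ, hE, hK⟩

end Uniserial

/-- For every length at most `d` and every admissible lowest weight `c` there is a `u_q`-module
with a basis on which `E` acts as a single nilpotent Jordan block. -/
theorem UqModule.exists_uniserial (P : RootData) {m : ℕ} (hm : m < P.d) {c : ℂ}
    (hc : c ^ P.d = 1) (h : c ^ 2 * (P.q ^ 2) ^ m = 1) :
    ∃ (X : UqModule.{u} P) (e : X ≃ₗ[ℂ] (Fin (m + 1) → ℂ)),
      (∀ x j, e (X.ρ (Uq.E P) x) j =
        if h : 0 < j.val then e x ⟨j.val - 1, by omega⟩ else 0) ∧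
      ∀ x j, e (X.ρ (Uq.K P) x) j = c * (P.q ^ 2) ^ j.val * e x j := by
  obtain ⟨φ, hE, hK⟩ := Uniserial.exists_rep P c hm hc h
  let e : ULift.{u} (Fin (m + 1) → ℂ) ≃ₗ[ℂ] (Fin (m + 1) → ℂ) := ULift.moduleEquiv
  refine ⟨⟨ULift.{u} (Fin (m + 1) → ℂ), e.symm.conjAlgEquiv ℂ |>.toAlgHom.comp φ⟩, e, ?_, ?_⟩
  · intro x j
    change φ (Uq.E P) (e x) j = _
    rw [hE]
    rfl
  · intro x j
    change φ (Uq.K P) (e x) j = _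
    rw [hK]
    rfl

/-! ### Weight vectors in modules over `u_q⁺` -/

namespace UqPlus

variable (P : RootData)

theorem Kp_mem (a : ZMod P.d) : Uq.Kp P a ∈ uqPlus P :=
  pow_mem (Algebra.subset_adjoin (by simp)) _

theorem idem_mem (b : ZMod P.d) : Uq.idem P b ∈ uqPlus P :=
  Subalgebra.smul_mem _ (sum_mem fun j _ => Subalgebra.smul_mem _ (Kp_mem P j) _) _

/-- The idempotent of `u_q⁺` projecting onto the eigenspace of `K` for `q ^ (2 b)`. -/
def idem (b : ZMod P.d) : uqPlus P := ⟨Uq.idem P b, idem_mem P b⟩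

theorem E_pow : E P ^ P.d = 0 := Subtype.ext (Uq.E_pow P)

theorem E_mul_idem (b : ZMod P.d) : E P * idem P b = idem P (b + 1) * E P :=
  Subtype.ext (Uq.E_mul_idem P b)

theorem E_pow_mul_idem (b : ZMod P.d) (k : ℕ) :
    E P ^ k * idem P b = idem P (b + k) * E P ^ k := by
  induction k with
  | zero => simp
  | succ k ih =>
    rw [pow_succ', mul_assoc, ih, ← mul_assoc, E_mul_idem, mul_assoc, add_assoc, Nat.cast_succ]

theorem K_mul_idem (b : ZMod P.d) : K P * idem P b = Uq.zeta P b • idem P b := by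
  apply Subtype.ext
  have h := Uq.Kp_mul_idem P 1 b
  rwa [Uq.Kp_one, one_mul] at h

theorem idem_mul_K (b : ZMod P.d) : idem P b * K P = Uq.zeta P b • idem P b := by
  apply Subtype.ext
  have h := Uq.idem_mul_Kp P 1 b
  rwa [Uq.Kp_one, one_mul] at h

theorem sum_idem : ∑ b, idem P b = 1 := by
  apply Subtype.ext
  rw [AddSubmonoidClass.coe_finsetSum]
  exact Uq.sum_idem P

theorem idem_mul_idem (a b : ZMod P.d) :
    idem P a * idem P b = if a = b then idem P b else 0 := by
  apply Subtype.ext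
  have h := Uq.idem_mul_idem P a b
  split_ifs with hab
  · rwa [if_pos hab] at h
  · rwa [if_neg hab] at h

end UqPlus

/-! ### Decomposition of finite-dimensional modules -/

section Decomposition

variable {P : RootData} {U : Type u} [AddCommGroup U] [Module ℂ U]

/-- This is where `d` odd matters: weights can be halved. -/
theorem exists_half (hd : Odd P.d) : ∃ t : ZMod P.d, t + t = 1 := by
  obtain ⟨k, hk⟩ := hd
  refine ⟨((k + 1 : ℕ) : ZMod P.d), ?_⟩
  rw [← Nat.cast_add, show k + 1 + (k + 1) = P.d + 1 by omega, Nat.cast_add, ZMod.natCast_self,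
    zero_add, Nat.cast_one]

/-- If `E ^ m ≠ 0` and `E ^ (m + 1) = 0` on `U`, then `U` has a direct summand `S_l ⊗ X` with `X`
uniserial of length `m + 1`: it is spanned by the `E ^ i v` for a weight vector `v` that is not
killed by `E ^ m`. The projection is given by a functional on the weight space of `E ^ m v`. -/
theorem exists_summand (hd : Odd P.d) (ρ : uqPlus P →ₐ[ℂ] Module.End ℂ U) {m : ℕ}
    (h0 : ρ (UqPlus.E P ^ m) ≠ 0) (h1 : ρ (UqPlus.E P ^ (m + 1)) = 0) :
    ∃ (l : ZMod P.d) (X : UqModule.{u} P) (inc : (ℂ ⊗[ℂ] X) →ₗ[ℂ] U)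
      (proj : U →ₗ[ℂ] (ℂ ⊗[ℂ] X)), IsIntertwining (X.shift l) ρ inc ∧
      IsIntertwining ρ (X.shift l) proj ∧ proj ∘ₗ inc = LinearMap.id ∧ proj ≠ 0 := by
  have hm : m < P.d := by
    by_contra hm
    apply h0
    rw [pow_eq_zero_of_le (not_lt.mp hm) (UqPlus.E_pow P), map_zero]
  obtain ⟨b, v, hv⟩ : ∃ b v, ρ (UqPlus.E P ^ m) (ρ (UqPlus.idem P b) v) ≠ 0 := by
    by_contra! h
    apply h0
    ext v
    have e : ∑ b, ρ (UqPlus.E P ^ m) (ρ (UqPlus.idem P b) v) = ρ (UqPlus.E P ^ m) v := by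
      rw [← map_sum, ← LinearMap.sum_apply, ← map_sum, UqPlus.sum_idem, map_one]
      rfl
    rw [← e, Finset.sum_eq_zero fun b _ => h b v]
    rfl
  obtain ⟨ψ, hψ⟩ := Module.Projective.exists_dual_eq_one ℂ hv
  obtain ⟨t, ht⟩ := exists_half hd
  -- half of `-m`: the weight of the lowest vector of the `u_q`-module `X` of dimension `m + 1`
  let l₀ : ZMod P.d := -(m * t)
  have hc : Uq.zeta P l₀ ^ P.d = 1 := by
    rw [Uq.zeta_apply]
    exact UqPlus.sq_pow_val_pow P l₀
  have hc' : Uq.zeta P l₀ ^ 2 * (P.q ^ 2) ^ m = 1 := by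
    rw [← Uq.zeta_natCast, pow_two, ← AddChar.map_add_eq_mul, ← AddChar.map_add_eq_mul]
    have : l₀ + l₀ + m = 0 := by
      linear_combination (-(m : ZMod P.d)) * ht
    rw [this, AddChar.map_zero_eq_one]
  obtain ⟨X, e, hXE, hXK⟩ := UqModule.exists_uniserial.{u} P hm hc hc'
  -- a matrix coefficient of `E ^ (m - i)` reads off the coordinate of `E ^ i v`
  let emb : X →ₗ[ℂ] U :=
    ∑ i : Fin (m + 1), (LinearMap.toSpanSingleton ℂ U (ρ (UqPlus.E P ^ i.val * UqPlus.idem P b) v))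
      ∘ₗ LinearMap.proj i ∘ₗ e.toLinearMap
  let coef : U →ₗ[ℂ] (Fin (m + 1) → ℂ) :=
    LinearMap.pi fun i => ψ ∘ₗ ρ (UqPlus.E P ^ (m - i.val) * UqPlus.idem P (b + i.val))
  have hemb : ∀ x, emb x = ∑ i : Fin (m + 1),
      e x i • ρ (UqPlus.E P ^ i.val * UqPlus.idem P b) v := by
    intro x
    simp [emb]
  have hcoef : ∀ u i, coef u i =
      ψ (ρ (UqPlus.E P ^ (m - i.val) * UqPlus.idem P (b + i.val)) u) := fun u i => rfl
  have hcoefE : ∀ u i, coef (ρ (UqPlus.E P) u) i =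
      if h : 0 < i.val then coef u ⟨i.val - 1, by omega⟩ else 0 := by
    intro u i
    have e1 : UqPlus.E P ^ (m - i.val) * UqPlus.idem P (b + i.val) * UqPlus.E P =
        UqPlus.E P ^ (m - i.val + 1) * UqPlus.idem P (b + i.val - 1) := by
      rw [pow_succ, mul_assoc, mul_assoc, UqPlus.E_mul_idem, sub_add_cancel]
    rw [hcoef, ← Module.End.mul_apply, ← map_mul, e1]
    split_ifs with hi
    · rw [hcoef]
      simp only
      rw [Nat.cast_sub hi, Nat.cast_one, ← add_sub_assoc, show m - i.val + 1 = m - (i.val - 1) by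
        omega]
    · rw [show m - i.val + 1 = m + 1 by omega, map_mul, h1, zero_mul]
      simp
  have hcoefK : ∀ u i, coef (ρ (UqPlus.K P) u) i = Uq.zeta P (b + i.val) * coef u i := by
    intro u i
    rw [hcoef, ← Module.End.mul_apply, ← map_mul, mul_assoc, UqPlus.idem_mul_K, mul_smul_comm,
      map_smul, LinearMap.smul_apply, map_smul, smul_eq_mul, hcoef]
  have hcoefemb : ∀ x, coef (emb x) = e x := by
    intro x
    funext i
    rw [hemb, map_sum, Finset.sum_apply, Finset.sum_eq_single i]
    · rw [map_smul, Pi.smul_apply, hcoef, ← Module.End.mul_apply, ← map_mul,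
        UqPlus.E_pow_mul_idem P b,
        mul_assoc, ← mul_assoc (UqPlus.idem P _), UqPlus.idem_mul_idem, if_pos rfl,
        ← UqPlus.E_pow_mul_idem P b, ← mul_assoc, ← pow_add, Nat.sub_add_cancel (by omega), map_mul,
        Module.End.mul_apply, hψ, smul_eq_mul, mul_one]
    · intro j _ hj
      have hne : b + (i.val : ZMod P.d) ≠ b + (j.val : ZMod P.d) := by
        intro h
        apply hj
        have h2 := (ZMod.natCast_eq_natCast_iff' _ _ _).mp (add_left_cancel h)
        rw [Nat.mod_eq_of_lt (by omega), Nat.mod_eq_of_lt (by omega)] at h2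
        exact Fin.ext h2.symm
      rw [map_smul, Pi.smul_apply, hcoef, ← Module.End.mul_apply, ← map_mul,
        UqPlus.E_pow_mul_idem P b,
        mul_assoc, ← mul_assoc (UqPlus.idem P _), UqPlus.idem_mul_idem, if_neg hne, zero_mul,
        mul_zero, map_zero]
      simp
    · simp
  have hembE : ∀ x, emb (X.ρ (Uq.E P) x) = ρ (UqPlus.E P) (emb x) := by
    intro x
    rw [hemb, hemb, map_sum, Fin.sum_univ_succ, Fin.sum_univ_castSucc]
    have hlast : ρ (UqPlus.E P) (e x (Fin.last m) •
        ρ (UqPlus.E P ^ (Fin.last m).val * UqPlus.idem P b) v) = 0 := by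
      rw [map_smul, ← Module.End.mul_apply, ← map_mul, ← mul_assoc, ← pow_succ', Fin.val_last,
        map_mul, h1, zero_mul]
      simp
    rw [hlast, add_zero, hXE, dif_neg (by simp), zero_smul, zero_add]
    refine Finset.sum_congr rfl fun i _ => ?_
    rw [hXE, dif_pos (by simp), map_smul, ← Module.End.mul_apply, ← map_mul, ← mul_assoc,
      ← pow_succ']
    rfl
  have hl : ∀ i : ℕ, Uq.zeta P (b - l₀) * (Uq.zeta P l₀ * (P.q ^ 2) ^ i) = Uq.zeta P (b + i) := by
    intro i
    rw [← Uq.zeta_natCast, ← AddChar.map_add_eq_mul, ← AddChar.map_add_eq_mul]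
    congr 1
    ring
  have hembK : ∀ x, Uq.zeta P (b - l₀) • emb (X.ρ (Uq.K P) x) = ρ (UqPlus.K P) (emb x) := by
    intro x
    rw [hemb, hemb, map_sum, Finset.smul_sum]
    refine Finset.sum_congr rfl fun i _ => ?_
    rw [hXK, smul_smul, ← mul_assoc, hl, map_smul, ← Module.End.mul_apply, ← map_mul,
      UqPlus.E_pow_mul_idem, ← mul_assoc, UqPlus.K_mul_idem, smul_mul_assoc, map_smul,
      LinearMap.smul_apply, smul_smul, mul_comm]
  have hchar : UqPlus.character P (b - l₀) (UqPlus.K P) = Uq.zeta P (b - l₀) := by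
    rw [UqPlus.character_K, Uq.zeta_apply]
  have hshiftE : ∀ z, TensorProduct.lid ℂ X (X.shift (b - l₀) (UqPlus.E P) z) =
      X.ρ (Uq.E P) (TensorProduct.lid ℂ X z) := by
    intro z
    induction z with
    | zero => simp
    | add z w hz hw => simp only [map_add, hz, hw]
    | tmul s x => rw [UqModule.shift_E, TensorProduct.lid_tmul, TensorProduct.lid_tmul, map_smul]
  have hshiftK : ∀ z, TensorProduct.lid ℂ X (X.shift (b - l₀) (UqPlus.K P) z) =
      Uq.zeta P (b - l₀) • X.ρ (Uq.K P) (TensorProduct.lid ℂ X z) := by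
    intro z
    induction z with
    | zero => simp
    | add z w hz hw => simp only [map_add, smul_add, hz, hw]
    | tmul s x =>
      rw [UqModule.shift_K, map_smul, TensorProduct.lid_tmul, TensorProduct.lid_tmul, map_smul,
        hchar]
  refine ⟨b - l₀, X, emb ∘ₗ (TensorProduct.lid ℂ X).toLinearMap,
    (TensorProduct.lid ℂ X).symm.toLinearMap ∘ₗ e.symm.toLinearMap ∘ₗ coef,
    isIntertwining_of_generators ?_ ?_, isIntertwining_of_generators ?_ ?_, ?_, ?_⟩
  · intro z
    exact (congrArg emb (hshiftE z)).trans (hembE _)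
  · intro z
    refine (congrArg emb (hshiftK z)).trans ?_
    rw [map_smul, hembK]
    rfl
  · intro u
    apply (TensorProduct.lid ℂ X).injective
    apply e.injective
    rw [hshiftE]
    simp only [LinearMap.comp_apply, LinearEquiv.coe_coe, LinearEquiv.apply_symm_apply]
    funext i
    rw [hXE, hcoefE, LinearEquiv.apply_symm_apply]
  · intro u
    apply (TensorProduct.lid ℂ X).injective
    apply e.injective
    rw [hshiftK]
    simp only [LinearMap.comp_apply, LinearEquiv.coe_coe, LinearEquiv.apply_symm_apply]
    funext i
    rw [map_smul, Pi.smul_apply, hXK, hcoefK, LinearEquiv.apply_symm_apply, smul_eq_mul,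
      ← mul_assoc, hl]
  · refine LinearMap.ext fun z => ?_
    simp only [LinearMap.comp_apply, LinearEquiv.coe_coe, hcoefemb, LinearEquiv.symm_apply_apply,
      LinearMap.id_apply]
  · intro h
    have h2 : coef = 0 := by
      ext1 u
      have h3 := LinearMap.congr_fun h u
      simpa using h3
    have h3 := hcoefemb (e.symm 1)
    rw [h2, LinearEquiv.apply_symm_apply] at h3
    have h4 := congrFun h3 0
    simp at h4

/-- The restriction of a representation to an invariant subspace. -/
theorem exists_subrep (ρ : uqPlus P →ₐ[ℂ] Module.End ℂ U) (C : Submodule ℂ U)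
    (hC : ∀ a, ∀ x ∈ C, ρ a x ∈ C) :
    ∃ σ : uqPlus P →ₐ[ℂ] Module.End ℂ C, ∀ a x, (σ a x : U) = ρ a x := by
  refine ⟨AlgHom.ofLinearMap
    { toFun := fun a => (ρ a).restrict (hC a)
      map_add' := fun a b => by
        ext x
        simp
      map_smul' := fun s a => by
        ext x
        simp } ?_ ?_, fun a x => rfl⟩
  · ext x
    simp
  · intro a b
    ext x
    simp

/-- A summand together with a decomposition of its complement gives a decomposition. -/
theorem Presentation.nonempty_of_ker (ρ : uqPlus P →ₐ[ℂ] Module.End ℂ U) (l : ZMod P.d)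
    (X : UqModule.{u} P) (inc : (ℂ ⊗[ℂ] X) →ₗ[ℂ] U) (proj : U →ₗ[ℂ] (ℂ ⊗[ℂ] X))
    (hinc : IsIntertwining (X.shift l) ρ inc) (hid : proj ∘ₗ inc = LinearMap.id)
    (σ : uqPlus P →ₐ[ℂ] Module.End ℂ (LinearMap.ker proj))
    (hσ : ∀ a x, (σ a x : U) = ρ a x) (π : Presentation σ) : Nonempty (Presentation ρ) := by
  have hpi : ∀ x, proj (inc x) = x := LinearMap.congr_fun hid
  let compl : U →ₗ[ℂ] LinearMap.ker proj :=
    (LinearMap.id - inc ∘ₗ proj).codRestrict _ fun x => by simp [hpi]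
  have hcompl : ∀ x, (compl x : U) = x - inc (proj x) := fun x => rfl
  have hcs : ∀ x : LinearMap.ker proj, compl x = x := by
    intro x
    apply Subtype.ext
    rw [hcompl, LinearMap.mem_ker.mp x.2, map_zero, sub_zero]
  have hci : ∀ x, compl (inc x) = 0 := by
    intro x
    apply Subtype.ext
    rw [hcompl, hpi, sub_self]
    rfl
  refine ⟨{
    ι := Option π.ι
    l := fun a => a.elim l π.l
    X := fun a => a.elim X π.X
    inc := fun a => match a with
      | none => inc
      | some a => (LinearMap.ker proj).subtype ∘ₗ π.inc a
    proj := fun a => match a with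
      | none => proj
      | some a => π.proj a ∘ₗ compl
    inc_isIntertwining := ?_
    proj_inc_self := ?_
    proj_inc_ne := ?_
    sum_inc_proj := ?_ }⟩
  · rintro (_ | a)
    · exact hinc
    · intro r x
      exact (congrArg Subtype.val (π.inc_isIntertwining a r x)).trans (hσ _ _)
  · rintro (_ | a)
    · exact hid
    · refine LinearMap.ext fun x => ?_
      exact (congrArg (π.proj a) (hcs _)).trans (LinearMap.congr_fun (π.proj_inc_self a) x)
  · rintro (_ | a) (_ | b) hab
    · exact absurd rfl hab
    · refine LinearMap.ext fun x => ?_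
      exact (congrArg (π.proj b) (hci _)).trans (map_zero _)
    · refine LinearMap.ext fun x => ?_
      exact LinearMap.mem_ker.mp (π.inc a x).2
    · refine LinearMap.ext fun x => ?_
      refine (congrArg (π.proj b) (hcs _)).trans ?_
      exact LinearMap.congr_fun (π.proj_inc_ne a b fun h => hab (congrArg some h)) x
  · rw [Fintype.sum_option]
    refine LinearMap.ext fun x => ?_
    have h := congrArg Subtype.val (π.sum_inc_proj_apply (compl x))
    rw [hcompl, AddSubmonoidClass.coe_finsetSum] at h
    refine Eq.trans (b := inc (proj x) +
      ∑ a, ((π.inc a (π.proj a (compl x)) : LinearMap.ker proj) : U)) ?_ ?_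
    · rw [LinearMap.add_apply, LinearMap.sum_apply]
      rfl
    · rw [h, add_sub_cancel]
      rfl

/-- Induction on the dimension: split off a uniserial summand of the maximal length. -/
theorem nonempty_presentation_of_finrank (hd : Odd P.d) (n : ℕ) :
    ∀ (U : Type u) [AddCommGroup U] [Module ℂ U] (ρ : uqPlus P →ₐ[ℂ] Module.End ℂ U),
      FiniteDimensional ℂ U → Module.finrank ℂ U = n → Nonempty (Presentation ρ) := by
  induction n using Nat.strong_induction_on with
  | _ n ih =>
    intro U _ _ ρ hU hn
    rcases subsingleton_or_nontrivial U with hs | hs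
    · exact ⟨{
        ι := PEmpty
        l := fun a => a.elim
        X := fun a => a.elim
        inc := fun a => a.elim
        proj := fun a => a.elim
        inc_isIntertwining := fun a => a.elim
        proj_inc_self := fun a => a.elim
        proj_inc_ne := fun a => a.elim
        sum_inc_proj := Subsingleton.elim _ _ }⟩
    · have hex : ∃ k, ρ (UqPlus.E P ^ k) = 0 := ⟨P.d, by rw [UqPlus.E_pow, map_zero]⟩
      classical
      obtain ⟨m, hm⟩ : ∃ m, Nat.find hex = m + 1 := by
        refine Nat.exists_eq_succ_of_ne_zero fun h => ?_
        have h' := Nat.find_spec hex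
        rw [h, pow_zero, map_one] at h'
        exact one_ne_zero h'
      have h1 := Nat.find_spec hex
      rw [hm] at h1
      have h0 : ρ (UqPlus.E P ^ m) ≠ 0 := Nat.find_min hex (by omega)
      obtain ⟨l, X, inc, proj, hinc, hproj, hid, hne⟩ := exists_summand hd ρ h0 h1
      obtain ⟨σ, hσ⟩ := exists_subrep ρ (LinearMap.ker proj) fun a x hx => by
        rw [LinearMap.mem_ker] at hx ⊢
        rw [hproj, hx, map_zero]
      have hlt : Module.finrank ℂ (LinearMap.ker proj) < n := by
        rw [← hn]
        exact Submodule.finrank_lt fun h => hne (LinearMap.ker_eq_top.mp h)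
      obtain ⟨π⟩ := ih _ hlt (LinearMap.ker proj) σ inferInstance rfl
      exact Presentation.nonempty_of_ker ρ l X inc proj hinc hid σ hσ π

end Decomposition

/-! ### Failure of naturality -/

namespace Uq

theorem zeta_injective (P : RootData) : Function.Injective (zeta P) := by
  intro a b h
  rw [zeta_apply, zeta_apply] at h
  exact ZMod.val_injective _ (P.prim_sq.pow_inj (ZMod.val_lt a) (ZMod.val_lt b) h)

end Uq

namespace UqModule

variable {P : RootData}

theorem rho_pow_apply (X : UqModule.{u} P) {a : Uq P} {c : ℂ} {x : X} (h : X.ρ a x = c • x)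
    (k : ℕ) : X.ρ (a ^ k) x = c ^ k • x := by
  induction k with
  | zero => simp
  | succ k ih => rw [pow_succ, map_mul, Module.End.mul_apply, h, map_smul, ih, smul_smul, pow_succ']

theorem weight_pow_d (X : UqModule.{u} P) {c : ℂ} {x : X} (hx : x ≠ 0)
    (h : X.ρ (Uq.K P) x = c • x) : c ^ P.d = 1 := by
  have h1 := X.rho_pow_apply h P.d
  rw [Uq.K_pow, map_one, Module.End.one_apply] at h1
  exact (smul_left_injective ℂ hx ((one_smul ℂ x).trans h1)).symm

/-- If the commutator of `E` and `F` vanishes on a vector of weight `c`, then `c = c⁻¹`. -/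
theorem weight_sq_eq_one {c : ℂ} (hc : c ^ P.d = 1)
    (h : (P.q - P.q⁻¹)⁻¹ * (c - c ^ (P.d - 1)) = 0) : c ^ 2 = 1 := by
  have h1 := sub_eq_zero.mp
    ((mul_eq_zero.mp h).resolve_left (inv_ne_zero (Uq.q_sub_inv_ne_zero P)))
  calc c ^ 2 = c ^ (P.d - 1) * c := by rw [← h1, pow_two]
    _ = 1 := by rw [← pow_succ, Nat.sub_add_cancel P.d_pos, hc]

theorem commutator_apply (X : UqModule.{u} P) {c : ℂ} {x : X} (h : X.ρ (Uq.K P) x = c • x) :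
    X.ρ (Uq.E P) (X.ρ (Uq.F P) x) - X.ρ (Uq.F P) (X.ρ (Uq.E P) x) =
      ((P.q - P.q⁻¹)⁻¹ * (c - c ^ (P.d - 1))) • x := by
  rw [← Module.End.mul_apply, ← map_mul, ← Module.End.mul_apply, ← map_mul,
    ← LinearMap.sub_apply, ← map_sub, Uq.E_mul_F, map_smul, map_sub, LinearMap.smul_apply,
    LinearMap.sub_apply, h, X.rho_pow_apply h, ← sub_smul, smul_smul]

/-- If `d` is odd, then the only one-dimensional `u_q`-module is the trivial one. -/
theorem trivial_of_span (hd : Odd P.d) (X : UqModule.{u} P) {x : X} (hx : x ≠ 0)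
    (hspan : ∀ y : X, ∃ s : ℂ, y = s • x) : X.ρ (Uq.K P) x = x ∧ X.ρ (Uq.F P) x = 0 := by
  obtain ⟨a, ha⟩ := hspan (X.ρ (Uq.E P) x)
  obtain ⟨b, hb⟩ := hspan (X.ρ (Uq.F P) x)
  obtain ⟨c, hc⟩ := hspan (X.ρ (Uq.K P) x)
  have hcd := X.weight_pow_d hx hc
  have h := X.commutator_apply hc
  rw [ha, hb, map_smul, map_smul, ha, hb, smul_comm, sub_self] at h
  have hc2 := weight_sq_eq_one hcd ((smul_eq_zero.mp h.symm).resolve_right hx)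
  have hc1 : c = 1 := by
    obtain ⟨k, hk⟩ := hd
    rw [hk, pow_succ, pow_mul, hc2, one_pow, one_mul] at hcd
    exact hcd
  have hF := X.rho_pow_apply hb P.d
  rw [Uq.F_pow, map_zero, LinearMap.zero_apply] at hF
  have hb0 : b = 0 := pow_eq_zero_iff P.d_pos.ne' |>.mp ((smul_eq_zero.mp hF.symm).resolve_right hx)
  exact ⟨by rw [hc, hc1, one_smul], by rw [hb, hb0, zero_smul]⟩

/-- If `y` spans a trivial module, then `R` fixes `x ⊗ y`, and only the shift is left of the
braiding. -/
theorem flipAct_shiftedR_of_trivial (X Y : UqModule.{u} P) (l m : ZMod P.d) (x : X) {y : Y}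
    (hK : Y.ρ (Uq.K P) y = y) (hF : Y.ρ (Uq.F P) y = 0) :
    flipAct X Y (Uq.shiftedR P l m) (x ⊗ₜ y) = y ⊗ₜ X.ρ (Uq.Kp P (-m)) x := by
  have hKp : ∀ a, Y.ρ (Uq.Kp P a) y = y := by
    intro a
    have h := Y.rho_pow_apply (c := 1) (hK.trans (one_smul ℂ y).symm) a.val
    rwa [one_pow, one_smul] at h
  have hexp : ∀ x : X, outerRep X.ρ Y.ρ (Uq.qexp P (Uq.E P ⊗ₜ Uq.F P)) (x ⊗ₜ y) = x ⊗ₜ y := by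
    intro x
    rw [Uq.qexp, map_sum, LinearMap.sum_apply, Finset.sum_eq_single 0]
    · rw [Uq.expCoeff_zero, one_smul, pow_zero, map_one]
      rfl
    · intro k _ hk
      rw [Algebra.TensorProduct.tmul_pow, map_smul, LinearMap.smul_apply, outerRep_tmul,
        TensorProduct.map_tmul, Y.rho_pow_apply (c := 0) (by rw [hF, zero_smul]),
        zero_pow hk, zero_smul, TensorProduct.tmul_zero, smul_zero]
    · intro h
      exact absurd (Finset.mem_range.mpr P.d_pos) h
  have hcartan : ∀ x : X, outerRep X.ρ Y.ρ (Uq.cartan P) (x ⊗ₜ y) = x ⊗ₜ y := by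
    intro x
    simp only [Uq.cartan_eq, map_sum, LinearMap.sum_apply, outerRep_tmul, TensorProduct.map_tmul,
      hKp]
    rw [← TensorProduct.sum_tmul, ← LinearMap.sum_apply, ← map_sum, Uq.sum_idem, map_one]
    rfl
  rw [flipAct, Uq.shiftedR, Uq.R_eq, LinearMap.comp_apply, ← outerRep_mul_apply,
    ← outerRep_mul_apply, ← outerRep_mul_apply, outerRep_tmul (b := (1 : Uq P)),
    TensorProduct.map_tmul, map_one, Module.End.one_apply, hexp, hcartan, outerRep_tmul,
    TensorProduct.map_tmul, map_one, Module.End.one_apply, hKp]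
  rfl

end UqModule

namespace Presentation

variable {P : RootData} {U : Type u} [AddCommGroup U] [Module ℂ U]
  {ρ : uqPlus P →ₐ[ℂ] Module.End ℂ U}

theorem emb_E (π : Presentation ρ) (a : π.ι) (x : π.X a) :
    π.emb a ((π.X a).ρ (Uq.E P) x) = ρ (UqPlus.E P) (π.emb a x) := by
  rw [emb_apply, emb_apply, ← π.inc_isIntertwining a, UqModule.shift_E]

theorem emb_K (π : Presentation ρ) (a : π.ι) (x : π.X a) :
    Uq.zeta P (π.l a) • π.emb a ((π.X a).ρ (Uq.K P) x) = ρ (UqPlus.K P) (π.emb a x) := by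
  rw [emb_apply, emb_apply, ← π.inc_isIntertwining a, UqModule.shift_K, UqPlus.character_K,
    Uq.zeta_apply, map_smul]

theorem emb_injective (π : Presentation ρ) (a : π.ι) : Function.Injective (π.emb a) := by
  intro x y h
  have h1 := congrArg (π.proj a) h
  rw [emb_apply, emb_apply, π.proj_inc_self_apply, π.proj_inc_self_apply] at h1
  simpa using congrArg (TensorProduct.lid ℂ (π.X a)) h1

theorem exists_emb_ne_zero (π : Presentation ρ) (T : Module.End ℂ U) {u : U} (hu : T u ≠ 0) :
    ∃ a x, T (π.emb a x) ≠ 0 := by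
  by_contra! h
  apply hu
  exact π.emb_induction (p := fun u => T u = 0) (fun x y hx hy => by rw [map_add, hx, hy, add_zero])
    (map_zero T) h u

/-- In any decomposition of a one-dimensional module, a spanning vector comes from a summand
`S_l ⊗ X` with `X` trivial. -/
theorem exists_emb_eq_one (hd : Odd P.d) {ρ : uqPlus P →ₐ[ℂ] Module.End ℂ ℂ}
    (π : Presentation ρ) : ∃ a x, π.emb a x = 1 ∧ (π.X a).ρ (Uq.K P) x = x ∧
      (π.X a).ρ (Uq.F P) x = 0 := by
  obtain ⟨a, x, hx⟩ := π.exists_emb_ne_zero 1 (one_ne_zero (α := ℂ))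
  have hx' : π.emb a x ≠ 0 := hx
  have h1 : π.emb a ((π.emb a x)⁻¹ • x) = 1 := by
    rw [map_smul, smul_eq_mul, inv_mul_cancel₀ hx']
  refine ⟨a, (π.emb a x)⁻¹ • x, h1, UqModule.trivial_of_span hd _ ?_ fun y => ⟨π.emb a y, ?_⟩⟩
  · intro h0
    rw [h0, map_zero] at h1
    exact zero_ne_one h1
  · apply π.emb_injective a
    rw [map_smul, h1, smul_eq_mul, mul_one]

end Presentation

theorem UqPlus.simple_K (P : RootData) (l : ZMod P.d) (s : ℂ) :
    UqPlus.simple P l (UqPlus.K P) s = Uq.zeta P l * s := by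
  change UqPlus.character P l (UqPlus.K P) * s = _
  rw [UqPlus.character_K, Uq.zeta_apply]

theorem UqPlus.simple_E (P : RootData) (l : ZMod P.d) (s : ℂ) :
    UqPlus.simple P l (UqPlus.E P) s = 0 := by
  change UqPlus.character P l (UqPlus.E P) * s = _
  rw [UqPlus.character_E, zero_mul]

/-- Let `U` have a basis of weight vectors `v`, `w` with `E v = w` and `E w = 0`. In any
decomposition of `U`, the vector `w` comes from a vector of some summand `S_l ⊗ X` that `K`
multiplies, in `X`, by a scalar different from `1`. -/
theorem Presentation.exists_emb_eq_highest {P : RootData} (hd : Odd P.d) {U : Type u}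
    [AddCommGroup U] [Module ℂ U] {ρ : uqPlus P →ₐ[ℂ] Module.End ℂ U} (π : Presentation ρ)
    {v w : U} {c : ℂ} (hli : ∀ s t : ℂ, s • v + t • w = 0 → s = 0 ∧ t = 0)
    (hspan : ∀ u, ∃ s t : ℂ, u = s • v + t • w) (hv : ρ (UqPlus.E P) v = w)
    (hw : ρ (UqPlus.E P) w = 0) (hKv : ρ (UqPlus.K P) v = c • v)
    (hKw : ρ (UqPlus.K P) w = (c * P.q ^ 2) • w) :
    ∃ a x, ∃ k : ℂ, π.emb a x = w ∧ (π.X a).ρ (Uq.K P) x = k • x ∧ k ≠ 1 := by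
  have hw0 : w ≠ 0 := by
    rintro rfl
    exact one_ne_zero (hli 0 1 (by simp)).2
  obtain ⟨a, z, hz⟩ := π.exists_emb_ne_zero (ρ (UqPlus.E P)) (u := v) (by rwa [hv])
  obtain ⟨s, t, hst⟩ := hspan (π.emb a z)
  have hEz : ρ (UqPlus.E P) (π.emb a z) = s • w := by
    rw [hst, map_add, map_smul, map_smul, hv, hw, smul_zero, add_zero]
  have hs : s ≠ 0 := by
    rintro rfl
    exact hz (by rw [hEz, zero_smul])
  -- `v` and `w` both lie in the image of the `a`-th summand
  obtain ⟨x₁, hx₁⟩ : ∃ x₁, π.emb a x₁ = w := by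
    refine ⟨s⁻¹ • (π.X a).ρ (Uq.E P) z, ?_⟩
    rw [map_smul, π.emb_E, hEz, smul_smul, inv_mul_cancel₀ hs, one_smul]
  obtain ⟨x₀, hx₀⟩ : ∃ x₀, π.emb a x₀ = v := by
    refine ⟨s⁻¹ • (z - t • x₁), ?_⟩
    rw [map_smul, map_sub, map_smul, hx₁, hst, add_sub_cancel_right, smul_smul,
      inv_mul_cancel₀ hs, one_smul]
  have hζ : ∀ u : U, Uq.zeta P (-π.l a) • Uq.zeta P (π.l a) • u = u := by
    intro u
    rw [smul_smul, Uq.zeta_neg_mul, one_smul]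
  have hK₀ : (π.X a).ρ (Uq.K P) x₀ = (Uq.zeta P (-π.l a) * c) • x₀ := by
    apply π.emb_injective a
    rw [← hζ (π.emb a _), π.emb_K, hx₀, hKv, map_smul, hx₀, smul_smul]
  have hK₁ : (π.X a).ρ (Uq.K P) x₁ = (Uq.zeta P (-π.l a) * (c * P.q ^ 2)) • x₁ := by
    apply π.emb_injective a
    rw [← hζ (π.emb a _), π.emb_K, hx₁, hKw, map_smul, hx₁, smul_smul]
  have hE₀ : (π.X a).ρ (Uq.E P) x₀ = x₁ := by
    apply π.emb_injective a
    rw [π.emb_E, hx₀, hv, hx₁]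
  have hE₁ : (π.X a).ρ (Uq.E P) x₁ = 0 := by
    apply π.emb_injective a
    rw [π.emb_E, hx₁, hw, map_zero]
  have hx₀0 : x₀ ≠ 0 := by
    intro h
    rw [h, map_zero] at hx₀
    rw [← hx₀, map_zero] at hv
    exact hw0 hv.symm
  have hcoord : ∀ y, ∃ s t : ℂ, y = s • x₀ + t • x₁ := by
    intro y
    obtain ⟨s, t, h⟩ := hspan (π.emb a y)
    refine ⟨s, t, π.emb_injective a ?_⟩
    rw [h, map_add, map_smul, map_smul, hx₀, hx₁]
  refine ⟨a, x₁, _, hx₁, hK₁, fun hk => ?_⟩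
  -- If `K` fixes `x₁`, then `E F x₁ = 0`, so `F x₁` is a multiple of `x₁`. Hence the commutator of
  -- `E` and `F` sends `x₀` to a multiple of `x₁`, and to a multiple of `x₀`, so it vanishes on
  -- `x₀`. The weight of `x₀` is then `1` or `-1`, and `q ^ 4 = 1`, which contradicts that `d` is
  -- odd.
  obtain ⟨α, β, hF₁⟩ := hcoord ((π.X a).ρ (Uq.F P) x₁)
  obtain ⟨α', β', hF₀⟩ := hcoord ((π.X a).ρ (Uq.F P) x₀)
  have h1 := (π.X a).commutator_apply hK₁
  rw [hk, one_pow, sub_self, mul_zero, zero_smul, hE₁, map_zero, sub_zero, hF₁, map_add, map_smul,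
    map_smul, hE₀, hE₁, smul_zero, add_zero] at h1
  have hx₁0 : x₁ ≠ 0 := by
    intro h
    rw [h, map_zero] at hx₁
    exact hw0 hx₁.symm
  have hα := (smul_eq_zero.mp h1).resolve_right hx₁0
  have h0 := (π.X a).commutator_apply hK₀
  rw [hE₀, hF₁, hF₀, map_add, map_smul, map_smul, hE₀, hE₁, hα, zero_smul, zero_add, smul_zero,
    add_zero, ← sub_smul] at h0
  have h0' := congrArg (π.emb a) h0
  rw [map_smul, map_smul, hx₀, hx₁] at h0'
  have hz0 := (hli ((P.q - P.q⁻¹)⁻¹ * (Uq.zeta P (-π.l a) * c -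
    (Uq.zeta P (-π.l a) * c) ^ (P.d - 1))) (-(α' - β)) (by rw [← h0', neg_smul, add_neg_cancel])).1
  have hsq := UqModule.weight_sq_eq_one ((π.X a).weight_pow_d hx₀0 hK₀) hz0
  have hq4 : (P.q ^ 2) ^ 2 = 1 := by
    linear_combination ((Uq.zeta P (-π.l a) * (c * P.q ^ 2)) + 1) * hk - (P.q ^ 2) ^ 2 * hsq
  have hdvd := P.prim_sq.dvd_of_pow_eq_one 2 hq4
  have hle := Nat.le_of_dvd two_pos hdvd
  have hlt := P.one_lt_d
  obtain ⟨k, hk⟩ := hd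
  omega

/-- Take for `U'` the two-dimensional simple `u_q`-module, for `U` its highest weight line, for `f`
the inclusion and `V = S_1`. In any decompositions, the braiding with `V` only permutes the factors
on `U`, as `K` acts trivially on a one-dimensional `u_q`-module; on the image of `f` it is the flip
times `k⁻¹`, where `k ≠ 1` is the scalar of `exists_emb_eq_highest`. -/
theorem not_natural (P : RootData) (hd : Odd P.d) :
    ∃ (U U' V : Type) (_ : AddCommGroup U) (_ : Module ℂ U) (_ : AddCommGroup U')
      (_ : Module ℂ U') (_ : AddCommGroup V) (_ : Module ℂ V)
      (ρ : uqPlus P →ₐ[ℂ] Module.End ℂ U) (ρ' : uqPlus P →ₐ[ℂ] Module.End ℂ U')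
      (σ : uqPlus P →ₐ[ℂ] Module.End ℂ V) (f : U →ₗ[ℂ] U'),
      FiniteDimensional ℂ U ∧ FiniteDimensional ℂ U' ∧ FiniteDimensional ℂ V ∧
      IsIntertwining ρ ρ' f ∧
      ∀ (π : Presentation ρ) (π' : Presentation ρ') (κ : Presentation σ),
        f.lTensor V ∘ₗ π.braiding κ ≠ π'.braiding κ ∘ₗ f.rTensor V := by
  obtain ⟨t, ht⟩ := exists_half hd
  have hc : Uq.zeta P (-t) ^ P.d = 1 := by
    rw [Uq.zeta_apply]
    exact UqPlus.sq_pow_val_pow P _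
  have hc' : Uq.zeta P (-t) ^ 2 * (P.q ^ 2) ^ 1 = 1 := by
    rw [pow_one, ← Uq.zeta_one, pow_two, ← AddChar.map_add_eq_mul, ← AddChar.map_add_eq_mul,
      show -t + -t + 1 = 0 by rw [← ht]; ring, AddChar.map_zero_eq_one]
  have hct : Uq.zeta P (-t) * P.q ^ 2 = Uq.zeta P t := by
    rw [← Uq.zeta_one, ← AddChar.map_add_eq_mul, ← ht, neg_add_cancel_left]
  obtain ⟨X, e, hXE, hXK⟩ := UqModule.exists_uniserial.{0} P P.one_lt_d hc hc'
  let v : X := e.symm (Pi.single 0 1)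
  let w : X := e.symm (Pi.single 1 1)
  have hE : X.ρ (Uq.E P) v = w := by
    apply e.injective
    funext j
    rw [hXE]
    fin_cases j <;> simp [v, w]
  have hEw : X.ρ (Uq.E P) w = 0 := by
    apply e.injective
    funext j
    rw [hXE]
    fin_cases j <;> simp [w]
  have hKv : X.ρ (Uq.K P) v = Uq.zeta P (-t) • v := by
    apply e.injective
    funext j
    rw [hXK]
    fin_cases j <;> simp [v]
  have hKw : X.ρ (Uq.K P) w = (Uq.zeta P (-t) * P.q ^ 2) • w := by
    apply e.injective
    funext j
    rw [hXK]
    fin_cases j <;> simp [w]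
  have hw0 : w ≠ 0 := by simp [w]
  refine ⟨ℂ, X, ℂ, inferInstance, inferInstance, inferInstance, inferInstance, inferInstance,
    inferInstance, UqPlus.simple P t, X.res, UqPlus.simple P 1, LinearMap.toSpanSingleton ℂ X w,
    inferInstance, Module.Finite.equiv e.symm, inferInstance, ?_, ?_⟩
  · refine isIntertwining_of_generators (fun s => ?_) fun s => ?_
    · rw [UqPlus.simple_E, map_zero, LinearMap.toSpanSingleton_apply, map_smul]
      change 0 = s • X.ρ (Uq.E P) w
      rw [hEw, smul_zero]
    · rw [UqPlus.simple_K, LinearMap.toSpanSingleton_apply, LinearMap.toSpanSingleton_apply,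
        map_smul]
      change _ = s • X.ρ (Uq.K P) w
      rw [hKw, hct, smul_smul, mul_comm]
  · intro π π' κ h
    obtain ⟨a, x, hx, hxK, -⟩ := π.exists_emb_eq_one hd
    obtain ⟨b, y, hy, hyK, hyF⟩ := κ.exists_emb_eq_one hd
    obtain ⟨a', x', k, hx', hx'K, hk⟩ := π'.exists_emb_eq_highest hd (v := v) (w := w)
      (c := Uq.zeta P (-t))
      (fun s r hsr => by
        have h := congrArg e hsr
        have h0 := congrFun h 0
        have h1 := congrFun h 1
        simp [v, w] at h0 h1
        exact ⟨h0, h1⟩)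
      (fun u => ⟨e u 0, e u 1, by
        apply e.injective
        funext j
        fin_cases j <;> simp [v, w]⟩)
      hE hEw hKv hKw
    have hb : κ.l b = 1 := by
      have h1 := κ.emb_K b y
      rw [hyK, hy, UqPlus.simple_K, mul_one, smul_eq_mul, mul_one] at h1
      exact Uq.zeta_injective P h1
    have h1 := LinearMap.congr_fun h ((1 : ℂ) ⊗ₜ (1 : ℂ))
    have hl : π.braiding κ ((1 : ℂ) ⊗ₜ (1 : ℂ)) = (1 : ℂ) ⊗ₜ (1 : ℂ) := by
      have h2 := Presentation.braiding_emb π κ a b x y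
      have h3 := (π.X a).rho_pow_apply (c := 1) (hxK.trans (one_smul ℂ x).symm) (-κ.l b).val
      rw [one_pow, one_smul] at h3
      rw [UqModule.flipAct_shiftedR_of_trivial _ _ _ _ _ hyK hyF, TensorProduct.map_tmul, hx, hy,
        Uq.Kp, h3, hx] at h2
      exact h2
    have hr : π'.braiding κ (w ⊗ₜ (1 : ℂ)) = (1 : ℂ) ⊗ₜ (k ^ (P.d - 1) • w) := by
      have h2 := Presentation.braiding_emb π' κ a' b x' y
      rw [UqModule.flipAct_shiftedR_of_trivial _ _ _ _ _ hyK hyF, TensorProduct.map_tmul, hx', hy,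
        hb, Uq.Kp_neg_one, (π'.X a').rho_pow_apply hx'K, map_smul, hx'] at h2
      exact h2
    rw [LinearMap.comp_apply, LinearMap.comp_apply, hl, LinearMap.lTensor_tmul,
      LinearMap.rTensor_tmul, LinearMap.toSpanSingleton_apply, one_smul, hr] at h1
    have h2 := congrArg (TensorProduct.lid ℂ X) h1
    rw [TensorProduct.lid_tmul, TensorProduct.lid_tmul, one_smul, one_smul] at h2
    have h3 : (1 : ℂ) = k ^ (P.d - 1) :=
      smul_left_injective ℂ hw0 ((one_smul ℂ w).trans h2)
    have hx'0 : x' ≠ 0 := by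
      rintro rfl
      rw [map_zero] at hx'
      exact hw0 hx'.symm
    have hkd := (π'.X a').weight_pow_d hx'0 hx'K
    rw [← Nat.sub_add_cancel P.d_pos, pow_succ, ← h3, one_mul] at hkd
    exact hk hkd

end

theorem corollary4p2 (P : RootData) (hd : Odd P.d) :
    -- every finite-dimensional module has a decomposition, so that the isomorphisms are defined
    (∀ (U : Type u) [AddCommGroup U] [Module ℂ U] (ρ : uqPlus P →ₐ[ℂ] Module.End ℂ U),
      FiniteDimensional ℂ U → Nonempty (Presentation ρ)) ∧
    -- the maps `c_{U,V}` are isomorphisms of modules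
    (∀ (U V : Type u) [AddCommGroup U] [Module ℂ U] [AddCommGroup V] [Module ℂ V]
      (ρ : uqPlus P →ₐ[ℂ] Module.End ℂ U) (σ : uqPlus P →ₐ[ℂ] Module.End ℂ V)
      (π : Presentation ρ) (κ : Presentation σ),
      IsIntertwining (tensorRep ρ σ) (tensorRep σ ρ) (π.braiding κ) ∧
        Function.Bijective (π.braiding κ)) ∧
    (∀ (U V W : Type u) [AddCommGroup U] [Module ℂ U] [AddCommGroup V] [Module ℂ V]
      [AddCommGroup W] [Module ℂ W]
      (ρ : uqPlus P →ₐ[ℂ] Module.End ℂ U) (σ : uqPlus P →ₐ[ℂ] Module.End ℂ V)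
      (θ : uqPlus P →ₐ[ℂ] Module.End ℂ W)
      (π : Presentation ρ) (κ : Presentation σ) (μ : Presentation θ),
      -- `c_{U,V⊗W} = (id_V ⊗ c_{U,W}) (c_{U,V} ⊗ id_W)`
      (π.braiding (κ.tensor μ) =
        (TensorProduct.assoc ℂ V W U).symm.toLinearMap ∘ₗ (π.braiding μ).lTensor V ∘ₗ
          (TensorProduct.assoc ℂ V U W).toLinearMap ∘ₗ (π.braiding κ).rTensor W ∘ₗ
            (TensorProduct.assoc ℂ U V W).symm.toLinearMap) ∧
      -- `c_{U⊗V,W} = (c_{U,W} ⊗ id_V) (id_U ⊗ c_{V,W})`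
      ((π.tensor κ).braiding μ =
        (TensorProduct.assoc ℂ W U V).toLinearMap ∘ₗ (π.braiding μ).rTensor V ∘ₗ
          (TensorProduct.assoc ℂ U W V).symm.toLinearMap ∘ₗ (κ.braiding μ).lTensor U ∘ₗ
            (TensorProduct.assoc ℂ U V W).toLinearMap) ∧
      -- the braid relation
      ((π.braiding κ).lTensor W ∘ₗ (TensorProduct.assoc ℂ W U V).toLinearMap ∘ₗ
          (π.braiding μ).rTensor V ∘ₗ (TensorProduct.assoc ℂ U W V).symm.toLinearMap ∘ₗ
            (κ.braiding μ).lTensor U ∘ₗ (TensorProduct.assoc ℂ U V W).toLinearMap =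
        (TensorProduct.assoc ℂ W V U).toLinearMap ∘ₗ (κ.braiding μ).rTensor U ∘ₗ
          (TensorProduct.assoc ℂ V W U).symm.toLinearMap ∘ₗ (π.braiding μ).lTensor V ∘ₗ
            (TensorProduct.assoc ℂ V U W).toLinearMap ∘ₗ (π.braiding κ).rTensor W)) ∧
    -- whatever decompositions are chosen, naturality fails
    (∃ (U U' V : Type) (_ : AddCommGroup U) (_ : Module ℂ U) (_ : AddCommGroup U')
      (_ : Module ℂ U') (_ : AddCommGroup V) (_ : Module ℂ V)
      (ρ : uqPlus P →ₐ[ℂ] Module.End ℂ U) (ρ' : uqPlus P →ₐ[ℂ] Module.End ℂ U')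
      (σ : uqPlus P →ₐ[ℂ] Module.End ℂ V) (f : U →ₗ[ℂ] U'),
      FiniteDimensional ℂ U ∧ FiniteDimensional ℂ U' ∧ FiniteDimensional ℂ V ∧
      IsIntertwining ρ ρ' f ∧
      ∀ (π : Presentation ρ) (π' : Presentation ρ') (κ : Presentation σ),
        f.lTensor V ∘ₗ π.braiding κ ≠ π'.braiding κ ∘ₗ f.rTensor V) := by
  refine ⟨fun U _ _ ρ hU => nonempty_presentation_of_finrank hd _ U ρ hU rfl,
    fun U V _ _ _ _ ρ σ π κ => ⟨π.braiding_isIntertwining κ, π.braiding_bijective κ⟩,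
    fun U V W _ _ _ _ _ _ ρ σ θ π κ μ => ⟨?_, ?_, ?_⟩, not_natural P hd⟩
  · exact Presentation.braiding_tensor_right π κ μ
  · exact Presentation.braiding_tensor_left π κ μ
  · exact Presentation.braid_relation π κ μ
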